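/- **Theorem.** Let $d\ge 1$, $k\ge 1$, let $\mathcal D=\{D_1,\dots,D_k\}\subset\mathbb R^d$ be a set of $k$ distinct points, and let $l>0$ be a real number with $l\ge St(\mathcal D)$, where $St(\mathcal D)$ is the minimal length $\mathcal H^1(C)$ of a closed connected set $C\subset\mathbb R^d$ containing $\mathcal D$. A *metric graph* $\Gamma$ is a finite simple graph with vertices $V(\Gamma)=\{V_1,\dots,V_N\}$ and a length $l_{ij}=l_{ji}\ge 0$ for each edge $e_{ij}=\{V_i,V_j\}$; its total length is $l(\Gamma)=\sum_{i<j}l_{ij}$ (sum over the edges). A *function* $u$ on $\Gamma$ is a family of functions $u_{ij}$ on $[0,l_{ij}]$, one for each oriented edge, with $u_{ji}(x)=u_{ij}(l_{ij}-x)$ and with $u_{ij}(0)=u(V_i)$ independent of $j$. For $\mathcal V\subset V(\Gamma)$, $H^1_0(\Gamma;\mathcal V)$ is the space of the real functions $u$ on $\Gamma$ with $u_{ij}\in H^1([0,l_{ij}])$ (continuous representatives) for all edges and $u=0$ on $\mathcal V$, and $$\lambda_1(\Gamma;\mathcal V)=\min\Big\{\int_\Gamma|u'|^2\,dx\ :\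 u\in H^1_0(\Gamma;\mathcal V),\ \int_\Gamma u^2\,dx=1\Big\},\qquad \int_\Gamma f\,dx=\sum_{i<j}\int_0^{l_{ij}}f_{ij}\,dx .$$ An *immersion* $\gamma:\Gamma\to\mathbb R^d$ is an $\mathbb R^d$-valued function on $\Gamma$ such that each $\gamma_{ij}:[0,l_{ij}]\to\mathbb R^d$ is an injective curve parametrized by arc length. Then the problem $$\min\big\{\lambda_1(\Gamma;\mathcal V)\ :\ \Gamma \text{ a connected metric graph},\ l(\Gamma)=l,\ \mathcal V\subset V(\Gamma),\ \exists\,\gamma:\Gamma\to\mathbb R^d\text{ immersion with }\gamma(\mathcal V)=\mathcal D\big\}$$ has a solution: there are an admissible $\Gamma$ and $\mathcal V$ (with an immersion $\gamma$) such that the minimum defining $\lambda_1(\Gamma;\mathcal V)$ is attained and $\lambda_1(\Gamma;\mathcal V)\le\lambda_1(\Gamma';\mathcal V')$ for every admissible pair $(\Gamma',\mathcal V')$. Moreover, $\Gamma$ can be chosen to be a tree with at most $2k$ vertices and $2k-1$ edges. -/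

import Mathlib

open MeasureTheory
open scoped ENNReal

noncomputable section

/-- A metric graph: a finite combinatorial (simple, undirected) graph with vertices
`0, …, numV - 1`, together with a non-negative length for every edge `{i, j}`.
The values of `len` at pairs that are not edges play no role. -/
structure MetricGraph where
  numV : ℕ
  graph : SimpleGraph (Fin numV)
  len : Fin numV → Fin numV → ℝ
  len_symm : ∀ i j, len i j = len j i
  len_nonneg : ∀ i j, graph.Adj i j → 0 ≤ len i j

namespace MetricGraph

open Classical in
/-- The sum of `F i j` over all edges `{i, j}`, each edge being counted once (with `i < j`). -/
def edgeSum (Γ : MetricGraph) (F : Fin Γ.numV → Fin Γ.numV → ℝ) : ℝ :=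
  ∑ p ∈ Finset.univ.filter
    (fun p : Fin Γ.numV × Fin Γ.numV => p.1 < p.2 ∧ Γ.graph.Adj p.1 p.2), F p.1 p.2

/-- The total length of a metric graph. -/
def totalLength (Γ : MetricGraph) : ℝ := Γ.edgeSum Γ.len

/-- A function `Γ → X` on a metric graph: for every oriented edge `(i, j)` a function `edge i j` on
`[0, len i j]`, such that reversing the orientation reverses the parametrization, and such that
all the functions on the edges issuing from a vertex `i` have the same value `vert i` there.
The values of `edge i j` outside `[0, len i j]` play no role. -/
structure Fn (Γ : MetricGraph) (X : Type) where
  vert : Fin Γ.numV → X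
  edge : Fin Γ.numV → Fin Γ.numV → ℝ → X
  edge_zero : ∀ i j, Γ.graph.Adj i j → edge i j 0 = vert i
  edge_symm : ∀ i j, Γ.graph.Adj i j →
    ∀ x ∈ Set.Icc 0 (Γ.len i j), edge j i x = edge i j (Γ.len i j - x)

/-- `f ∈ H¹([0, L])`, for the continuous representative: `f` is absolutely continuous on `[0, L]`
and its derivative, which exists almost everywhere, is square integrable. -/
def IsH1 (f : ℝ → ℝ) (L : ℝ) : Prop :=
  AbsolutelyContinuousOnInterval f 0 L ∧ MemLp (deriv f) 2 (volume.restrict (Set.Icc 0 L))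

/-- `u ∈ H¹₀(Γ; W)`: `u` is in `H¹` on each edge, continuous on `Γ`, and zero at the vertices
in `W`. -/
def IsH10 (Γ : MetricGraph) (W : Set (Fin Γ.numV)) (u : Γ.Fn ℝ) : Prop :=
  (∀ i j, Γ.graph.Adj i j → IsH1 (u.edge i j) (Γ.len i j)) ∧ ∀ i ∈ W, u.vert i = 0

/-- `∫_Γ u² dx`. -/
def sqIntegral (Γ : MetricGraph) (u : Γ.Fn ℝ) : ℝ :=
  Γ.edgeSum fun i j => ∫ x in (0 : ℝ)..Γ.len i j, (u.edge i j x) ^ 2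

/-- `∫_Γ |u'|² dx`. -/
def gradSqIntegral (Γ : MetricGraph) (u : Γ.Fn ℝ) : ℝ :=
  Γ.edgeSum fun i j => ∫ x in (0 : ℝ)..Γ.len i j, (deriv (u.edge i j) x) ^ 2

/-- The set of the values `∫_Γ |u'|² dx`, for `u ∈ H¹₀(Γ; W)` with `∫_Γ u² dx = 1`. -/
def rayleighValues (Γ : MetricGraph) (W : Set (Fin Γ.numV)) : Set ℝ :=
  {e | ∃ u : Γ.Fn ℝ, IsH10 Γ W u ∧ Γ.sqIntegral u = 1 ∧ Γ.gradSqIntegral u = e}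

/-- The first Dirichlet eigenvalue `λ₁(Γ; W)` of `Γ` with Dirichlet conditions at the vertices
in `W`. -/
def lambda1 (Γ : MetricGraph) (W : Set (Fin Γ.numV)) : ℝ := sInf (Γ.rayleighValues W)

/-- `γ : Γ → ℝᵈ` is an immersion: on each edge it is an injective curve parametrized by
arc length. -/
def IsImmersion {d : ℕ} (Γ : MetricGraph) (γ : Γ.Fn (EuclideanSpace ℝ (Fin d))) : Prop :=
  ∀ i j, Γ.graph.Adj i j →
    Set.InjOn (γ.edge i j) (Set.Icc 0 (Γ.len i j)) ∧
      HasUnitSpeedOn (γ.edge i j) (Set.Icc 0 (Γ.len i j))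

/-- `(Γ, W)` is admissible for the points `S` and the length `l`: `Γ` is a connected metric graph
of total length `l` which has an immersion into `ℝᵈ` that maps `W` onto `S`. -/
def IsAdmissible {d : ℕ} (S : Set (EuclideanSpace ℝ (Fin d))) (l : ℝ)
    (Γ : MetricGraph) (W : Set (Fin Γ.numV)) : Prop :=
  Γ.graph.Connected ∧ Γ.totalLength = l ∧
    ∃ γ : Γ.Fn (EuclideanSpace ℝ (Fin d)), Γ.IsImmersion γ ∧ γ.vert '' W = S

end MetricGraph

/-- `St(S)`: the minimal length (one-dimensional Hausdorff measure) of a closed connected set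
containing `S`. -/
def steinerLength {d : ℕ} (S : Set (EuclideanSpace ℝ (Fin d))) : ℝ≥0∞ :=
  ⨅ (C : Set (EuclideanSpace ℝ (Fin d))) (_ : IsClosed C ∧ IsConnected C ∧ S ⊆ C),
    Measure.hausdorffMeasure 1 C

end

/-! Let Λ be the infimum of the Rayleigh quotients of all competitors. It is positive by the
Poincaré inequality `inv_le_of_mem_rayleighValues`, and scaling lengths by ω = √Λ turns it into 1.
On an interval of length h < π the least value of ∫ f'² - f² for given boundary values is the
explicit quantity `edgeEnergy`, so a competitor is encoded by finitely many data, a `Net`: a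
multigraph with lengths, and with positions and values of the vertices. Two relaxations are allowed.
An edge may be longer than the distance of its ends, and part of the length ℓ may stay unspent,
forming a reservoir at the base vertex where the function is constant. Neither is an advantage: an
edge with slack can be broken into two straight ones (`exists_tight`), and unspent length can be
used for pendant edges, which lowers the energy (`edgeEnergy_self_lt`). Hence, by the definition of
Λ, no valid simple net has negative energy, and a net of energy zero whose function is not zero
yields a minimizer (`exists_metricGraph`).

Existence of such a net is a compactness argument. A competitor with quotient close to Λ is cut into
short pieces, its values are divided by their maximum, and the base is put where the maximum is
attained (`exists_good_of_mem_rayleighValues`). Energies are capped from below by the energy of the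
constant function with the base value. Therefore an edge can be deleted without loss, its length
going to the reservoir. A net with the least number of edges is thus a tree whose leaves are
terminals or the base, and two short edges at a free vertex of degree two are merged. This bounds
the number of vertices (`IsMinimal.card_le`), and a limit exists (`exists_good_of_forall_pos`). The
same compactness with all values zero shows that an admissible graph exists at all: a connected set
of length at most l is covered by small sets, and chains of these sets give nets of length almost l.

For the bound 2k, the number of edges is minimized again, among nets whose edges are shorter than π
or have zero boundary values. Free vertices now have degree at least three. Exchange arguments
control an edge with slack: it descends from one of its ends v; no other edge at v descends
(`not_descending_of_slack`), since otherwise the two edges could be zipped together near v and the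
freed length moved to a reservoir at v; and v, if it is not the base, has degree at least four
(`four_le_card_incident`), since otherwise v could be slid along one of the two ascending edges
(`not_ascending_of_slack`). Charging every edge with slack to such an end, the degree count in the
tree gives |V| + |L| ≤ 2k, where L is the set of edges with slack. Straightening an edge of L costs
exactly one more vertex. -/

/-! ### The energy of an interval as a function of its length and boundary values. -/

noncomputable section

/-- The least energy `∫ f'² - f²` of a function on an interval of length `h < π` with the
boundary values `x` and `y`. -/
def edgeEnergy (h x y : ℝ) : ℝ := ((x ^ 2 + y ^ 2) * Real.cos h - 2 * x * y) / Real.sin h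

/-- The energy of an edge, cut off from below at the energy of the constant function `c`. -/
def cappedEnergy (c h x y : ℝ) : ℝ := max (edgeEnergy h x y) (-(c ^ 2 * h))

/-- The sinusoid `x cos t + s sin t`. -/
def sinusoid (x s t : ℝ) : ℝ := x * Real.cos t + s * Real.sin t

end

open Real

theorem edgeEnergy_comm (h x y : ℝ) : edgeEnergy h x y = edgeEnergy h y x := by
  unfold edgeEnergy; ring_nf

theorem cappedEnergy_comm (c h x y : ℝ) : cappedEnergy c h x y = cappedEnergy c h y x := by
  unfold cappedEnergy; rw [edgeEnergy_comm]

@[simp] theorem edgeEnergy_zero_zero (h : ℝ) : edgeEnergy h 0 0 = 0 := by simp [edgeEnergy]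

@[simp] theorem edgeEnergy_zero_length (x y : ℝ) : edgeEnergy 0 x y = 0 := by simp [edgeEnergy]

theorem edgeEnergy_smul (r h x y : ℝ) :
    edgeEnergy h (r * x) (r * y) = r ^ 2 * edgeEnergy h x y := by
  unfold edgeEnergy; ring

theorem sin_pos_of_length {h : ℝ} (h0 : 0 < h) (hp : h < π) : 0 < sin h :=
  sin_pos_of_pos_of_lt_pi h0 hp

theorem edgeEnergy_abs_le {h : ℝ} (h0 : 0 ≤ h) (hp : h ≤ π) (x y : ℝ) :
    edgeEnergy h |x| |y| ≤ edgeEnergy h x y := by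
  unfold edgeEnergy
  apply div_le_div_of_nonneg_right _ (sin_nonneg_of_nonneg_of_le_pi h0 hp)
  rw [sq_abs, sq_abs]
  have : x * y ≤ |x| * |y| := by rw [← abs_mul]; exact le_abs_self _
  linarith

@[simp] theorem sinusoid_zero (x s : ℝ) : sinusoid x s 0 = x := by simp [sinusoid]

theorem continuous_sinusoid (x s : ℝ) : Continuous (sinusoid x s) := by
  unfold sinusoid; fun_prop

theorem hasDerivAt_sinusoid (x s t : ℝ) : HasDerivAt (sinusoid x s) (sinusoid s (-x) t) t := by
  have := ((hasDerivAt_cos t).const_mul x).add ((hasDerivAt_sin t).const_mul s)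
  have e : sinusoid s (-x) t = x * -sin t + s * cos t := by unfold sinusoid; ring
  rw [e]
  exact this

/-- The energy of a sinusoid over an interval is a boundary term. -/
theorem edgeEnergy_sinusoid {a b : ℝ} (x s : ℝ) (h0 : 0 < b - a) (hp : b - a < π) :
    edgeEnergy (b - a) (sinusoid x s a) (sinusoid x s b) =
      sinusoid x s b * sinusoid s (-x) b - sinusoid x s a * sinusoid s (-x) a := by
  have h1 := (sin_pos_of_length h0 hp).ne'
  unfold edgeEnergy
  rw [div_eq_iff h1]
  unfold sinusoid
  rw [cos_sub, sin_sub]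
  have ha := sin_sq_add_cos_sq a
  have hb := sin_sq_add_cos_sq b
  have ha' : cos a ^ 2 = 1 - sin a ^ 2 := by linarith
  have hb' : cos b ^ 2 = 1 - sin b ^ 2 := by linarith
  have ha3 : cos a ^ 3 = cos a * (1 - sin a ^ 2) := by rw [← ha']; ring
  have hb3 : cos b ^ 3 = cos b * (1 - sin b ^ 2) := by rw [← hb']; ring
  ring_nf
  rw [ha3, hb3, ha', hb']
  ring

/-- The initial slope of the sinusoid with boundary values `x`, `y` on `[0, h]`. -/
theorem exists_sinusoid {h : ℝ} (h0 : 0 < h) (hp : h < π) (x y : ℝ) :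
    sinusoid x ((y - x * cos h) / sin h) h = y := by
  have h1 := (sin_pos_of_length h0 hp).ne'
  unfold sinusoid; field_simp; ring

/-- Cutting an edge at an interior point. -/
theorem edgeEnergy_split {t h : ℝ} (x s : ℝ) (h0 : 0 < t) (ht : t < h) (hp : h < π) :
    edgeEnergy h x (sinusoid x s h) =
      edgeEnergy t x (sinusoid x s t) + edgeEnergy (h - t) (sinusoid x s t) (sinusoid x s h) := by
  have e1 := edgeEnergy_sinusoid (a := 0) (b := h) x s (by linarith) (by linarith)
  have e2 := edgeEnergy_sinusoid (a := 0) (b := t) x s (by linarith) (by linarith)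
  have e3 := edgeEnergy_sinusoid (a := t) (b := h) x s (by linarith) (by linarith)
  simp only [sub_zero, sinusoid_zero] at e1 e2
  rw [e1, e2, e3]; ring

/-- The difference of the two sides is a square divided by a product of sines. The square vanishes
when `y` lies on the sinusoid from `x` to `z`. The conditions for length zero are needed because
`edgeEnergy 0` is zero by the convention for division. -/
theorem edgeEnergy_add_le {h₁ h₂ : ℝ} (h1 : 0 ≤ h₁) (h2 : 0 ≤ h₂) (hp : h₁ + h₂ < π) {x y z : ℝ}
    (e1 : h₁ = 0 → x = y) (e2 : h₂ = 0 → y = z) :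
    edgeEnergy (h₁ + h₂) x z ≤ edgeEnergy h₁ x y + edgeEnergy h₂ y z := by
  rcases h1.eq_or_lt with rfl | h1
  · simp [e1 rfl]
  rcases h2.eq_or_lt with rfl | h2
  · simp [e2 rfl]
  have s1 := sin_pos_of_length h1 (by linarith)
  have s2 := sin_pos_of_length h2 (by linarith)
  have s3 := sin_pos_of_length (by linarith : 0 < h₁ + h₂) hp
  have key : edgeEnergy h₁ x y + edgeEnergy h₂ y z - edgeEnergy (h₁ + h₂) x z =
      (y * sin (h₁ + h₂) - x * sin h₂ - z * sin h₁) ^ 2 /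
        (sin h₁ * sin h₂ * sin (h₁ + h₂)) := by
    unfold edgeEnergy
    rw [eq_div_iff (by positivity)]
    field_simp
    rw [sin_add, cos_add]
    have ha' : cos h₁ ^ 2 = 1 - sin h₁ ^ 2 := by linarith [sin_sq_add_cos_sq h₁]
    have hb' : cos h₂ ^ 2 = 1 - sin h₂ ^ 2 := by linarith [sin_sq_add_cos_sq h₂]
    ring_nf
    rw [ha', hb']
    ring
  have : 0 ≤ edgeEnergy h₁ x y + edgeEnergy h₂ y z - edgeEnergy (h₁ + h₂) x z := by
    rw [key]; positivity
  linarith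

theorem neg_le_cappedEnergy (c h x y : ℝ) : -(c ^ 2 * h) ≤ cappedEnergy c h x y := le_max_right _ _

theorem edgeEnergy_le_cappedEnergy (c h x y : ℝ) : edgeEnergy h x y ≤ cappedEnergy c h x y :=
  le_max_left _ _

/-- The cap is additive in the length, so subadditivity survives taking the maximum. -/
theorem cappedEnergy_add_le {c h₁ h₂ : ℝ} (h1 : 0 ≤ h₁) (h2 : 0 ≤ h₂) (hp : h₁ + h₂ < π)
    {x y z : ℝ} (e1 : h₁ = 0 → x = y) (e2 : h₂ = 0 → y = z) :
    cappedEnergy c (h₁ + h₂) x z ≤ cappedEnergy c h₁ x y + cappedEnergy c h₂ y z := by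
  refine max_le ?_ ?_
  · exact (edgeEnergy_add_le h1 h2 hp e1 e2).trans
      (add_le_add (edgeEnergy_le_cappedEnergy _ _ _ _) (edgeEnergy_le_cappedEnergy _ _ _ _))
  · have := neg_le_cappedEnergy c h₁ x y
    have := neg_le_cappedEnergy c h₂ y z
    linarith

theorem edgeEnergy_self {h : ℝ} (h0 : 0 < h) (hp : h < π) (y : ℝ) :
    edgeEnergy h y y = -(2 * y ^ 2 * tan (h / 2)) := by
  have h1 := (sin_pos_of_length h0 hp).ne'
  have h2 : cos (h / 2) ≠ 0 := (cos_pos_of_mem_Ioo ⟨by linarith, by linarith⟩).ne'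
  have h3 : sin (h / 2) ≠ 0 := (sin_pos_of_length (by linarith) (by linarith)).ne'
  unfold edgeEnergy
  rw [tan_eq_sin_div_cos, div_eq_iff h1]
  have e1 : cos h = 2 * cos (h / 2) ^ 2 - 1 := by rw [← cos_two_mul]; congr 1; ring
  have e2 : sin h = 2 * sin (h / 2) * cos (h / 2) := by rw [← sin_two_mul]; congr 1; ring
  rw [e1, e2]
  field_simp
  have := sin_sq_add_cos_sq (h / 2)
  have : sin (h / 2) ^ 2 = 1 - cos (h / 2) ^ 2 := by linarith
  rw [this]; ring

/-- As tan (h / 2) > h / 2, the optimal function beats the constant one. This makes it profitable to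
spend the reservoir on actual edges. -/
theorem edgeEnergy_self_lt {h y : ℝ} (h0 : 0 < h) (hp : h < π) (hy : y ≠ 0) :
    edgeEnergy h y y < -(h * y ^ 2) := by
  rw [edgeEnergy_self h0 hp]
  have := lt_tan (x := h / 2) (by linarith) (by linarith)
  have hy2 : 0 < y ^ 2 := by positivity
  nlinarith

theorem edgeEnergy_self_le {h : ℝ} (h0 : 0 < h) (hp : h < π) (y : ℝ) :
    edgeEnergy h y y ≤ -(h * y ^ 2) := by
  by_cases hy : y = 0
  · simp [hy]
  · exact (edgeEnergy_self_lt h0 hp hy).le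

/-- A short edge of bounded energy has close boundary values. -/
theorem sq_sub_le_of_edgeEnergy_le {h x y c B : ℝ} (h0 : 0 ≤ h) (hp : h ≤ π / 2)
    (e : h = 0 → x = y) (hx : x ^ 2 ≤ c) (hy : y ^ 2 ≤ c) (hB : edgeEnergy h x y ≤ B) (hB0 : 0 ≤ B) :
    (x - y) ^ 2 ≤ (B + 2 * c) * h := by
  rcases h0.eq_or_lt with rfl | h0
  · simp [e rfl]
  have s1 := sin_pos_of_length h0 (by linarith [pi_pos])
  unfold edgeEnergy at hB
  rw [div_le_iff₀ s1] at hB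
  -- The numerator of the energy is (x - y)² - (x² + y²)(1 - cos h), and this bound makes the second
  -- term of the order of sin h.
  have hc : 1 - cos h ≤ sin h := by
    have : 0 ≤ cos h := cos_nonneg_of_mem_Icc ⟨by linarith, hp⟩
    nlinarith [sin_sq_add_cos_sq h, cos_le_one h, sin_le_one h]
  have hs : sin h ≤ h := sin_le h0.le
  have hc0 : 0 ≤ 1 - cos h := by linarith [cos_le_one h]
  have c0 : 0 ≤ c := le_trans (sq_nonneg x) hx
  have : (x ^ 2 + y ^ 2) * (1 - cos h) ≤ (2 * c) * sin h := by
    apply mul_le_mul _ hc hc0 (by linarith)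
    linarith
  have h3 : (x - y) ^ 2 ≤ (B + 2 * c) * sin h := by nlinarith
  exact h3.trans (by gcongr)

/-! ### Nets, and the reductions which do not increase the capped energy. -/

noncomputable section

/-- `edgeEnergy` as a function of the unordered pair of the boundary values. -/
def symEnergy (h : ℝ) : Sym2 ℝ → ℝ := Sym2.lift ⟨edgeEnergy h, edgeEnergy_comm h⟩

/-- `cappedEnergy` as a function of the unordered pair of the boundary values. -/
def symCapped (c h : ℝ) : Sym2 ℝ → ℝ := Sym2.lift ⟨cappedEnergy c h, cappedEnergy_comm c h⟩

@[simp] theorem symEnergy_mk (h x y : ℝ) : symEnergy h s(x, y) = edgeEnergy h x y := rfl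

@[simp] theorem symCapped_mk (c h x y : ℝ) : symCapped c h s(x, y) = cappedEnergy c h x y := rfl

/-- A finite weighted multigraph with vertices of type `α`, mapped to `E`, with a real value and a
position for every vertex, `k` terminals and a base vertex. -/
structure Net (k : ℕ) (E α : Type) where
  edges : Multiset (Sym2 α × ℝ)
  pos : α → E
  val : α → ℝ
  term : Fin k → α
  base : α

/-- Two vertices are connected by edges of `m`. -/
def Conn {α : Type} (m : Multiset (Sym2 α × ℝ)) : α → α → Prop :=
  Relation.EqvGen fun a b => ∃ h, (s(a, b), h) ∈ m

namespace Conn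

variable {α β : Type} {m m' : Multiset (Sym2 α × ℝ)}

theorem refl (a : α) : Conn m a a := Relation.EqvGen.refl a

theorem symm {a b : α} (h : Conn m a b) : Conn m b a := Relation.EqvGen.symm _ _ h

theorem trans {a b c : α} (h : Conn m a b) (h' : Conn m b c) : Conn m a c :=
  Relation.EqvGen.trans _ _ _ h h'

theorem of_mem {a b : α} {h : ℝ} (hm : (s(a, b), h) ∈ m) : Conn m a b :=
  Relation.EqvGen.rel _ _ ⟨h, hm⟩

/-- The form in which connectedness is carried through every modification of a net: it suffices to
treat single edges, and `f` may collapse vertices. -/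
theorem map {m' : Multiset (Sym2 β × ℝ)} (f : α → β)
    (hf : ∀ a b h, (s(a, b), h) ∈ m → Conn m' (f a) (f b)) {a b : α} (h : Conn m a b) :
    Conn m' (f a) (f b) := by
  induction h with
  | rel a b h => obtain ⟨x, hx⟩ := h; exact hf _ _ _ hx
  | refl a => exact refl _
  | symm a b _ ih => exact ih.symm
  | trans a b c _ _ ih1 ih2 => exact ih1.trans ih2

theorem mono (hm : ∀ e ∈ m, e ∈ m') {a b : α} (h : Conn m a b) : Conn m' a b :=
  h.map (m' := m') id fun _ _ _ hx => of_mem (hm _ hx)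

theorem map_cons {m' : Multiset (Sym2 β × ℝ)} (f : α → β) {i j : α} {h : ℝ}
    (h1 : Conn m' (f i) (f j))
    (hf : ∀ a b x, (s(a, b), x) ∈ m → Conn m' (f a) (f b)) :
    ∀ a b x, (s(a, b), x) ∈ (s(i, j), h) ::ₘ m → Conn m' (f a) (f b) := by
  intro a b x hx
  rcases Multiset.mem_cons.1 hx with hx | hx
  · have := (Prod.ext_iff.1 hx).1
    rcases Sym2.eq_iff.1 this with ⟨rfl, rfl⟩ | ⟨rfl, rfl⟩
    · exact h1
    · exact h1.symm
  · exact hf _ _ _ hx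

end Conn

/-- The conditions on a single edge: its length is at least the distance between its ends, edges
of length zero have equal boundary values, and `P` holds for the length and the values. -/
def EdgeOk {E α : Type} [NormedAddCommGroup E] (P : ℝ → ℝ → ℝ → Prop) (pos : α → E) (val : α → ℝ)
    (e : Sym2 α × ℝ) : Prop :=
  ∀ i j, e.1 = s(i, j) →
    dist (pos i) (pos j) ≤ e.2 ∧ (e.2 = 0 → val i = val j) ∧ P e.2 (val i) (val j)

/-- `P` is symmetric in the two boundary values. -/
def SymmCond (P : ℝ → ℝ → ℝ → Prop) : Prop := ∀ h x y, P h x y → P h y x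

theorem EdgeOk.mk {E α : Type} [NormedAddCommGroup E] {P : ℝ → ℝ → ℝ → Prop} (hP : SymmCond P)
    {pos : α → E} {val : α → ℝ} {i j : α} {h : ℝ} (h1 : dist (pos i) (pos j) ≤ h)
    (h2 : h = 0 → val i = val j) (h3 : P h (val i) (val j)) : EdgeOk P pos val (s(i, j), h) := by
  intro a b hab
  rcases Sym2.eq_iff.1 hab with ⟨rfl, rfl⟩ | ⟨rfl, rfl⟩
  · exact ⟨h1, h2, h3⟩
  · exact ⟨by rwa [dist_comm], fun h => (h2 h).symm, hP _ _ _ h3⟩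

theorem EdgeOk.congr {E α : Type} [NormedAddCommGroup E] {P : ℝ → ℝ → ℝ → Prop}
    {pos pos' : α → E} {val val' : α → ℝ} {e : Sym2 α × ℝ} (h : EdgeOk P pos val e)
    (h1 : ∀ v ∈ e.1, pos' v = pos v) (h2 : ∀ v ∈ e.1, val' v = val v) : EdgeOk P pos' val' e := by
  intro a b hab
  have ha : a ∈ e.1 := by rw [hab]; exact Sym2.mem_mk_left _ _
  have hb : b ∈ e.1 := by rw [hab]; exact Sym2.mem_mk_right _ _
  rw [h1 a ha, h1 b hb, h2 a ha, h2 b hb]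
  exact h a b hab

theorem EdgeOk.mono {E α : Type} [NormedAddCommGroup E] {P P' : ℝ → ℝ → ℝ → Prop}
    {pos : α → E} {val : α → ℝ} {e : Sym2 α × ℝ} (h : EdgeOk P pos val e)
    (hP : ∀ h x y, P h x y → P' h x y) : EdgeOk P' pos val e :=
  fun i j hij => ⟨(h i j hij).1, (h i j hij).2.1, hP _ _ _ (h i j hij).2.2⟩

theorem EdgeOk.length_nonneg {E α : Type} [NormedAddCommGroup E] {P : ℝ → ℝ → ℝ → Prop}
    {pos : α → E} {val : α → ℝ} {e : Sym2 α × ℝ} (h : EdgeOk P pos val e) : 0 ≤ e.2 := by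
  induction he : e.1 using Sym2.ind with
  | _ i j => exact dist_nonneg.trans (h i j he).1

namespace Net

variable {k : ℕ} {E α β : Type}

/-- The total length of a net. -/
def total (G : Net k E α) : ℝ := (G.edges.map Prod.snd).sum

/-- The energy of a net in which the length which remains from `ℓ` carries the constant value of
the base vertex. -/
def energy (ℓ : ℝ) (G : Net k E α) : ℝ :=
  (G.edges.map fun e => symEnergy e.2 (e.1.map G.val)).sum - (ℓ - G.total) * G.val G.base ^ 2

/-- The energy of a net with capped edge energies. -/
def capped (c ℓ : ℝ) (G : Net k E α) : ℝ :=
  (G.edges.map fun e => symCapped c e.2 (e.1.map G.val)).sum - (ℓ - G.total) * c ^ 2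

variable [NormedAddCommGroup E]

/-- Only an inequality between lengths and distances is required, so the class is stable under
merging of edges and under limits. Vertices outside the component of the base are irrelevant, which
allows `ℕ` as a universal vertex type. -/
structure Valid (D : Fin k → E) (P : ℝ → ℝ → ℝ → Prop) (ℓ : ℝ) (G : Net k E α) : Prop where
  edge_ok : ∀ e ∈ G.edges, EdgeOk P G.pos G.val e
  conn_edge : ∀ e ∈ G.edges, ∀ v ∈ e.1, Conn G.edges G.base v
  conn_term : ∀ a, Conn G.edges G.base (G.term a)
  pos_term : ∀ a, G.pos (G.term a) = D a
  val_term : ∀ a, G.val (G.term a) = 0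
  total_le : G.total ≤ ℓ

/-- The base has the greatest admissible value `c`, so a unit of length in the reservoir has energy
-c², the least which the cap permits on an edge. The case c = 1 serves the eigenvalue problem, and c
= 0 the existence of a connecting net. -/
structure Good (D : Fin k → E) (P : ℝ → ℝ → ℝ → Prop) (c ℓ η : ℝ) (G : Net k E α) : Prop
    extends G.Valid D P ℓ where
  val_nonneg : ∀ v, 0 ≤ G.val v
  val_le : ∀ v, G.val v ≤ c
  val_base : G.val G.base = c
  capped_le : G.capped c ℓ ≤ η

/-- A good net with the least number of edges. -/
def IsMinimal (D : Fin k → E) (P : ℝ → ℝ → ℝ → Prop) (c ℓ η : ℝ) (G : Net k E α) : Prop :=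
  G.Good D P c ℓ η ∧ ∀ G' : Net k E α, G'.Good D P c ℓ η → G.edges.card ≤ G'.edges.card

theorem exists_isMinimal {D : Fin k → E} {P : ℝ → ℝ → ℝ → Prop} {c ℓ η : ℝ} {G : Net k E α}
    (hG : G.Good D P c ℓ η) : ∃ G' : Net k E α, G'.IsMinimal D P c ℓ η := by
  have := WellFounded.has_min (measure fun G : Net k E α => G.edges.card).wf
    {G | G.Good D P c ℓ η} ⟨G, hG⟩
  obtain ⟨G', h1, h2⟩ := this
  exact ⟨G', h1, fun G'' h => not_lt.1 (h2 G'' h)⟩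

theorem Valid.mono {D : Fin k → E} {P P' : ℝ → ℝ → ℝ → Prop} {ℓ : ℝ} {G : Net k E α}
    (hG : G.Valid D P ℓ) (hP : ∀ h x y, P h x y → P' h x y) : G.Valid D P' ℓ :=
  { hG with edge_ok := fun e he => (hG.edge_ok e he).mono hP }

theorem Valid.length_nonneg {D : Fin k → E} {P : ℝ → ℝ → ℝ → Prop} {ℓ : ℝ} {G : Net k E α}
    (hG : G.Valid D P ℓ) {e : Sym2 α × ℝ} (he : e ∈ G.edges) : 0 ≤ e.2 :=
  (hG.edge_ok e he).length_nonneg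

section Reductions

variable {D : Fin k → E} {P : ℝ → ℝ → ℝ → Prop} {c ℓ η : ℝ} {G : Net k E α}

/-- In a minimal net every edge is a bridge. -/
theorem IsMinimal.not_conn (hG : G.IsMinimal D P c ℓ η) {i j : α} {h : ℝ}
    {r : Multiset (Sym2 α × ℝ)} (hr : G.edges = (s(i, j), h) ::ₘ r) : ¬ Conn r i j := by
  intro hc
  have hV := hG.1.toValid
  have hmap : ∀ a b x, (s(a, b), x) ∈ G.edges → Conn r a b := by
    rw [hr]; exact Conn.map_cons id hc fun a b x hx => Conn.of_mem hx
  have hsub : ∀ e ∈ r, e ∈ G.edges := fun e he => by rw [hr]; exact Multiset.mem_cons_of_mem he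
  have hh : 0 ≤ h := hV.length_nonneg (e := (s(i, j), h)) (by rw [hr]; exact Multiset.mem_cons_self _ _)
  have htot : G.total = h + (r.map Prod.snd).sum := by simp [total, hr]
  have hcap := hG.1.capped_le
  have := hG.2 { G with edges := r }
    { edge_ok := fun e he => hV.edge_ok e (hsub e he)
      conn_edge := fun e he v hv => (hV.conn_edge e (hsub e he) v hv).map id hmap
      conn_term := fun a => (hV.conn_term a).map id hmap
      pos_term := hV.pos_term
      val_term := hV.val_term
      total_le := by
        have := hV.total_le
        have e : ({ G with edges := r } : Net k E α).total = (r.map Prod.snd).sum := rfl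
        rw [e]; linarith
      val_nonneg := hG.1.val_nonneg
      val_le := hG.1.val_le
      val_base := hG.1.val_base
      capped_le := by
        refine le_trans ?_ hcap
        simp only [capped, total, hr, Multiset.map_cons, Multiset.sum_cons, Sym2.map_mk,
          symCapped_mk]
        -- The deleted length moves to the reservoir, where its energy -c²h is at most that of the
        -- deleted edge.
        have := neg_le_cappedEnergy c h (G.val i) (G.val j)
        nlinarith }
  rw [hr] at this
  simp at this

theorem IsMinimal.ne_of_mem (hG : G.IsMinimal D P c ℓ η) {i j : α} {h : ℝ}
    (he : (s(i, j), h) ∈ G.edges) : i ≠ j := by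
  obtain ⟨r, hr⟩ := Multiset.exists_cons_of_mem he
  rintro rfl
  exact hG.not_conn hr (Conn.refl _)

theorem IsMinimal.not_isDiag (hG : G.IsMinimal D P c ℓ η) {e : Sym2 α × ℝ}
    (he : e ∈ G.edges) : ¬ e.1.IsDiag := by
  obtain ⟨e, h⟩ := e
  induction e using Sym2.ind with
  | _ i j => exact fun hd => hG.ne_of_mem he (by simpa using hd)

/-- Each of two parallel edges connects the ends of the other one, so neither is a bridge. -/
theorem IsMinimal.nodup (hG : G.IsMinimal D P c ℓ η) : (G.edges.map Prod.fst).Nodup := by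
  rw [Multiset.nodup_iff_le]
  intro e he
  have h2 : 2 ≤ (G.edges.map Prod.fst).card := by simpa using Multiset.card_le_card he
  have hmem : e ∈ G.edges.map Prod.fst := Multiset.mem_of_le he (by simp)
  obtain ⟨⟨e', h⟩, hx, rfl⟩ := Multiset.mem_map.1 hmem
  obtain ⟨r, hr⟩ := Multiset.exists_cons_of_mem hx
  rw [hr, Multiset.map_cons, Multiset.cons_le_cons_iff] at he
  replace he := Multiset.mem_of_le he (Multiset.mem_cons_self _ _)
  obtain ⟨⟨e'', h'⟩, hx', h3⟩ := Multiset.mem_map.1 he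
  induction e' using Sym2.ind with
  | _ i j =>
    simp only at h3
    subst h3
    exact hG.not_conn hr (Conn.of_mem hx')

variable [DecidableEq α]

/-- In a minimal net every leaf is a terminal or the base vertex. -/
theorem IsMinimal.not_leaf (hG : G.IsMinimal D P c ℓ η) {v w : α} {h : ℝ}
    {r : Multiset (Sym2 α × ℝ)} (hr : G.edges = (s(v, w), h) ::ₘ r) (hvr : ∀ e ∈ r, v ∉ e.1)
    (hb : v ≠ G.base) (ht : ∀ a, v ≠ G.term a) : False := by
  have hV := hG.1.toValid
  -- Folding the leaf onto its neighbour carries connections in the net to connections by the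
  -- remaining edges.
  set f : α → α := Function.update id v w with hf
  have fv : f v = w := by simp [hf]
  have fne : ∀ x, x ≠ v → f x = x := fun x hx => by simp [hf, hx]
  have fw : f w = w := by
    by_cases hw : w = v
    · rw [hw, fv, hw]
    · exact fne w hw
  have hmap : ∀ a b x, (s(a, b), x) ∈ G.edges → Conn r (f a) (f b) := by
    rw [hr]
    refine Conn.map_cons f (by rw [fv, fw]; exact Conn.refl _) fun a b x hx => ?_
    have h1 := hvr _ hx
    simp only [Sym2.mem_iff, not_or] at h1
    rw [fne a (Ne.symm h1.1), fne b (Ne.symm h1.2)]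
    exact Conn.of_mem hx
  have hconn : ∀ x, x ≠ v → Conn G.edges G.base x → Conn r G.base x := by
    intro x hx hc
    have := hc.map f hmap
    rwa [fne x hx, fne _ hb.symm] at this
  have hsub : ∀ e ∈ r, e ∈ G.edges := fun e he => by rw [hr]; exact Multiset.mem_cons_of_mem he
  have hh : 0 ≤ h := hV.length_nonneg (e := (s(v, w), h)) (by rw [hr]; exact Multiset.mem_cons_self _ _)
  have htot : G.total = h + (r.map Prod.snd).sum := by simp [total, hr]
  have hcap := hG.1.capped_le
  have := hG.2 { G with edges := r }
    { edge_ok := fun e he => hV.edge_ok e (hsub e he)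
      conn_edge := fun e he x hx => hconn x (fun hxv => hvr e he (hxv ▸ hx))
        (hV.conn_edge e (hsub e he) x hx)
      conn_term := fun a => hconn _ (ht a).symm (hV.conn_term a)
      pos_term := hV.pos_term
      val_term := hV.val_term
      total_le := by
        have := hV.total_le
        have e : ({ G with edges := r } : Net k E α).total = (r.map Prod.snd).sum := rfl
        rw [e]; linarith
      val_nonneg := hG.1.val_nonneg
      val_le := hG.1.val_le
      val_base := hG.1.val_base
      capped_le := by
        refine le_trans ?_ hcap
        simp only [capped, total, hr, Multiset.map_cons, Multiset.sum_cons, Sym2.map_mk,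
          symCapped_mk]
        have := neg_le_cappedEnergy c h (G.val v) (G.val w)
        nlinarith }
  rw [hr] at this
  simp at this

/-- In a minimal net two edges at a vertex of degree two which is neither a terminal nor the base
vertex cannot be replaced by a single edge. -/
theorem IsMinimal.not_merge (hP : SymmCond P) (hG : G.IsMinimal D P c ℓ η) {i v j : α} {h₁ h₂ : ℝ}
    {r : Multiset (Sym2 α × ℝ)} (hr : G.edges = (s(i, v), h₁) ::ₘ (s(v, j), h₂) ::ₘ r)
    (hvr : ∀ e ∈ r, v ∉ e.1) (hb : v ≠ G.base) (ht : ∀ a, v ≠ G.term a)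
    (hok : P (h₁ + h₂) (G.val i) (G.val j))
    (hle : cappedEnergy c (h₁ + h₂) (G.val i) (G.val j) ≤
      cappedEnergy c h₁ (G.val i) (G.val v) + cappedEnergy c h₂ (G.val v) (G.val j)) : False := by
  have hV := hG.1.toValid
  have m1 : (s(i, v), h₁) ∈ G.edges := by rw [hr]; simp
  have m2 : (s(v, j), h₂) ∈ G.edges := by rw [hr]; simp
  have iv : i ≠ v := hG.ne_of_mem m1
  have jv : v ≠ j := hG.ne_of_mem m2
  have k1 := hV.edge_ok _ m1 i v rfl
  have k2 := hV.edge_ok _ m2 v j rfl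
  have n1 : 0 ≤ h₁ := hV.length_nonneg m1
  have n2 : 0 ≤ h₂ := hV.length_nonneg m2
  -- Collapsing `v` to `i` makes the first edge trivial and turns the second one into the merged
  -- edge.
  set f : α → α := Function.update id v i with hf
  have fv : f v = i := by simp [hf]
  have fne : ∀ x, x ≠ v → f x = x := fun x hx => by simp [hf, hx]
  set r' := (s(i, j), h₁ + h₂) ::ₘ r with hr'
  have hmap : ∀ a b x, (s(a, b), x) ∈ G.edges → Conn r' (f a) (f b) := by
    rw [hr]
    refine Conn.map_cons f (by rw [fv, fne i iv]; exact Conn.refl _)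
      (Conn.map_cons f (by rw [fv, fne j jv.symm]; exact Conn.of_mem (Multiset.mem_cons_self _ _))
        fun a b x hx => ?_)
    have h1 := hvr _ hx
    simp only [Sym2.mem_iff, not_or] at h1
    rw [fne a (Ne.symm h1.1), fne b (Ne.symm h1.2)]
    exact Conn.of_mem (Multiset.mem_cons_of_mem hx)
  have hconn : ∀ x, x ≠ v → Conn G.edges G.base x → Conn r' G.base x := by
    intro x hx hc
    have := hc.map f hmap
    rwa [fne x hx, fne _ hb.symm] at this
  have hsub : ∀ e ∈ r, e ∈ G.edges := fun e he => by rw [hr]; simp [he]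
  have htot : (r'.map Prod.snd).sum = G.total := by simp [total, hr, hr']; ring
  have hcap := hG.1.capped_le
  have := hG.2 { G with edges := r' }
    { edge_ok := fun e he => by
        rcases Multiset.mem_cons.1 he with rfl | he
        · refine EdgeOk.mk hP ((dist_triangle _ (G.pos v) _).trans (add_le_add k1.1 k2.1))
            (fun h0 => ?_) hok
          have e1 : h₁ = 0 := by linarith
          have e2 : h₂ = 0 := by linarith
          exact (k1.2.1 e1).trans (k2.2.1 e2)
        · exact hV.edge_ok e (hsub e he)
      conn_edge := fun e he x hx => by
        rcases Multiset.mem_cons.1 he with rfl | he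
        · rcases Sym2.mem_iff.1 hx with rfl | rfl
          · exact hconn _ iv (hV.conn_edge _ m1 _ (Sym2.mem_mk_left _ _))
          · exact hconn _ jv.symm (hV.conn_edge _ m2 _ (Sym2.mem_mk_right _ _))
        · exact hconn x (fun hxv => hvr e he (hxv ▸ hx)) (hV.conn_edge e (hsub e he) x hx)
      conn_term := fun a => hconn _ (ht a).symm (hV.conn_term a)
      pos_term := hV.pos_term
      val_term := hV.val_term
      total_le := by
        have := hV.total_le
        have e : ({ G with edges := r' } : Net k E α).total = (r'.map Prod.snd).sum := rfl
        rw [e, htot]; exact this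
      val_nonneg := hG.1.val_nonneg
      val_le := hG.1.val_le
      val_base := hG.1.val_base
      capped_le := by
        refine le_trans ?_ hcap
        have e : ({ G with edges := r' } : Net k E α).total = G.total := htot
        simp only [capped, e]
        simp only [hr, hr', Multiset.map_cons, Multiset.sum_cons, Sym2.map_mk, symCapped_mk]
        linarith }
  rw [hr, hr'] at this
  simp at this

end Reductions

end Net

end

/-! ### Degree counts, and the simple graph of a net. -/

noncomputable section

/-- The simple graph on `Fin n` of a multigraph whose vertices are enumerated by `σ`. -/
def indexGraph {α : Type} {n : ℕ} (σ : Fin n → α) (m : Multiset (Sym2 α × ℝ)) :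
    SimpleGraph (Fin n) :=
  SimpleGraph.fromEdgeSet {e | e.map σ ∈ m.map Prod.fst}

/-- The edges at a vertex. -/
def incident {α : Type} [DecidableEq α] (m : Multiset (Sym2 α × ℝ)) (v : α) :
    Multiset (Sym2 α × ℝ) := m.filter fun e => v ∈ e.1

section Multigraph

variable {α : Type} [DecidableEq α] {m : Multiset (Sym2 α × ℝ)}

/-- Double counting: an edge which is not a loop occurs at exactly two vertices. General weights are
needed in `IsMinimal.card_le`, where long edges must count for more. -/
theorem sum_incident (V : Finset α) (hV : ∀ e ∈ m, ∀ v ∈ e.1, v ∈ V)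
    (hd : ∀ e ∈ m, ¬ e.1.IsDiag) (w : Sym2 α × ℝ → ℝ) :
    ∑ v ∈ V, ((incident m v).map w).sum = 2 * (m.map w).sum := by
  induction m using Multiset.induction with
  | empty => simp [incident]
  | cons e m ih =>
    have ih' := ih (fun e he => hV e (Multiset.mem_cons_of_mem he))
      (fun e he => hd e (Multiset.mem_cons_of_mem he))
    have h1 : ∀ v, ((incident (e ::ₘ m) v).map w).sum =
        (if v ∈ e.1.toFinset then w e else 0) + ((incident m v).map w).sum := by
      intro v
      unfold incident
      rw [Multiset.filter_cons]
      by_cases hv : v ∈ e.1 <;> simp [hv]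
    rw [Finset.sum_congr rfl fun v _ => h1 v, Finset.sum_add_distrib, ih', Finset.sum_ite_mem,
      Multiset.map_cons, Multiset.sum_cons, Finset.sum_const]
    have h2 : V ∩ e.1.toFinset = e.1.toFinset := by
      apply Finset.inter_eq_right.2
      intro v hv
      exact hV e (Multiset.mem_cons_self _ _) v (Sym2.mem_toFinset.1 hv)
    rw [h2, Sym2.card_toFinset_of_not_isDiag _ (hd e (Multiset.mem_cons_self _ _))]
    simp; ring

theorem sum_incident_card (V : Finset α) (hV : ∀ e ∈ m, ∀ v ∈ e.1, v ∈ V)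
    (hd : ∀ e ∈ m, ¬ e.1.IsDiag) : ∑ v ∈ V, (incident m v).card = 2 * m.card := by
  have := sum_incident V hV hd fun _ => 1
  simp only [Multiset.map_const', Multiset.sum_replicate, mul_one, nsmul_eq_mul] at this
  exact_mod_cast this

theorem eq_add_of_incident_eq {v : α} {t : Multiset (Sym2 α × ℝ)} (h : incident m v = t) :
    ∃ r, m = t + r ∧ ∀ e ∈ r, v ∉ e.1 :=
  ⟨m.filter fun e => v ∉ e.1, by rw [← h, incident, Multiset.filter_add_not],
    fun e he => (Multiset.mem_filter.1 he).2⟩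

theorem mem_incident {v : α} {e : Sym2 α × ℝ} : e ∈ incident m v ↔ e ∈ m ∧ v ∈ e.1 :=
  Multiset.mem_filter

theorem exists_mem_incident {v : α} {e : Sym2 α × ℝ} (h : e ∈ incident m v) :
    ∃ w, e = (s(v, w), e.2) := by
  obtain ⟨w, hw⟩ := Sym2.mem_iff_exists.1 (mem_incident.1 h).2
  exact ⟨w, by rw [← hw]⟩

/-- If no edge ended at `b`, the property of being equal to `b` would be invariant under connection.
-/
theorem Conn.incident_ne_zero {a b : α} (h : Conn m a b) (hab : a ≠ b) : incident m b ≠ 0 := by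
  intro h0
  have hn : ∀ e ∈ m, b ∉ e.1 := fun e he hb => by
    have : e ∈ incident m b := mem_incident.2 ⟨he, hb⟩
    rw [h0] at this
    simp at this
  have : (a = b ↔ b = b) := by
    refine Relation.EqvGen.rec (motive := fun x y _ => (x = b ↔ y = b)) ?_ ?_ ?_ ?_ h
    · rintro x y ⟨z, hz⟩
      have := hn _ hz
      simp only [Sym2.mem_iff, not_or] at this
      exact ⟨fun h => (this.1 h.symm).elim, fun h => (this.2 h.symm).elim⟩
    · intro x; rfl
    · intro x y _ h; exact h.symm
    · intro x y z _ _ h1 h2; exact h1.trans h2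
  exact hab (this.2 rfl)

variable {n : ℕ} {σ : Fin n → α} (hσ : Function.Injective σ)

omit [DecidableEq α] in
theorem indexGraph_adj {a b : Fin n} :
    (indexGraph σ m).Adj a b ↔ (∃ h, (s(σ a, σ b), h) ∈ m) ∧ a ≠ b := by
  simp [indexGraph, SimpleGraph.fromEdgeSet_adj]

include hσ in
theorem reachable_of_conn (hV : ∀ e ∈ m, ∀ v ∈ e.1, v ∈ Set.range σ) {a b : Fin n}
    (h : Conn m (σ a) (σ b)) : (indexGraph σ m).Reachable a b := by
  classical
  -- A left inverse of `σ`. The default value `a` plays no role, since edges do not leave the range.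
  let f : α → Fin n := fun v => if hv : v ∈ Set.range σ then hv.choose else a
  have hf : ∀ i, f (σ i) = i := fun i => by
    have : σ i ∈ Set.range σ := ⟨i, rfl⟩
    simp only [f, dif_pos this]
    exact hσ this.choose_spec
  suffices H : ∀ x y, Conn m x y → (indexGraph σ m).Reachable (f x) (f y) by
    have := H _ _ h
    rwa [hf, hf] at this
  intro x y h
  induction h with
  | rel x y h =>
    obtain ⟨z, hz⟩ := h
    obtain ⟨i, rfl⟩ := hV _ hz x (Sym2.mem_mk_left _ _)
    obtain ⟨j, rfl⟩ := hV _ hz y (Sym2.mem_mk_right _ _)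
    rw [hf, hf]
    by_cases hij : i = j
    · rw [hij]
    · exact SimpleGraph.Adj.reachable (indexGraph_adj.2 ⟨⟨z, hz⟩, hij⟩)
  | refl x => exact SimpleGraph.Reachable.refl _
  | symm x y _ ih => exact ih.symm
  | trans x y z _ _ ih1 ih2 => exact ih1.trans ih2

omit [DecidableEq α] in
theorem conn_of_reachable {G : SimpleGraph (Fin n)}
    (hG : ∀ a b, G.Adj a b → Conn m (σ a) (σ b)) {a b : Fin n} (h : G.Reachable a b) :
    Conn m (σ a) (σ b) := by
  obtain ⟨p⟩ := h
  induction p with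
  | nil => exact Conn.refl _
  | cons h _ ih => exact (hG _ _ h).trans ih

open Classical in
theorem image_edgeFinset_indexGraph (hV : ∀ e ∈ m, ∀ v ∈ e.1, v ∈ Set.range σ)
    (hd : ∀ e ∈ m, ¬ e.1.IsDiag) :
    (indexGraph σ m).edgeFinset.image (Sym2.map σ) = (m.map Prod.fst).toFinset := by
  ext e
  simp only [Finset.mem_image, SimpleGraph.mem_edgeFinset, Multiset.mem_toFinset]
  constructor
  · rintro ⟨e', he', rfl⟩
    rw [indexGraph, SimpleGraph.edgeSet_fromEdgeSet] at he'
    exact he'.1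
  · intro he
    obtain ⟨⟨e, h⟩, hx, rfl⟩ := Multiset.mem_map.1 he
    induction e using Sym2.ind with
    | _ x y =>
      obtain ⟨i, rfl⟩ := hV _ hx x (Sym2.mem_mk_left _ _)
      obtain ⟨j, rfl⟩ := hV _ hx y (Sym2.mem_mk_right _ _)
      refine ⟨s(i, j), ?_, rfl⟩
      rw [SimpleGraph.mem_edgeSet]
      exact indexGraph_adj.2 ⟨⟨h, hx⟩, fun hij => hd _ hx (by simp [hij])⟩

include hσ in
theorem card_edgeSet_indexGraph (hV : ∀ e ∈ m, ∀ v ∈ e.1, v ∈ Set.range σ)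
    (hd : ∀ e ∈ m, ¬ e.1.IsDiag) (hn : (m.map Prod.fst).Nodup) :
    Nat.card (indexGraph σ m).edgeSet = m.card := by
  classical
  rw [Nat.card_eq_fintype_card, ← SimpleGraph.edgeFinset_card,
    ← Finset.card_image_of_injective _ (Sym2.map.injective hσ),
    image_edgeFinset_indexGraph hV hd, Multiset.toFinset_card_of_nodup hn, Multiset.card_map]

end Multigraph

namespace Net

variable {k : ℕ} {E α : Type} [DecidableEq α]

/-- `V` is the vertex set of the connected net `G`. -/
structure Spans (V : Finset α) (G : Net k E α) : Prop where
  mem_edge : ∀ e ∈ G.edges, ∀ v ∈ e.1, v ∈ V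
  mem_base : G.base ∈ V
  mem_term : ∀ a, G.term a ∈ V
  conn : ∀ v ∈ V, Conn G.edges G.base v

theorem Valid.exists_spans [NormedAddCommGroup E] {D : Fin k → E} {P : ℝ → ℝ → ℝ → Prop} {ℓ : ℝ}
    {G : Net k E α} (hG : G.Valid D P ℓ) : ∃ V : Finset α, G.Spans V := by
  refine ⟨insert G.base (Finset.univ.image G.term ∪
    (G.edges.map Prod.fst).toFinset.biUnion Sym2.toFinset), ?_, ?_, ?_, ?_⟩
  · intro e he v hv
    simp only [Finset.mem_insert, Finset.mem_union, Finset.mem_biUnion, Multiset.mem_toFinset]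
    exact Or.inr (Or.inr ⟨e.1, Multiset.mem_map_of_mem _ he, Sym2.mem_toFinset.2 hv⟩)
  · simp
  · intro a; simp
  · intro v hv
    simp only [Finset.mem_insert, Finset.mem_union, Finset.mem_biUnion, Multiset.mem_toFinset,
      Finset.mem_image, Finset.mem_univ, true_and] at hv
    rcases hv with rfl | ⟨a, rfl⟩ | ⟨e, he, hv⟩
    · exact Conn.refl _
    · exact hG.conn_term a
    · obtain ⟨e, hx, rfl⟩ := Multiset.mem_map.1 he
      exact hG.conn_edge _ hx v (Sym2.mem_toFinset.1 hv)

theorem Spans.connected {V : Finset α} {G : Net k E α} (hV : G.Spans V) {n : ℕ} {σ : Fin n → α}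
    (hσ : Function.Injective σ) (hr : Set.range σ = V) : (indexGraph σ G.edges).Connected := by
  have hm : ∀ v ∈ V, v ∈ Set.range σ := fun v hv => by rw [hr]; exact hv
  have hσV : ∀ i, σ i ∈ V := fun i => by
    have : σ i ∈ Set.range σ := ⟨i, rfl⟩
    rwa [hr] at this
  rw [SimpleGraph.connected_iff]
  refine ⟨fun a b => reachable_of_conn hσ (fun e he v hv => hm v (hV.mem_edge e he v hv))
    ((hV.conn _ (hσV a)).symm.trans (hV.conn _ (hσV b))), ?_⟩
  obtain ⟨i, -⟩ := hm _ hV.mem_base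
  exact ⟨i⟩

/-- A connected graph is a tree when all its edges are bridges, and this is what
`IsMinimal.not_conn` says. -/
theorem IsMinimal.isTree [NormedAddCommGroup E] {D : Fin k → E} {P : ℝ → ℝ → ℝ → Prop} {c ℓ η : ℝ}
    {G : Net k E α} (hG : G.IsMinimal D P c ℓ η) {V : Finset α} (hV : G.Spans V) {n : ℕ}
    {σ : Fin n → α} (hσ : Function.Injective σ) (hr : Set.range σ = V) :
    (indexGraph σ G.edges).IsTree := by
  refine ⟨hV.connected hσ hr, ?_⟩
  rw [SimpleGraph.isAcyclic_iff_forall_adj_isBridge]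
  intro a b hab
  rw [SimpleGraph.isBridge_iff]
  intro hreach
  obtain ⟨⟨h, hm⟩, -⟩ := indexGraph_adj.1 hab
  obtain ⟨r, hr⟩ := Multiset.exists_cons_of_mem hm
  refine hG.not_conn hr (conn_of_reachable (fun x y hxy => ?_) hreach)
  rw [SimpleGraph.deleteEdges_adj] at hxy
  obtain ⟨⟨h', hm'⟩, -⟩ := indexGraph_adj.1 hxy.1
  rw [hr] at hm'
  rcases Multiset.mem_cons.1 hm' with h1 | h1
  · refine absurd ?_ hxy.2
    have := (Prod.ext_iff.1 h1).1
    exact Sym2.map.injective hσ (by simpa using this)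
  · exact Conn.of_mem h1

omit [DecidableEq α] in
theorem exists_enum (V : Finset α) :
    ∃ σ : Fin V.card → α, Function.Injective σ ∧ Set.range σ = V :=
  ⟨fun i => (V.equivFin.symm i : α), Subtype.val_injective.comp V.equivFin.symm.injective, by
    ext v
    constructor
    · rintro ⟨i, rfl⟩
      exact (V.equivFin.symm i).2
    · intro hv
      exact ⟨V.equivFin ⟨v, hv⟩, by simp⟩⟩

theorem IsMinimal.card_edges_add_one [NormedAddCommGroup E] {D : Fin k → E}
    {P : ℝ → ℝ → ℝ → Prop} {c ℓ η : ℝ} {G : Net k E α} (hG : G.IsMinimal D P c ℓ η)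
    {V : Finset α} (hV : G.Spans V) : G.edges.card + 1 = V.card := by
  obtain ⟨σ, hσ, hr⟩ := exists_enum V
  have := (SimpleGraph.isTree_iff_connected_and_card.1 (hG.isTree hV hσ hr)).2
  rw [card_edgeSet_indexGraph hσ (fun e he v hv => by rw [hr]; exact hV.mem_edge e he v hv)
    (fun e he => hG.not_isDiag he) hG.nodup] at this
  simpa using this

theorem IsMinimal.two_le_card_incident [NormedAddCommGroup E] {D : Fin k → E}
    {P : ℝ → ℝ → ℝ → Prop} {c ℓ η : ℝ} {G : Net k E α} (hG : G.IsMinimal D P c ℓ η) {v : α}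
    (hc : Conn G.edges G.base v) (hb : v ≠ G.base) (ht : ∀ a, v ≠ G.term a) :
    2 ≤ (incident G.edges v).card := by
  have h0 : (incident G.edges v).card ≠ 0 := by
    rw [Ne, Multiset.card_eq_zero]
    exact hc.incident_ne_zero hb.symm
  have h1 : (incident G.edges v).card ≠ 1 := by
    intro h1
    obtain ⟨e, he⟩ := Multiset.card_eq_one.1 h1
    obtain ⟨r, hr, hvr⟩ := eq_add_of_incident_eq he
    obtain ⟨w, hw⟩ := exists_mem_incident (v := v) (e := e) (m := G.edges) (by rw [he]; simp)
    rw [hw] at hr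
    exact hG.not_leaf (by rw [hr, Multiset.singleton_add]) hvr hb ht
  omega

/-- A vertex of degree two of a multigraph. -/
theorem exists_of_card_incident_eq_two {m : Multiset (Sym2 α × ℝ)} {v : α}
    (h : (incident m v).card = 2) : ∃ i j h₁ h₂ r, m = (s(i, v), h₁) ::ₘ (s(v, j), h₂) ::ₘ r ∧
      incident m v = {(s(i, v), h₁), (s(v, j), h₂)} ∧ ∀ e ∈ r, v ∉ e.1 := by
  obtain ⟨e₁, e₂, he⟩ := Multiset.card_eq_two.1 h
  obtain ⟨r, hr, hvr⟩ := eq_add_of_incident_eq he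
  obtain ⟨i, h1⟩ := exists_mem_incident (v := v) (e := e₁) (m := m) (by rw [he]; simp)
  obtain ⟨j, h2⟩ := exists_mem_incident (v := v) (e := e₂) (m := m) (by rw [he]; simp)
  refine ⟨i, j, e₁.2, e₂.2, r, ?_, ?_, hvr⟩
  · rw [Sym2.eq_swap, ← h1, ← h2, hr]
    simp [Multiset.insert_eq_cons, Multiset.cons_add]
  · rw [Sym2.eq_swap, ← h1, ← h2, he]

end Net

end

/-! ### Compactness of the class of nets with short edges. -/

open Real Filter Topology

/-- The edges are so short that energies depend continuously on the data. -/
def shortCond : ℝ → ℝ → ℝ → Prop := fun h _ _ => h ≤ π / 2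

theorem symmCond_shortCond : SymmCond shortCond := fun _ _ _ h => h

namespace Net

section Bounds

variable {k : ℕ} {E α : Type} [NormedAddCommGroup E] {D : Fin k → E} {P : ℝ → ℝ → ℝ → Prop}
  {c ℓ η : ℝ} {G : Net k E α}

theorem neg_le_symCapped (c : ℝ) (h : ℝ) (e : Sym2 ℝ) : -(c ^ 2 * h) ≤ symCapped c h e := by
  induction e using Sym2.ind with
  | _ x y => exact neg_le_cappedEnergy c h x y

theorem symEnergy_le_symCapped (c : ℝ) (h : ℝ) (e : Sym2 ℝ) : symEnergy h e ≤ symCapped c h e := by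
  induction e using Sym2.ind with
  | _ x y => exact edgeEnergy_le_cappedEnergy c h x y

theorem neg_le_sum_symCapped (c : ℝ) (val : α → ℝ) (m : Multiset (Sym2 α × ℝ)) :
    -(c ^ 2 * (m.map Prod.snd).sum) ≤ (m.map fun e => symCapped c e.2 (e.1.map val)).sum := by
  induction m using Multiset.induction with
  | empty => simp
  | cons e m ih =>
    simp only [Multiset.map_cons, Multiset.sum_cons]
    have := neg_le_symCapped c e.2 (e.1.map val)
    linarith

/-- All other edges and the reservoir together have at least the energy -c²ℓ. The resulting bound
for a single edge forces the values at the ends of a collapsing edge to merge in the limit. -/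
theorem Good.symCapped_le (hG : G.Good D P c ℓ η) {e : Sym2 α × ℝ} (he : e ∈ G.edges) :
    symCapped c e.2 (e.1.map G.val) ≤ η + ℓ * c ^ 2 := by
  obtain ⟨r, hr⟩ := Multiset.exists_cons_of_mem he
  have h1 := hG.capped_le
  have h2 := hG.toValid.length_nonneg he
  have h3 := neg_le_sum_symCapped c G.val r
  simp only [capped, total, hr, Multiset.map_cons, Multiset.sum_cons] at h1
  nlinarith [sq_nonneg c]

theorem Valid.sum_length_nonneg (hG : G.Valid D P ℓ) {m : Multiset (Sym2 α × ℝ)}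
    (hm : ∀ e ∈ m, e ∈ G.edges) : 0 ≤ (m.map Prod.snd).sum :=
  Multiset.sum_nonneg fun x hx => by
    obtain ⟨e, he, rfl⟩ := Multiset.mem_map.1 hx
    exact hG.length_nonneg (hm e he)

theorem Valid.total_nonneg (hG : G.Valid D P ℓ) : 0 ≤ G.total :=
  hG.sum_length_nonneg fun _ h => h

theorem Valid.length_le (hG : G.Valid D P ℓ) {e : Sym2 α × ℝ} (he : e ∈ G.edges) : e.2 ≤ ℓ := by
  obtain ⟨r, hr⟩ := Multiset.exists_cons_of_mem he
  have h1 := hG.total_le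
  have h2 := hG.sum_length_nonneg (m := r) fun e he => by rw [hr]; exact Multiset.mem_cons_of_mem he
  simp only [total, hr, Multiset.map_cons, Multiset.sum_cons] at h1
  linarith

theorem Good.mono_cond {P' : ℝ → ℝ → ℝ → Prop} (hG : G.Good D P c ℓ η)
    (hP : ∀ h x y, P h x y → P' h x y) : G.Good D P' c ℓ η :=
  { hG with toValid := hG.toValid.mono hP }

/-- The additional length goes to the reservoir, where it has energy -c²ε ≤ 0. -/
theorem Good.add_length (hG : G.Good D P c ℓ η) {ε : ℝ} (hε : 0 ≤ ε) :
    G.Good D P c (ℓ + ε) η :=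
  { hG with
    total_le := by linarith [hG.total_le]
    capped_le := by
      refine le_trans ?_ hG.capped_le
      simp only [capped]
      nlinarith [sq_nonneg c] }

variable [DecidableEq α]

/-- The number of vertices of a minimal net with short edges. -/
theorem IsMinimal.card_le (hG : G.IsMinimal D shortCond c ℓ η) {V : Finset α} (hV : G.Spans V) :
    (V.card : ℝ) ≤ 3 * k + 1 + 4 * ℓ / π := by
  have hcard := hG.card_edges_add_one hV
  -- With the weight 1 + 2h/π every free vertex has weight at least 3: if its degree is at least
  -- three this is clear, and if its degree is two, its edges have total length more than π/2.
  have hsum := sum_incident V hV.mem_edge (fun e he => hG.not_isDiag he)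
    fun e => 1 + e.2 * (2 / π)
  have htot : (G.edges.map fun e => 1 + e.2 * (2 / π)).sum = G.edges.card + G.total * (2 / π) := by
    rw [Multiset.sum_map_add, Multiset.sum_map_mul_right]
    simp [total]
  rw [htot] at hsum
  have hpi := pi_pos
  set M : Finset α := insert G.base (Finset.univ.image G.term) with hM
  have hMc : M.card ≤ k + 1 := by
    refine (Finset.card_insert_le _ _).trans ?_
    have : (Finset.univ.image G.term).card ≤ k := by
      simpa using Finset.card_image_le (s := Finset.univ) (f := G.term)
    omega
  have hlow : ∀ v ∈ V \ M, (3 : ℝ) ≤ ((incident G.edges v).map fun e => 1 + e.2 * (2 / π)).sum := by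
    intro v hv
    obtain ⟨hvV, hvM⟩ := Finset.mem_sdiff.1 hv
    simp only [hM, Finset.mem_insert, Finset.mem_image, Finset.mem_univ, true_and, not_or,
      not_exists] at hvM
    have hb := hvM.1
    have ht : ∀ a, v ≠ G.term a := fun a h => hvM.2 a h.symm
    have h2 := hG.two_le_card_incident (hV.conn v hvV) hb ht
    have hnn : ∀ e ∈ incident G.edges v, 0 ≤ e.2 := fun e he =>
      hG.1.toValid.length_nonneg (mem_incident.1 he).1
    rcases h2.lt_or_eq with h3 | h3
    · have : ((incident G.edges v).card : ℝ) ≤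
          ((incident G.edges v).map fun e => 1 + e.2 * (2 / π)).sum := by
        have := Multiset.card_nsmul_le_sum (s := (incident G.edges v).map fun e => 1 + e.2 * (2 / π))
          (a := 1) (fun x hx => by
            obtain ⟨e, he, rfl⟩ := Multiset.mem_map.1 hx
            have := hnn e he
            have : 0 ≤ e.2 * (2 / π) := by positivity
            linarith)
        simpa using this
      have : (3 : ℝ) ≤ (incident G.edges v).card := by exact_mod_cast h3
      linarith
    · obtain ⟨i, j, h₁, h₂, r, hr, hinc, hvr⟩ := exists_of_card_incident_eq_two h3.symm
      have m1 : (s(i, v), h₁) ∈ G.edges := by rw [hr]; simp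
      have m2 : (s(v, j), h₂) ∈ G.edges := by rw [hr]; simp
      have n1 : 0 ≤ h₁ := hG.1.toValid.length_nonneg m1
      have n2 : 0 ≤ h₂ := hG.1.toValid.length_nonneg m2
      have k1 := hG.1.edge_ok _ m1 i v rfl
      have k2 := hG.1.edge_ok _ m2 v j rfl
      have : π / 2 < h₁ + h₂ := by
        by_contra hcon
        exact hG.not_merge symmCond_shortCond hr hvr hb ht (not_lt.1 hcon)
          (cappedEnergy_add_le n1 n2 (by linarith) k1.2.1 k2.2.1)
      rw [hinc]
      simp only [Multiset.insert_eq_cons, Multiset.map_cons, Multiset.map_singleton,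
        Multiset.sum_cons, Multiset.sum_singleton]
      have : 1 < (h₁ + h₂) * (2 / π) := by
        rw [← mul_div_assoc, lt_div_iff₀ hpi]; linarith
      linarith
  have hnn : ∀ v ∈ V, (0 : ℝ) ≤ ((incident G.edges v).map fun e => 1 + e.2 * (2 / π)).sum := by
    intro v _
    refine Multiset.sum_nonneg fun x hx => ?_
    obtain ⟨e, he, rfl⟩ := Multiset.mem_map.1 hx
    have := hG.1.toValid.length_nonneg (mem_incident.1 he).1
    positivity
  have h1 : ((V \ M).card : ℝ) * 3 ≤
      ∑ v ∈ V, ((incident G.edges v).map fun e => 1 + e.2 * (2 / π)).sum := by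
    calc ((V \ M).card : ℝ) * 3 = ∑ v ∈ V \ M, (3 : ℝ) := by simp
      _ ≤ ∑ v ∈ V \ M, ((incident G.edges v).map fun e => 1 + e.2 * (2 / π)).sum :=
        Finset.sum_le_sum hlow
      _ ≤ _ := Finset.sum_le_sum_of_subset_of_nonneg Finset.sdiff_subset fun v hv _ => hnn v hv
  have h2 : V.card ≤ (V \ M).card + (k + 1) := by
    have := Finset.le_card_sdiff M V
    omega
  have h2' : (V.card : ℝ) ≤ (V \ M).card + (k + 1) := by exact_mod_cast h2
  have h3 : (G.edges.card : ℝ) + 1 = V.card := by exact_mod_cast hcard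
  have h4 : G.total * (2 / π) ≤ ℓ * (2 / π) := by
    have := hG.1.total_le
    gcongr
  have h5 : 4 * ℓ / π = 2 * (ℓ * (2 / π)) := by ring
  rw [h5]
  rw [hsum] at h1
  linarith

end Bounds

section Relabel

variable {k : ℕ} {E α β : Type} {c ℓ η : ℝ} {G : Net k E α}

/-- Relabelling the vertices of a net. -/
def relabel (G : Net k E α) (f : α → β) (pos : β → E) (val : β → ℝ) : Net k E β where
  edges := G.edges.map (Prod.map (Sym2.map f) id)
  pos := pos
  val := val
  term := f ∘ G.term
  base := f G.base

theorem conn_relabel {m : Multiset (Sym2 α × ℝ)} (f : α → β) {a b : α} (h : Conn m a b) :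
    Conn (m.map (Prod.map (Sym2.map f) id)) (f a) (f b) :=
  h.map f fun a b x hx => Conn.of_mem (h := x) (Multiset.mem_map.2 ⟨_, hx, by simp⟩)

theorem total_relabel (f : α → β) (pos : β → E) (val : β → ℝ) :
    (G.relabel f pos val).total = G.total := by
  simp [total, relabel, Multiset.map_map, Function.comp_def]

theorem Good.relabel [NormedAddCommGroup E] {D : Fin k → E} {P : ℝ → ℝ → ℝ → Prop}
    (hG : G.Good D P c ℓ η) (f : α → β) {pos : β → E} {val : β → ℝ}
    (V : Set α) (hVe : ∀ e ∈ G.edges, ∀ v ∈ e.1, v ∈ V) (hVb : G.base ∈ V) (hVt : ∀ a, G.term a ∈ V)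
    (hpos : ∀ v ∈ V, pos (f v) = G.pos v) (hval : ∀ v ∈ V, val (f v) = G.val v)
    (h0 : ∀ v, 0 ≤ val v) (hc : ∀ v, val v ≤ c) : (G.relabel f pos val).Good D P c ℓ η where
  edge_ok := by
    intro e he
    obtain ⟨⟨e, h⟩, hx, rfl⟩ := Multiset.mem_map.1 he
    intro a b hab
    induction e using Sym2.ind with
    | _ i j =>
      have hi := hVe _ hx i (Sym2.mem_mk_left _ _)
      have hj := hVe _ hx j (Sym2.mem_mk_right _ _)
      have key := hG.edge_ok _ hx
      simp only [Prod.map_apply, Sym2.map_mk, Sym2.eq_iff, id] at hab ⊢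
      change dist (pos a) (pos b) ≤ h ∧ (h = 0 → val a = val b) ∧ P h (val a) (val b)
      rcases hab with ⟨rfl, rfl⟩ | ⟨rfl, rfl⟩
      · rw [hpos i hi, hpos j hj, hval i hi, hval j hj]
        exact key i j rfl
      · rw [hpos i hi, hpos j hj, hval i hi, hval j hj]
        exact key j i Sym2.eq_swap
  conn_edge := by
    intro e he v hv
    obtain ⟨⟨e, h⟩, hx, rfl⟩ := Multiset.mem_map.1 he
    obtain ⟨w, hw, rfl⟩ := Sym2.mem_map.1 hv
    exact conn_relabel f (hG.conn_edge _ hx w hw)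
  conn_term := fun a => conn_relabel f (hG.conn_term a)
  pos_term := fun a => (hpos _ (hVt a)).trans (hG.pos_term a)
  val_term := fun a => (hval _ (hVt a)).trans (hG.val_term a)
  total_le := by rw [total_relabel]; exact hG.total_le
  val_nonneg := h0
  val_le := hc
  val_base := (hval _ hVb).trans hG.val_base
  capped_le := by
    refine le_trans (le_of_eq ?_) hG.capped_le
    simp only [capped, total_relabel]
    congr 2
    simp only [Net.relabel, Multiset.map_map, Function.comp_def, Prod.map_fst, Prod.map_snd, id]
    refine Multiset.map_congr rfl fun e he => ?_
    congr 1
    rw [Sym2.map_map]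
    exact Sym2.map_congr fun v hv => hval v (hVe e he v hv)

/-- A net whose edges are indexed by `Fin m`. -/
def ofIndex {m : ℕ} (a : Fin m → Sym2 α) (t : Fin k → α) (z : α) (pos : α → E) (val : α → ℝ)
    (h : Fin m → ℝ) : Net k E α where
  edges := (Finset.univ : Finset (Fin m)).val.map fun i => (a i, h i)
  pos := pos
  val := val
  term := t
  base := z

theorem exists_ofIndex (G : Net k E α) : ∃ (a : Fin G.edges.card → Sym2 α)
    (h : Fin G.edges.card → ℝ), G = ofIndex a G.term G.base G.pos G.val h := by
  obtain ⟨E', hE⟩ : ∃ l : List (Sym2 α × ℝ), G.edges = l := ⟨G.edges.toList, by simp⟩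
  have hl : G.edges.card = E'.length := by rw [hE]; simp
  refine ⟨fun i => (E'.get (i.cast hl)).1, fun i => (E'.get (i.cast hl)).2, ?_⟩
  obtain ⟨e, p, v, t, b⟩ := G
  simp only at hE hl ⊢
  subst hE
  simp only [ofIndex, Net.mk.injEq, and_true]
  simp only [Prod.mk.eta]
  rw [Fin.univ_val_map]
  congr 1
  exact (List.ofFn_get E').symm

theorem total_ofIndex {m : ℕ} (a : Fin m → Sym2 α) (t : Fin k → α) (z : α) (pos : α → E)
    (val : α → ℝ) (h : Fin m → ℝ) : (ofIndex a t z pos val h).total = ∑ i, h i := by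
  simp only [total, ofIndex, Finset.sum, Multiset.map_map]
  rfl

theorem capped_ofIndex {m : ℕ} (a : Fin m → Sym2 α) (t : Fin k → α) (z : α) (pos : α → E)
    (val : α → ℝ) (h : Fin m → ℝ) : (ofIndex a t z pos val h).capped c ℓ =
      ∑ i, symCapped c (h i) ((a i).map val) - (ℓ - ∑ i, h i) * c ^ 2 := by
  rw [capped, total_ofIndex]
  simp only [ofIndex, Finset.sum, Multiset.map_map]
  rfl

theorem mem_edges_ofIndex {m : ℕ} (a : Fin m → Sym2 α) (t : Fin k → α) (z : α) (pos : α → E)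
    (val : α → ℝ) (h : Fin m → ℝ) (e : Sym2 α × ℝ) :
    e ∈ (ofIndex a t z pos val h).edges ↔ ∃ i, (a i, h i) = e := by
  simp [ofIndex]

/-- Connection depends on the combinatorial type alone, so it passes to the limit. -/
theorem conn_ofIndex {m : ℕ} {a : Fin m → Sym2 α} {t : Fin k → α} {z : α} {pos pos' : α → E}
    {val val' : α → ℝ} {h h' : Fin m → ℝ} {x y : α}
    (hc : Conn (ofIndex a t z pos val h).edges x y) :
    Conn (ofIndex a t z pos' val' h').edges x y :=
  hc.map id fun x y u hu => by
    obtain ⟨i, hi⟩ := (mem_edges_ofIndex ..).1 hu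
    have : a i = s(x, y) := congrArg Prod.fst hi
    exact Conn.of_mem (h := h' i) ((mem_edges_ofIndex ..).2 ⟨i, by rw [this]; rfl⟩)

/-- Positions of connected vertices. -/
theorem dist_le_of_conn [NormedAddCommGroup E] {N : ℕ} {m : Multiset (Sym2 (Fin N) × ℝ)} {pos : Fin N → E} {B : ℝ}
    (hB : 0 ≤ B) (hm : ∀ i j h, (s(i, j), h) ∈ m → dist (pos i) (pos j) ≤ B) {i j : Fin N}
    (hc : Conn m i j) : dist (pos i) (pos j) ≤ N * B := by
  have hr : (indexGraph id m).Reachable i j :=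
    reachable_of_conn (σ := id) Function.injective_id (fun e _ v _ => ⟨v, rfl⟩) hc
  obtain ⟨p, hp⟩ := hr.exists_isPath
  have key : ∀ {i j : Fin N} (p : (indexGraph id m).Walk i j),
      dist (pos i) (pos j) ≤ p.length * B := by
    intro i j p
    induction p with
    | nil => simp
    | cons h p ih =>
      obtain ⟨⟨x, hx⟩, -⟩ := indexGraph_adj.1 h
      have h1 := hm _ _ _ hx
      simp only [id] at h1
      refine (dist_triangle _ _ _).trans ((add_le_add h1 ih).trans ?_)
      rw [SimpleGraph.Walk.length_cons]
      push_cast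
      linarith
  refine (key p).trans ?_
  have := hp.length_lt
  rw [Fintype.card_fin] at this
  have : (p.length : ℝ) ≤ N := by exact_mod_cast this.le
  gcongr

end Relabel

end Net

/-- Lower semicontinuity. For h > 0 there is continuity, because sin h ≠ 0. At h = 0 the limiting
energy is zero, and the cap alone bounds the approximating energies from below by a null sequence.
-/
theorem cappedEnergy_eventually_le {c h x y : ℝ} {hn xn yn : ℕ → ℝ} (h0 : ∀ n, 0 ≤ hn n)
    (hp : ∀ n, hn n ≤ π / 2) (hh : Tendsto hn atTop (𝓝 h)) (hx : Tendsto xn atTop (𝓝 x))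
    (hy : Tendsto yn atTop (𝓝 y)) (e : h = 0 → x = y) {δ : ℝ} (hδ : 0 < δ) :
    ∀ᶠ n in atTop, cappedEnergy c h x y ≤ cappedEnergy c (hn n) (xn n) (yn n) + δ := by
  have hn0 : 0 ≤ h := ge_of_tendsto' hh h0
  have hpi : h ≤ π / 2 := le_of_tendsto' hh hp
  rcases hn0.eq_or_lt with rfl | hpos
  · have : Tendsto (fun n => -(c ^ 2 * hn n) + δ) atTop (𝓝 (-(c ^ 2 * 0) + δ)) :=
      ((hh.const_mul _).neg).add_const _
    have h2 := this.eventually (lt_mem_nhds (show (0 : ℝ) < -(c ^ 2 * 0) + δ by simpa using hδ))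
    filter_upwards [h2] with n hn2
    have h3 := neg_le_cappedEnergy c (hn n) (xn n) (yn n)
    have h4 : cappedEnergy c 0 x y = 0 := by simp [cappedEnergy]
    rw [h4]; linarith
  · have hs : sin h ≠ 0 := (sin_pos_of_length hpos (by linarith [pi_pos])).ne'
    have : Tendsto (fun n => cappedEnergy c (hn n) (xn n) (yn n) + δ) atTop
        (𝓝 (cappedEnergy c h x y + δ)) := by
      unfold cappedEnergy edgeEnergy
      refine Tendsto.add_const _ (Tendsto.max ?_ ((hh.const_mul _).neg))
      refine Tendsto.div ?_ ((continuous_sin.tendsto _).comp hh) hs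
      exact ((((hx.pow 2).add (hy.pow 2)).mul ((continuous_cos.tendsto _).comp hh))).sub
        ((hx.const_mul 2).mul hy)
    filter_upwards [this.eventually (lt_mem_nhds (show cappedEnergy c h x y <
      cappedEnergy c h x y + δ by linarith))] with n hn2
    exact hn2.le

open Real Filter Topology

namespace Net

variable {k : ℕ} {E : Type} [NormedAddCommGroup E]
  {D : Fin k → E} {c ℓ : ℝ}

/-- A good net with short edges can be replaced by one with a bounded number of vertices, all of
which are close to a given terminal. -/
theorem Good.exists_bounded {P : ℝ → ℝ → ℝ → Prop} {η : ℝ} {G : Net k E ℕ}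
    (hG : G.Good D P c ℓ η) (hmin : G.IsMinimal D P c ℓ η) (a₀ : Fin k) {V : Finset ℕ}
    (hV : G.Spans V) {N : ℕ} (hN : V.card ≤ N) :
    ∃ G' : Net k E (Fin N), G'.Good D P c ℓ η ∧ G'.edges.card ≤ N ∧
      ∀ v, dist (G'.pos v) (D a₀) ≤ 2 * (N * ℓ) := by
  classical
  obtain ⟨σ, hσ, hr⟩ := exists_enum V
  have hpos : 0 < N := lt_of_lt_of_le (Finset.card_pos.2 ⟨_, hV.mem_base⟩) hN
  have hVσ : ∀ v ∈ V, ∃ i, σ i = v := fun v hv => by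
    have : v ∈ Set.range σ := by rw [hr]; exact hv
    exact this
  have : Nonempty (Fin V.card) := ⟨⟨0, Finset.card_pos.2 ⟨_, hV.mem_base⟩⟩⟩
  choose! g hg using hVσ
  let f : ℕ → Fin N := fun v => if hv : v ∈ V then (g v).castLE hN else ⟨0, hpos⟩
  -- Labels beyond the number of vertices repeat the base, so they inherit its position and its
  -- value.
  let f' : Fin N → ℕ := fun i => if hi : (i : ℕ) < V.card then σ ⟨i, hi⟩ else G.base
  have hff : ∀ v ∈ V, f' (f v) = v := by
    intro v hv
    simp only [f, f', dif_pos hv, Fin.val_castLE, Fin.is_lt, dite_true]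
    exact hg v hv
  have hf'V : ∀ i, f' i ∈ V := by
    intro i
    by_cases hi : (i : ℕ) < V.card
    · simp only [f', dif_pos hi]
      have : σ ⟨i, hi⟩ ∈ Set.range σ := ⟨_, rfl⟩
      rwa [hr] at this
    · simp only [f', dif_neg hi]
      exact hV.mem_base
  have hgood : (G.relabel f (G.pos ∘ f') (G.val ∘ f')).Good D P c ℓ η :=
    hG.relabel f V hV.mem_edge hV.mem_base hV.mem_term
      (fun v hv => by simp [hff v hv]) (fun v hv => by simp [hff v hv])
      (fun v => hG.val_nonneg _) (fun v => hG.val_le _)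
  have hl0 : 0 ≤ ℓ := hG.toValid.total_nonneg.trans hG.total_le
  refine ⟨_, hgood, ?_, ?_⟩
  · have := hmin.card_edges_add_one hV
    simp only [Net.relabel, Multiset.card_map]
    omega
  · have key : ∀ x, Conn (G.relabel f (G.pos ∘ f') (G.val ∘ f')).edges (f G.base) x →
        dist ((G.pos ∘ f') (f G.base)) ((G.pos ∘ f') x) ≤ N * ℓ := fun x hx =>
      dist_le_of_conn hl0 (fun i j h hm => ((hgood.edge_ok _ hm i j rfl).1).trans
        (hgood.toValid.length_le hm)) hx
    intro v
    have h1 := key (f (f' v)) (conn_relabel f (hV.conn _ (hf'V v)))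
    have h2 := key _ (hgood.conn_term a₀)
    have h3 := hgood.pos_term a₀
    have e1 : (G.pos ∘ f') (f (f' v)) = (G.pos ∘ f') v := by simp [hff _ (hf'V v)]
    rw [e1] at h1
    change (G.pos ∘ f') _ = _ at h3
    rw [h3] at h2
    change dist ((G.pos ∘ f') v) (D a₀) ≤ _
    have := dist_triangle_left ((G.pos ∘ f') v) (D a₀) ((G.pos ∘ f') (f G.base))
    linarith

/-- Compactness of the class of nets with short edges. -/
theorem exists_good_of_forall_pos [ProperSpace E] (a₀ : Fin k)
    (h : ∀ ε > 0, ∃ G : Net k E ℕ, G.Good D shortCond c (ℓ + ε) ε) :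
    ∃ G : Net k E ℕ, G.Good D shortCond c ℓ 0 := by
  classical
  set N : ℕ := ⌈3 * k + 1 + 4 * (ℓ + 1) / π⌉₊ with hN
  set ε : ℕ → ℝ := fun n => 1 / ((n : ℝ) + 1) with hε
  have hε0 : ∀ n, 0 < ε n := fun n => by positivity
  have hε1 : ∀ n, ε n ≤ 1 := fun n => by
    simp only [hε]
    rw [div_le_one (by positivity)]
    have : (0 : ℝ) ≤ n := n.cast_nonneg
    linarith
  have hεlim : Tendsto ε atTop (𝓝 0) := tendsto_one_div_add_atTop_nhds_zero_nat
  have hstep : ∀ n, ∃ G : Net k E (Fin N), G.Good D shortCond c (ℓ + ε n) (ε n) ∧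
      G.edges.card ≤ N ∧ ∀ v, dist (G.pos v) (D a₀) ≤ 2 * (N * (ℓ + 1)) := by
    intro n
    obtain ⟨G₀, hG₀⟩ := h (ε n) (hε0 n)
    obtain ⟨G, hG⟩ := exists_isMinimal hG₀
    obtain ⟨V, hV⟩ := hG.1.toValid.exists_spans
    have hc := hG.card_le hV
    have hcN : V.card ≤ N := by
      have h1 : (V.card : ℝ) ≤ 3 * k + 1 + 4 * (ℓ + 1) / π := by
        refine hc.trans ?_
        have := hε1 n
        have := pi_pos
        gcongr
      exact (Nat.cast_le (α := ℝ)).1 (h1.trans (Nat.le_ceil _))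
    obtain ⟨G', h1, h2, h3⟩ := hG.1.exists_bounded hG a₀ hV hcN
    refine ⟨G', h1, h2, fun v => (h3 v).trans ?_⟩
    have := hε1 n
    gcongr
  choose G hG hcard hdist using hstep
  have hidx : ∀ n, ∃ (m : Fin (N + 1)) (a : Fin m → Sym2 (Fin N)) (h : Fin m → ℝ),
      G n = ofIndex a (G n).term (G n).base (G n).pos (G n).val h := fun n => by
    obtain ⟨a, h, e⟩ := exists_ofIndex (G n)
    exact ⟨⟨_, Nat.lt_succ_of_le (hcard n)⟩, a, h, e⟩
  choose m a hh he using hidx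
  -- The combinatorial types form a finite set, so one of them occurs infinitely often. Along it
  -- only lengths, positions and values vary, in a compact set.
  let T := Σ m : Fin (N + 1), (Fin m → Sym2 (Fin N)) × (Fin k → Fin N) × Fin N
  let τ : ℕ → T := fun n => ⟨m n, a n, (G n).term, (G n).base⟩
  obtain ⟨⟨m₀, a₁, t₀, z₀⟩, hinf⟩ := Finite.exists_infinite_fiber τ
  have hfreq : ∃ᶠ n in atTop, τ n = ⟨m₀, a₁, t₀, z₀⟩ := by
    rw [Nat.frequently_atTop_iff_infinite]
    exact Set.infinite_coe_iff.1 hinf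
  obtain ⟨φ, hφ, hφτ⟩ := extraction_of_frequently_atTop hfreq
  have hdata : ∀ n, ∃ h : Fin m₀ → ℝ,
      G (φ n) = ofIndex a₁ t₀ z₀ (G (φ n)).pos (G (φ n)).val h := by
    intro n
    have h1 := hφτ n
    have h2 := he (φ n)
    revert h1 h2
    simp only [τ]
    generalize hh (φ n) = hhn
    revert hhn
    generalize a (φ n) = an
    revert an
    generalize m (φ n) = mn
    intro an hhn h1 h2
    cases h1
    exact ⟨hhn, h2⟩
  choose h hG' using hdata
  have hGood : ∀ n, (ofIndex a₁ t₀ z₀ (G (φ n)).pos (G (φ n)).val (h n)).Good D shortCond c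
      (ℓ + ε (φ n)) (ε (φ n)) := fun n => by rw [← hG' n]; exact hG _
  have hmem : ∀ n i, (a₁ i, h n i) ∈
      (ofIndex a₁ t₀ z₀ (G (φ n)).pos (G (φ n)).val (h n)).edges := fun n i =>
    (mem_edges_ofIndex ..).2 ⟨i, rfl⟩
  -- a convergent subsequence
  have hl0 : 0 ≤ ℓ + 1 := by
    have h1 := (hG 0).toValid.total_nonneg.trans (hG 0).total_le
    have := hε1 0
    linarith
  let K : Set ((Fin N → E) × (Fin m₀ → ℝ) × (Fin N → ℝ)) :=
    (Set.univ.pi fun _ => Metric.closedBall (D a₀) (2 * (N * (ℓ + 1)))) ×ˢ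
      (Set.univ.pi fun _ => Set.Icc 0 (π / 2)) ×ˢ (Set.univ.pi fun _ => Set.Icc 0 c)
  have hK : IsCompact K :=
    (isCompact_univ_pi fun _ => isCompact_closedBall _ _).prod
      ((isCompact_univ_pi fun _ => isCompact_Icc).prod (isCompact_univ_pi fun _ => isCompact_Icc))
  have hnn : ∀ n i, 0 ≤ h n i := fun n i => (hGood n).toValid.length_nonneg (hmem n i)
  have hshort : ∀ n i, h n i ≤ π / 2 := fun n i => by
    obtain ⟨x, y, hxy⟩ : ∃ x y, a₁ i = s(x, y) := by
      induction hxy : a₁ i using Sym2.ind with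
      | _ x y => exact ⟨x, y, rfl⟩
    exact ((hGood n).edge_ok _ (hmem n i) x y hxy).2.2
  have hxK : ∀ n, ((G (φ n)).pos, h n, (G (φ n)).val) ∈ K := by
    intro n
    refine ⟨fun v _ => hdist (φ n) v, fun i _ => ⟨hnn n i, hshort n i⟩, fun v _ => ?_⟩
    exact ⟨(hG (φ n)).val_nonneg v, (hG (φ n)).val_le v⟩
  obtain ⟨⟨p, hl, y⟩, hxlim, ψ, hψ, hlim⟩ := hK.tendsto_subseq hxK
  have hp : ∀ v, Tendsto (fun n => (G (φ (ψ n))).pos v) atTop (𝓝 (p v)) := fun v =>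
    ((continuous_apply v).tendsto _).comp ((continuous_fst.tendsto _).comp hlim)
  have hh : ∀ i, Tendsto (fun n => h (ψ n) i) atTop (𝓝 (hl i)) := fun i =>
    ((continuous_apply i).tendsto _).comp
      ((continuous_fst.tendsto _).comp ((continuous_snd.tendsto _).comp hlim))
  have hy : ∀ v, Tendsto (fun n => (G (φ (ψ n))).val v) atTop (𝓝 (y v)) := fun v =>
    ((continuous_apply v).tendsto _).comp
      ((continuous_snd.tendsto _).comp ((continuous_snd.tendsto _).comp hlim))
  have hεφ : Tendsto (fun n => ε (φ (ψ n))) atTop (𝓝 0) :=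
    hεlim.comp (hφ.tendsto_atTop.comp hψ.tendsto_atTop)
  -- A bounded energy gives (difference of the values)² ≤ B · length, so the ends of an edge which
  -- collapses have equal values in the limit.
  have hval : ∀ i u v, a₁ i = s(u, v) → hl i = 0 → y u = y v := by
    intro i u v huv h0
    set B := 1 + (ℓ + 1) * c ^ 2 + 2 * c ^ 2 with hB
    have hbound : ∀ n, ((G (φ (ψ n))).val u - (G (φ (ψ n))).val v) ^ 2 ≤ B * h (ψ n) i := by
      intro n
      have hgn := hGood (ψ n)
      have h1 := hgn.symCapped_le (hmem (ψ n) i)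
      have h2 := hgn.edge_ok _ (hmem (ψ n) i) u v huv
      simp only [huv] at h1
      have h3 : edgeEnergy (h (ψ n) i) ((G (φ (ψ n))).val u) ((G (φ (ψ n))).val v) ≤
          1 + (ℓ + 1) * c ^ 2 := by
        refine (edgeEnergy_le_cappedEnergy c _ _ _).trans (h1.trans ?_)
        have := hε1 (φ (ψ n))
        gcongr
      have hb : ∀ w, (G (φ (ψ n))).val w ^ 2 ≤ c ^ 2 := fun w =>
        pow_le_pow_left₀ ((hG _).val_nonneg w) ((hG _).val_le w) 2
      exact sq_sub_le_of_edgeEnergy_le (hnn _ _) (hshort _ _) h2.2.1 (hb u) (hb v) h3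
        (by positivity)
    have hlim1 : Tendsto (fun n => ((G (φ (ψ n))).val u - (G (φ (ψ n))).val v) ^ 2) atTop
        (𝓝 ((y u - y v) ^ 2)) := ((hy u).sub (hy v)).pow 2
    have hlim2 := (hh i).const_mul B
    have := le_of_tendsto_of_tendsto' hlim1 hlim2 hbound
    rw [h0, mul_zero] at this
    have := pow_eq_zero_iff (two_ne_zero) |>.1 (le_antisymm this (sq_nonneg _))
    linarith
  have hbase : ∀ n, (G (φ (ψ n))).val z₀ = c := fun n => (hGood (ψ n)).val_base
  have hterm : ∀ n b, (G (φ (ψ n))).val (t₀ b) = 0 := fun n b => (hGood (ψ n)).val_term b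
  have hpterm : ∀ n b, (G (φ (ψ n))).pos (t₀ b) = D b := fun n b => (hGood (ψ n)).pos_term b
  have hlimit : (ofIndex a₁ t₀ z₀ p y hl).Good D shortCond c ℓ 0 :=
    { edge_ok := by
        intro e he
        obtain ⟨i, rfl⟩ := (mem_edges_ofIndex ..).1 he
        intro u v huv
        refine ⟨?_, hval i u v huv, le_of_tendsto' (hh i) fun n => hshort _ _⟩
        exact le_of_tendsto_of_tendsto' ((hp u).dist (hp v)) (hh i) fun n =>
          ((hGood (ψ n)).edge_ok _ (hmem (ψ n) i) u v huv).1
      conn_edge := by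
        intro e he v hv
        obtain ⟨i, rfl⟩ := (mem_edges_ofIndex ..).1 he
        exact conn_ofIndex ((hGood 0).conn_edge _ (hmem 0 i) v hv)
      conn_term := fun b => conn_ofIndex ((hGood 0).conn_term b)
      pos_term := fun b => tendsto_nhds_unique (hp (t₀ b)) (by simp only [hpterm]; exact tendsto_const_nhds)
      val_term := fun b => tendsto_nhds_unique (hy (t₀ b)) (by simp only [hterm]; exact tendsto_const_nhds)
      total_le := by
        rw [total_ofIndex]
        have h1 : Tendsto (fun n => ∑ i, h (ψ n) i) atTop (𝓝 (∑ i, hl i)) :=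
          tendsto_finsetSum _ fun i _ => hh i
        have h2 : Tendsto (fun n => ℓ + ε (φ (ψ n))) atTop (𝓝 (ℓ + 0)) := hεφ.const_add _
        rw [add_zero] at h2
        refine le_of_tendsto_of_tendsto' h1 h2 fun n => ?_
        have := (hGood (ψ n)).total_le
        rwa [total_ofIndex] at this
      val_nonneg := fun v => (hxlim.2.2 v trivial).1
      val_le := fun v => (hxlim.2.2 v trivial).2
      val_base := tendsto_nhds_unique (hy z₀) (by simp only [hbase]; exact tendsto_const_nhds)
      capped_le := by
        rw [capped_ofIndex]
        refine le_of_forall_pos_le_add fun δ hδ => ?_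
        -- The error is shared among the `m₀` edges; the additional 1 avoids a division by zero.
        set δ' := δ / (m₀ + 1) with hδ'
        have hδ0 : 0 < δ' := by positivity
        have hev : ∀ᶠ n in atTop, ∀ i, symCapped c (hl i) ((a₁ i).map y) ≤
            symCapped c (h (ψ n) i) ((a₁ i).map (G (φ (ψ n))).val) + δ' := by
          rw [eventually_all]
          intro i
          obtain ⟨u, v, huv⟩ : ∃ x y, a₁ i = s(x, y) := by
            induction hxy : a₁ i using Sym2.ind with
            | _ x y => exact ⟨x, y, rfl⟩
          simp only [huv, Sym2.map_mk, symCapped_mk]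
          exact cappedEnergy_eventually_le (fun n => hnn _ _) (fun n => hshort _ _) (hh i) (hy u)
            (hy v) (hval i u v huv) hδ0
        have hsum : Tendsto (fun n => ε (φ (ψ n)) + (ℓ + ε (φ (ψ n)) - ∑ i, h (ψ n) i) * c ^ 2
            + m₀ * δ') atTop (𝓝 (0 + (ℓ + 0 - ∑ i, hl i) * c ^ 2 + m₀ * δ')) :=
          ((hεφ.add (((hεφ.const_add ℓ).sub (tendsto_finsetSum _ fun i _ => hh i)).mul_const _))).add_const _
        have hle : ∑ i, symCapped c (hl i) ((a₁ i).map y) ≤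
            0 + (ℓ + 0 - ∑ i, hl i) * c ^ 2 + m₀ * δ' := by
          refine ge_of_tendsto hsum ?_
          filter_upwards [hev] with n hn
          have h1 := (hGood (ψ n)).capped_le
          rw [capped_ofIndex] at h1
          have h2 := Finset.sum_le_sum fun i (_ : i ∈ Finset.univ) => hn i
          rw [Finset.sum_add_distrib] at h2
          simp only [Finset.sum_const, Finset.card_univ, Fintype.card_fin, nsmul_eq_mul] at h2
          linarith
        have h3 : (m₀ : ℝ) * δ' ≤ δ := by
          rw [hδ', mul_div_assoc', div_le_iff₀ (by positivity)]
          nlinarith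
        linarith }
  -- Labels which are not used must still have values in [0, c], hence the value of the base as the
  -- default.
  refine ⟨_, hlimit.relabel (fun i => (i : ℕ)) (pos := fun v => if hv : v < N then p ⟨v, hv⟩ else 0)
    (val := fun v => if hv : v < N then y ⟨v, hv⟩ else y z₀) Set.univ (fun _ _ _ _ => trivial)
    trivial (fun _ => trivial) (fun v _ => by simp; rfl) (fun v _ => by simp; rfl) (fun v => ?_)
    (fun v => ?_)⟩
  · split_ifs
    · exact hlimit.val_nonneg _
    · exact hlimit.val_nonneg z₀
  · split_ifs
    · exact hlimit.val_le _
    · exact hlimit.val_le z₀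

end Net

/-! ### Replacing edges of a net, with a new vertex. -/

open Real Filter Topology

/-- Edges with nonzero boundary values are shorter than `π`. -/
def properCond : ℝ → ℝ → ℝ → Prop := fun h x y => h < π ∨ (x = 0 ∧ y = 0)

theorem symmCond_properCond : SymmCond properCond := fun _ _ _ h => h.imp id And.symm

theorem shortCond.properCond {h x y : ℝ} (hs : shortCond h x y) : properCond h x y :=
  Or.inl (lt_of_le_of_lt hs (by linarith [pi_pos]))

namespace Net

variable {k : ℕ} {E α : Type}

/-- The sum of the energies of the edges. -/
noncomputable def edgesEnergy (val : α → ℝ) (m : Multiset (Sym2 α × ℝ)) : ℝ :=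
  (m.map fun e => symEnergy e.2 (e.1.map val)).sum

theorem energy_eq (G : Net k E α) (ℓ : ℝ) : G.energy ℓ =
    edgesEnergy G.val G.edges - (ℓ - G.total) * G.val G.base ^ 2 := rfl

@[simp] theorem edgesEnergy_cons (val : α → ℝ) (i j : α) (h : ℝ) (m : Multiset (Sym2 α × ℝ)) :
    edgesEnergy val ((s(i, j), h) ::ₘ m) = edgeEnergy h (val i) (val j) + edgesEnergy val m := by
  simp [edgesEnergy]

theorem edgesEnergy_congr {val val' : α → ℝ} {m : Multiset (Sym2 α × ℝ)}
    (h : ∀ e ∈ m, ∀ v ∈ e.1, val' v = val v) : edgesEnergy val' m = edgesEnergy val m := by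
  unfold edgesEnergy
  congr 1
  refine Multiset.map_congr rfl fun e he => ?_
  rw [Sym2.map_congr (h e he)]

/-- As the base has the value `c`, the reservoir terms agree, and the edges are compared one by one.
-/
theorem energy_le_capped [NormedAddCommGroup E] {D : Fin k → E} {P : ℝ → ℝ → ℝ → Prop}
    {c ℓ η : ℝ} {G : Net k E α} (hG : G.Good D P c ℓ η) : G.energy ℓ ≤ η := by
  refine le_trans ?_ hG.capped_le
  unfold energy capped
  rw [hG.val_base]
  have := Multiset.sum_map_le_sum_map (s := G.edges)
    (fun e => symEnergy e.2 (e.1.map G.val)) (fun e => symCapped c e.2 (e.1.map G.val))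
    fun e _ => symEnergy_le_symCapped c e.2 _
  linarith

/-- There are no loops and no parallel edges. -/
def Simple (G : Net k E α) : Prop :=
  (G.edges.map Prod.fst).Nodup ∧ ∀ e ∈ G.edges, ¬ e.1.IsDiag

theorem IsMinimal.simple [NormedAddCommGroup E] {D : Fin k → E} {P : ℝ → ℝ → ℝ → Prop}
    {c ℓ η : ℝ} {G : Net k E α} (hG : G.IsMinimal D P c ℓ η) : G.Simple :=
  ⟨hG.nodup, fun _ he => hG.not_isDiag he⟩

/-- Replacing some edges of a simple net by edges at a new vertex. -/
theorem Simple.replace {G G' : Net k E α} (hS : G.Simple) {old new r : Multiset (Sym2 α × ℝ)}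
    (hr : G.edges = old + r) (hr' : G'.edges = new + r) {w : α} (hw : ∀ e ∈ r, w ∉ e.1)
    (hnw : ∀ e ∈ new, w ∈ e.1) (hn : (new.map Prod.fst).Nodup) (hd : ∀ e ∈ new, ¬ e.1.IsDiag) :
    G'.Simple := by
  obtain ⟨h1, h2⟩ := hS
  rw [hr, Multiset.map_add, Multiset.nodup_add] at h1
  refine ⟨?_, ?_⟩
  · rw [hr', Multiset.map_add, Multiset.nodup_add]
    refine ⟨hn, h1.2.1, ?_⟩
    rw [Multiset.disjoint_left]
    rintro e he he'
    obtain ⟨x, hx, rfl⟩ := Multiset.mem_map.1 he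
    obtain ⟨y, hy, hxy⟩ := Multiset.mem_map.1 he'
    exact hw y hy (hxy ▸ hnw x hx)
  · rw [hr']
    intro e he
    rcases Multiset.mem_add.1 he with he | he
    · exact hd e he
    · exact h2 e (by rw [hr]; exact Multiset.mem_add.2 (Or.inr he))

variable [NormedAddCommGroup E] {D : Fin k → E} {P : ℝ → ℝ → ℝ → Prop} {ℓ : ℝ} {G G' : Net k E ℕ}

omit [NormedAddCommGroup E] in
/-- Replacing some edges of a net. -/
theorem Spans.replace {V V' : Finset ℕ} (hV : G.Spans V) (hVV' : V ⊆ V')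
    {old new r : Multiset (Sym2 ℕ × ℝ)} (hr : G.edges = old + r) (hr' : G'.edges = new + r)
    (hterm : G'.term = G.term) (hbase : G'.base ∈ V)
    (hnew : ∀ e ∈ new, ∀ v ∈ e.1, v ∈ V')
    (hold : ∀ a b x, (s(a, b), x) ∈ old → Conn G'.edges a b)
    (hVc : ∀ v ∈ V', v ∉ V → ∃ u ∈ V, Conn G'.edges u v) : G'.Spans V' := by
  have hmap : ∀ a b x, (s(a, b), x) ∈ G.edges → Conn G'.edges a b := by
    intro a b x hx
    rw [hr] at hx
    rcases Multiset.mem_add.1 hx with hx | hx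
    · exact hold a b x hx
    · exact Conn.of_mem (by rw [hr']; exact Multiset.mem_add.2 (Or.inr hx))
  have h1 : ∀ v ∈ V, Conn G'.edges G'.base v := fun v hv =>
    ((hV.conn _ hbase).symm.trans (hV.conn v hv)).map id hmap
  refine ⟨?_, hVV' hbase, fun a => by rw [hterm]; exact hVV' (hV.mem_term a), ?_⟩
  · rw [hr']
    intro e he v hv
    rcases Multiset.mem_add.1 he with he | he
    · exact hnew e he v hv
    · exact hVV' (hV.mem_edge e (by rw [hr]; exact Multiset.mem_add.2 (Or.inr he)) v hv)
  · intro v hv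
    by_cases hvV : v ∈ V
    · exact h1 v hvV
    · obtain ⟨u, hu, hc⟩ := hVc v hv hvV
      exact (h1 u hu).trans hc

theorem Spans.valid {V : Finset ℕ} (hV : G.Spans V) (hok : ∀ e ∈ G.edges, EdgeOk P G.pos G.val e)
    (hp : ∀ a, G.pos (G.term a) = D a) (hv : ∀ a, G.val (G.term a) = 0) (ht : G.total ≤ ℓ) :
    G.Valid D P ℓ :=
  ⟨hok, fun e he v hv => hV.conn v (hV.mem_edge e he v hv), fun a => hV.conn _ (hV.mem_term a),
    hp, hv, ht⟩

/-- Adding a new vertex `w` and replacing the edges `old` by the edges `new` at `w`. -/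
theorem Valid.addVertex (hG : G.Valid D P ℓ) {V : Finset ℕ} (hV : G.Spans V) {w : ℕ} (hw : w ∉ V)
    (x : E) (y : ℝ) (z : ℕ) (hz : z ∈ V) {old new r : Multiset (Sym2 ℕ × ℝ)}
    (hr : G.edges = old + r)
    (hok : ∀ e ∈ new, EdgeOk P (Function.update G.pos w x) (Function.update G.val w y) e)
    (hnew : ∀ e ∈ new, ∀ v ∈ e.1, v ∈ insert w V)
    (hold : ∀ a b x, (s(a, b), x) ∈ old → Conn (new + r) a b)
    (hc : ∃ u ∈ V, Conn (new + r) u w)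
    (ht : (new.map Prod.snd).sum + (r.map Prod.snd).sum ≤ ℓ) :
    (Net.mk (new + r) (Function.update G.pos w x) (Function.update G.val w y) G.term z).Valid D P ℓ ∧
    (Net.mk (new + r) (Function.update G.pos w x) (Function.update G.val w y) G.term z).Spans
      (insert w V) := by
  have hS : (Net.mk (new + r) (Function.update G.pos w x) (Function.update G.val w y)
      G.term z).Spans (insert w V) := by
    refine hV.replace (Finset.subset_insert _ _) hr rfl rfl hz hnew hold fun v hv hvV => ?_
    rcases Finset.mem_insert.1 hv with rfl | hv
    · exact hc
    · exact absurd hv hvV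
  have hne : ∀ v ∈ V, v ≠ w := fun v hv h => hw (h ▸ hv)
  refine ⟨hS.valid ?_ ?_ ?_ ?_, hS⟩
  · intro e he
    rcases Multiset.mem_add.1 he with he | he
    · exact hok e he
    · have he' : e ∈ G.edges := by rw [hr]; exact Multiset.mem_add.2 (Or.inr he)
      refine (hG.edge_ok e he').congr (fun v hv => ?_) fun v hv => ?_ <;>
      exact Function.update_of_ne (hne v (hV.mem_edge e he' v hv)) _ _
  · intro a
    exact (Function.update_of_ne (hne _ (hV.mem_term a)) _ _).trans (hG.pos_term a)
  · intro a
    exact (Function.update_of_ne (hne _ (hV.mem_term a)) _ _).trans (hG.val_term a)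
  · simpa [total] using ht

omit [NormedAddCommGroup E] in
theorem Spans.notMem_of_notMem {V : Finset ℕ} (hV : G.Spans V) {w : ℕ} (hw : w ∉ V)
    {e : Sym2 ℕ × ℝ} (he : e ∈ G.edges) : w ∉ e.1 := fun h => hw (hV.mem_edge e he w h)

theorem edgesEnergy_update {m : Multiset (Sym2 ℕ × ℝ)} {w : ℕ} (hw : ∀ e ∈ m, w ∉ e.1)
    (val : ℕ → ℝ) (y : ℝ) : edgesEnergy (Function.update val w y) m = edgesEnergy val m :=
  edgesEnergy_congr fun e he v hv =>
    Function.update_of_ne (fun h => hw e he (by rwa [← h])) _ _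

end Net

/-! ### The exchange argument for two descending edges. -/

theorem dist_lineMap_left_le {E : Type} [NormedAddCommGroup E] [NormedSpace ℝ E] {p q : E}
    {t h : ℝ} (h0 : 0 < h) (ht : 0 ≤ t) : dist p (AffineMap.lineMap p q (t / h)) = t / h * dist p q := by
  rw [dist_left_lineMap, Real.norm_eq_abs, abs_of_nonneg (by positivity)]

theorem dist_lineMap_right_le {E : Type} [NormedAddCommGroup E] [NormedSpace ℝ E] {p q : E}
    {t h : ℝ} (h0 : 0 < h) (ht : t ≤ h) :
    dist (AffineMap.lineMap p q (t / h)) q = (h - t) / h * dist p q := by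
  rw [dist_lineMap_right, Real.norm_eq_abs, abs_of_nonneg, sub_div, div_self h0.ne']
  rw [sub_nonneg, div_le_one h0]; exact ht

theorem mul_dist_le {t h d : ℝ} (h0 : 0 < h) (ht : 0 ≤ t) (hd : d ≤ h) : t / h * d ≤ t := by
  rw [div_mul_eq_mul_div, div_le_iff₀ h0]
  gcongr

/-- Both sinusoids start at the height `y` and are below it at every small positive time. The one
which is lower at a chosen time has passed the height of the other one before, by the intermediate
value theorem. -/
theorem exists_equal_levels {y s₁ s₂ ε : ℝ} (hy : 0 < y) (h1 : s₁ ≤ 0) (h2 : s₂ ≤ 0)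
    (hε : 0 < ε) : ∃ δ t, 0 < δ ∧ δ < ε ∧ 0 < t ∧ t < ε ∧ sinusoid y s₁ δ = sinusoid y s₂ t := by
  have key : ∀ {s₁ s₂ t₀ : ℝ}, s₁ ≤ 0 → s₂ ≤ 0 → 0 < t₀ → t₀ < π →
      sinusoid y s₁ t₀ ≤ sinusoid y s₂ t₀ → ∃ δ, 0 < δ ∧ δ ≤ t₀ ∧
        sinusoid y s₁ δ = sinusoid y s₂ t₀ := by
    intro s₁ s₂ t₀ h1 h2 ht hp hle
    have hlt : sinusoid y s₂ t₀ < y := by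
      have hs := sin_pos_of_length ht hp
      have hc : cos t₀ < 1 := by
        have := cos_lt_cos_of_nonneg_of_le_pi le_rfl hp.le ht
        rwa [cos_zero] at this
      unfold sinusoid
      nlinarith
    obtain ⟨δ, hδ, e⟩ := intermediate_value_Icc' ht.le
      (continuous_sinusoid y s₁).continuousOn ⟨hle, by simpa using hlt.le⟩
    refine ⟨δ, lt_of_le_of_ne hδ.1 fun h0 => ?_, hδ.2, e⟩
    rw [← h0, sinusoid_zero] at e
    linarith
  have ht0 : 0 < min (ε / 2) 1 := by positivity
  have htε : min (ε / 2) 1 < ε := (min_le_left _ _).trans_lt (by linarith)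
  have htp : min (ε / 2) 1 < π := (min_le_right _ _).trans_lt (by linarith [pi_gt_three])
  rcases le_total (sinusoid y s₁ (min (ε / 2) 1)) (sinusoid y s₂ (min (ε / 2) 1)) with h | h
  · obtain ⟨δ, hδ, hδ', e⟩ := key h1 h2 ht0 htp h
    exact ⟨δ, _, hδ, hδ'.trans_lt htε, ht0, htε, e⟩
  · obtain ⟨δ, hδ, hδ', e⟩ := key h2 h1 ht0 htp h
    exact ⟨_, δ, ht0, htε, hδ, hδ'.trans_lt htε, e.symm⟩

/-- The energy is (s² - y²) sin δ cos δ - 2ys sin² δ. For s ≤ 0 this is at least -y² sin δ cos δ,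
which exceeds -δy². So the piece next to a vertex from which an edge descends is worse than a
reservoir at that vertex. -/
theorem neg_lt_edgeEnergy_of_descending {y s δ : ℝ} (hy : 0 < y) (hs : s ≤ 0) (h0 : 0 < δ)
    (hp : δ < π / 2) : -(δ * y ^ 2) < edgeEnergy δ y (sinusoid y s δ) := by
  have e := edgeEnergy_sinusoid (a := 0) (b := δ) y s (by linarith) (by linarith)
  simp only [sub_zero, sinusoid_zero] at e
  rw [e]
  have hsin := sin_pos_of_length h0 (by linarith)
  have hcos : 0 < cos δ := cos_pos_of_mem_Ioo ⟨by linarith, hp⟩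
  have hlt := sin_lt h0
  have hc1 := cos_le_one δ
  unfold sinusoid
  have e2 : (y * cos δ + s * sin δ) * (s * cos δ + -y * sin δ) - y * s =
      (s ^ 2 - y ^ 2) * (sin δ * cos δ) - 2 * y * s * sin δ ^ 2 := by
    have : cos δ ^ 2 = 1 - sin δ ^ 2 := by linarith [sin_sq_add_cos_sq δ]
    ring_nf
    rw [this]; ring
  rw [e2]
  have h3 : sin δ * cos δ < δ := by nlinarith
  have h4 : 0 ≤ s ^ 2 * (sin δ * cos δ) := by positivity
  have h5 : 0 ≤ -(y * s) * sin δ ^ 2 := by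
    have : y * s ≤ 0 := mul_nonpos_of_nonneg_of_nonpos hy.le hs
    have : 0 ≤ -(y * s) := by linarith
    positivity
  have h6 : 0 < y ^ 2 := by positivity
  nlinarith

namespace Net

variable {k : ℕ} {E : Type} [NormedAddCommGroup E] [NormedSpace ℝ E] {D : Fin k → E} {ℓ : ℝ}
  {G : Net k E ℕ}

/-- If the energy is nonnegative on all nets, then a net of energy zero and full length has no
edge with slack from whose end `v` this edge and another one descend: the edge could be cut and
attached to the other one. -/
theorem not_descending_of_slack
    (hF : ∀ G : Net k E ℕ, G.Valid D properCond ℓ → G.Simple → 0 ≤ G.energy ℓ)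
    (hG : G.Valid D properCond ℓ) (hS : G.Simple) (ht : G.total = ℓ) (hE : G.energy ℓ ≤ 0)
    {i v j : ℕ} {h₁ h₂ : ℝ} {r : Multiset (Sym2 ℕ × ℝ)}
    (hr : G.edges = (s(i, v), h₁) ::ₘ (s(v, j), h₂) ::ₘ r)
    (hslack : dist (G.pos i) (G.pos v) < h₁) (hv : 0 < G.val v) (h2 : 0 < h₂)
    (d1 : G.val i ≤ G.val v * cos h₁) (d2 : G.val j ≤ G.val v * cos h₂) : False := by
  obtain ⟨V, hV⟩ := hG.exists_spans
  obtain ⟨w, hw⟩ := Infinite.exists_notMem_finset V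
  have m1 : (s(i, v), h₁) ∈ G.edges := by rw [hr]; simp
  have m2 : (s(v, j), h₂) ∈ G.edges := by rw [hr]; simp
  have k1 := hG.edge_ok _ m1 i v rfl
  have k2 := hG.edge_ok _ m2 v j rfl
  have h1 : 0 < h₁ := dist_nonneg.trans_lt hslack
  have p1 : h₁ < π := k1.2.2.resolve_right fun h => hv.ne' h.2
  have p2 : h₂ < π := k2.2.2.resolve_right fun h => hv.ne' h.1
  have iV : i ∈ V := hV.mem_edge _ m1 i (Sym2.mem_mk_left _ _)
  have vV : v ∈ V := hV.mem_edge _ m1 v (Sym2.mem_mk_right _ _)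
  have jV : j ∈ V := hV.mem_edge _ m2 j (Sym2.mem_mk_right _ _)
  have hne : ∀ {u}, u ∈ V → u ≠ w := fun hu h => hw (h ▸ hu)
  have s1 := sin_pos_of_length h1 p1
  have s2 := sin_pos_of_length h2 p2
  -- Both lengths are taken below σ/2, so that the slack pays for the removed length δ and for the
  -- detour t. The bound 1 keeps δ below π/2, and h₁ and h₂ keep the cuts interior.
  set σ := h₁ - dist (G.pos i) (G.pos v) with hσ
  obtain ⟨δ, t, δ0, δε, t0, tε, e⟩ := exists_equal_levels
    (s₁ := (G.val i - G.val v * cos h₁) / sin h₁) (s₂ := (G.val j - G.val v * cos h₂) / sin h₂)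
    (ε := min (min (σ / 2) 1) (min h₁ h₂)) hv
    (div_nonpos_of_nonpos_of_nonneg (by linarith) s1.le)
    (div_nonpos_of_nonpos_of_nonneg (by linarith) s2.le)
    (lt_min (lt_min (by linarith) one_pos) (lt_min h1 h2))
  simp only [lt_min_iff] at δε tε
  set y := sinusoid (G.val v) ((G.val i - G.val v * cos h₁) / sin h₁) δ with hy
  have en1 := edgeEnergy_split (G.val v) ((G.val i - G.val v * cos h₁) / sin h₁) δ0 δε.2.1 p1
  have en2 := edgeEnergy_split (G.val v) ((G.val j - G.val v * cos h₂) / sin h₂) t0 tε.2.2 p2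
  rw [exists_sinusoid h1 p1, ← hy] at en1
  rw [exists_sinusoid h2 p2, ← e] at en2
  have en3 := neg_lt_edgeEnergy_of_descending
    (s := (G.val i - G.val v * cos h₁) / sin h₁) hv
    (div_nonpos_of_nonpos_of_nonneg (by linarith) s1.le) δ0 (by linarith [pi_gt_three])
  rw [← hy] at en3
  set x : E := AffineMap.lineMap (G.pos v) (G.pos j) (t / h₂) with hx
  have dv : dist (G.pos v) x ≤ t := by
    rw [dist_lineMap_left_le h2 t0.le]; exact mul_dist_le h2 t0.le k2.1
  have dj : dist x (G.pos j) ≤ h₂ - t := by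
    rw [dist_lineMap_right_le h2 tε.2.2.le]; exact mul_dist_le h2 (by linarith) k2.1
  have di : dist (G.pos i) x ≤ h₁ - δ := by
    have := dist_triangle (G.pos i) (G.pos v) x
    linarith
  -- The first edge, shortened by δ, is attached to the second one at the point `w` of equal height.
  -- The length δ becomes a reservoir at `v`. Taking `v` as the new base costs nothing, since the
  -- old reservoir is empty.
  set new : Multiset (Sym2 ℕ × ℝ) :=
    (s(i, w), h₁ - δ) ::ₘ (s(v, w), t) ::ₘ (s(w, j), h₂ - t) ::ₘ 0 with hnew
  have hr' : G.edges = ((s(i, v), h₁) ::ₘ (s(v, j), h₂) ::ₘ 0) + r := by rw [hr]; simp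
  have hmem : ∀ {e}, e ∈ new → e ∈ new + r := fun he => Multiset.mem_add.2 (Or.inl he)
  have c1 : Conn (new + r) i w := Conn.of_mem (h := h₁ - δ) (hmem (by rw [hnew]; simp))
  have c2 : Conn (new + r) v w := Conn.of_mem (h := t) (hmem (by rw [hnew]; simp))
  have c3 : Conn (new + r) w j := Conn.of_mem (h := h₂ - t) (hmem (by rw [hnew]; simp))
  have htot : h₁ + (h₂ + (r.map Prod.snd).sum) = ℓ := by rw [← ht]; simp [total, hr]
  have hnt : (new.map Prod.snd).sum = h₁ + h₂ - δ := by
    simp only [hnew, Multiset.map_cons, Multiset.map_zero, Multiset.sum_cons, Multiset.sum_zero]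
    ring
  obtain ⟨hV', hS'⟩ := hG.addVertex hV hw x y v vV (new := new) hr' (by
      simp only [hnew, Multiset.mem_cons, Multiset.notMem_zero, or_false, forall_eq_or_imp,
        forall_eq]
      refine ⟨EdgeOk.mk symmCond_properCond ?_ ?_ ?_, EdgeOk.mk symmCond_properCond ?_ ?_ ?_,
        EdgeOk.mk symmCond_properCond ?_ ?_ ?_⟩
      · rw [Function.update_self, Function.update_of_ne (hne iV)]; exact di
      · intro h; linarith
      · exact Or.inl (by linarith)
      · rw [Function.update_self, Function.update_of_ne (hne vV)]; exact dv
      · intro h; linarith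
      · exact Or.inl (by linarith)
      · rw [Function.update_self, Function.update_of_ne (hne jV)]; exact dj
      · intro h; linarith
      · exact Or.inl (by linarith)) (by
      simp only [hnew, Multiset.mem_cons, Multiset.notMem_zero, or_false, forall_eq_or_imp,
        forall_eq, Sym2.mem_iff, Finset.mem_insert]
      refine ⟨⟨Or.inr iV, Or.inl trivial⟩, ⟨Or.inr vV, Or.inl trivial⟩, Or.inl trivial,
        Or.inr jV⟩)
    (Conn.map_cons id (c1.trans c2.symm) (Conn.map_cons id (c2.trans c3)
      fun _ _ _ h => absurd h (Multiset.notMem_zero _))) ⟨v, vV, c2⟩ (by rw [hnt]; linarith)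
  have hwr : ∀ e ∈ r, w ∉ e.1 := fun e he => hV.notMem_of_notMem hw (by rw [hr]; simp [he])
  have iv : i ≠ v := fun h => hS.2 _ m1 (by simp [h])
  have vj : v ≠ j := fun h => hS.2 _ m2 (by simp [h])
  have ij : i ≠ j := fun h => by
    have := hS.1
    rw [hr, Multiset.map_cons, Multiset.map_cons, Multiset.nodup_cons] at this
    exact this.1 (by simp [h, Sym2.eq_swap])
  have hS'' := hS.replace (G' := Net.mk (new + r) (Function.update G.pos w x)
      (Function.update G.val w y) G.term v) hr' rfl hwr
    (by simp [hnew])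
    (by
      simp only [hnew, Multiset.map_cons, Multiset.map_zero, Multiset.nodup_cons,
        Multiset.mem_cons, Multiset.notMem_zero, Sym2.eq_iff]
      have := hne iV; have := hne vV; have := hne jV
      simp_all)
    (by
      have := hne iV; have := hne vV; have := (hne jV).symm
      simp_all)
  have hfin := hF _ hV' hS''
  rw [energy_eq] at hfin hE
  have ht' : (Net.mk (new + r) (Function.update G.pos w x) (Function.update G.val w y)
      G.term v).total = ℓ - δ := by
    simp only [total, Multiset.map_add, Multiset.sum_add, hnt]; linarith
  rw [ht'] at hfin
  rw [ht, hr] at hE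
  have hen : edgesEnergy (Function.update G.val w y) (new + r) =
      edgeEnergy (h₁ - δ) (G.val i) y + (edgeEnergy t (G.val v) y +
        (edgeEnergy (h₂ - t) y (G.val j) + edgesEnergy G.val r)) := by
    simp only [hnew, Multiset.cons_add, zero_add, edgesEnergy_cons, edgesEnergy_update hwr,
      Function.update_self, Function.update_of_ne (hne iV), Function.update_of_ne (hne vV),
      Function.update_of_ne (hne jV)]
  simp only [Function.update_of_ne (hne vV), hen] at hfin
  simp only [edgesEnergy_cons] at hE
  rw [edgeEnergy_comm h₁, en1, en2] at hE
  rw [edgeEnergy_comm (h₁ - δ)] at hfin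
  linarith

end Net

/-! ### Subdivision, pendant edges, and first consequences of extremality. -/

open Real Filter Topology

namespace Net

variable {k : ℕ} {E : Type}

/-- Cutting the edge `(s(i, j), h)` at a new vertex `w`; the other edges are `r`. -/
def subdivide (G : Net k E ℕ) (r : Multiset (Sym2 ℕ × ℝ)) (i w j : ℕ) (t t' : ℝ) (x : E) (y : ℝ) :
    Net k E ℕ where
  edges := (s(i, w), t) ::ₘ (s(w, j), t') ::ₘ r
  pos := Function.update G.pos w x
  val := Function.update G.val w y
  term := G.term
  base := G.base

/-- Attaching an edge of length `β` which ends in a new vertex `w` to the base vertex. -/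
def pendant (G : Net k E ℕ) (w : ℕ) (β : ℝ) (x : E) : Net k E ℕ where
  edges := (s(G.base, w), β) ::ₘ G.edges
  pos := Function.update G.pos w x
  val := Function.update G.val w (G.val G.base)
  term := G.term
  base := G.base

variable [NormedAddCommGroup E] {D : Fin k → E} {ℓ : ℝ} {G : Net k E ℕ}

/-- The value at the new vertex is left free, so the comparison of energies is conditional. On an
edge of length at least π the boundary values are zero, and then the new value must be zero too. -/
theorem Valid.subdivide (hG : G.Valid D properCond ℓ) (hS : G.Simple) {V : Finset ℕ}
    (hV : G.Spans V) {w : ℕ} (hw : w ∉ V) {i j : ℕ} {h : ℝ} {r : Multiset (Sym2 ℕ × ℝ)}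
    (hr : G.edges = (s(i, j), h) ::ₘ r) {x : E} {y t : ℝ} (t0 : 0 < t) (ht : t < h)
    (di : dist (G.pos i) x ≤ t) (dj : dist x (G.pos j) ≤ h - t)
    (hc : h < π ∨ (G.val i = 0 ∧ G.val j = 0 ∧ y = 0)) :
    (G.subdivide r i w j t (h - t) x y).Valid D properCond ℓ ∧
    (G.subdivide r i w j t (h - t) x y).Simple ∧
    (G.subdivide r i w j t (h - t) x y).Spans (insert w V) ∧
    (G.subdivide r i w j t (h - t) x y).total = G.total ∧
    (edgeEnergy t (G.val i) y + edgeEnergy (h - t) y (G.val j) ≤ edgeEnergy h (G.val i) (G.val j) →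
      (G.subdivide r i w j t (h - t) x y).energy ℓ ≤ G.energy ℓ) := by
  have m1 : (s(i, j), h) ∈ G.edges := by rw [hr]; simp
  have iV : i ∈ V := hV.mem_edge _ m1 i (Sym2.mem_mk_left _ _)
  have jV : j ∈ V := hV.mem_edge _ m1 j (Sym2.mem_mk_right _ _)
  have hne : ∀ {u}, u ∈ V → u ≠ w := fun hu h => hw (h ▸ hu)
  have ij : i ≠ j := fun h => hS.2 _ m1 (by simp [h])
  have hwr : ∀ e ∈ r, w ∉ e.1 := fun e he => hV.notMem_of_notMem hw (by rw [hr]; simp [he])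
  set new : Multiset (Sym2 ℕ × ℝ) := (s(i, w), t) ::ₘ (s(w, j), h - t) ::ₘ 0 with hnew
  have hr' : G.edges = ((s(i, j), h) ::ₘ 0) + r := by rw [hr]; simp
  have hG' : G.subdivide r i w j t (h - t) x y = Net.mk (new + r) (Function.update G.pos w x)
      (Function.update G.val w y) G.term G.base := by
    simp [Net.subdivide, hnew]
  have hmem : ∀ {e}, e ∈ new → e ∈ new + r := fun he => Multiset.mem_add.2 (Or.inl he)
  have c1 : Conn (new + r) i w := Conn.of_mem (h := t) (hmem (by rw [hnew]; simp))
  have c3 : Conn (new + r) w j := Conn.of_mem (h := h - t) (hmem (by rw [hnew]; simp))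
  have htot : h + (r.map Prod.snd).sum = G.total := by simp [total, hr]
  have hnt : (new.map Prod.snd).sum = h := by simp [hnew]
  obtain ⟨hV', hS'⟩ := hG.addVertex hV hw x y G.base hV.mem_base (new := new) hr' (by
      simp only [hnew, Multiset.mem_cons, Multiset.notMem_zero, or_false, forall_eq_or_imp,
        forall_eq]
      refine ⟨EdgeOk.mk symmCond_properCond ?_ ?_ ?_, EdgeOk.mk symmCond_properCond ?_ ?_ ?_⟩
      · rw [Function.update_self, Function.update_of_ne (hne iV)]; exact di
      · intro h; linarith
      · rw [Function.update_self, Function.update_of_ne (hne iV)]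
        exact hc.imp (fun h => by linarith) fun h => ⟨h.1, h.2.2⟩
      · rw [Function.update_self, Function.update_of_ne (hne jV)]; exact dj
      · intro h; linarith
      · rw [Function.update_self, Function.update_of_ne (hne jV)]
        exact hc.imp (fun h => by linarith) fun h => ⟨h.2.2, h.2.1⟩) (by
      simp only [hnew, Multiset.mem_cons, Multiset.notMem_zero, or_false, forall_eq_or_imp,
        forall_eq, Sym2.mem_iff, Finset.mem_insert]
      exact ⟨⟨Or.inr iV, Or.inl trivial⟩, Or.inl trivial, Or.inr jV⟩)
    (Conn.map_cons id (c1.trans c3) fun _ _ _ h => absurd h (Multiset.notMem_zero _)) ⟨i, iV, c1⟩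
    (by rw [hnt, htot]; exact hG.total_le)
  have hS'' := hS.replace (G' := Net.mk (new + r) (Function.update G.pos w x)
      (Function.update G.val w y) G.term G.base) hr' rfl hwr
    (by simp [hnew])
    (by
      simp only [hnew, Multiset.map_cons, Multiset.map_zero, Multiset.nodup_cons,
        Multiset.mem_cons, Multiset.notMem_zero, Sym2.eq_iff]
      have := hne iV; have := hne jV
      simp_all)
    (by
      have := hne iV; have := (hne jV).symm
      simp_all)
  have ht' : (G.subdivide r i w j t (h - t) x y).total = G.total := by
    rw [hG']
    simp only [total, Multiset.map_add, Multiset.sum_add, hnt]; exact htot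
  refine ⟨hG' ▸ hV', hG' ▸ hS'', hG' ▸ hS', ht', fun hle => ?_⟩
  rw [energy_eq, energy_eq, ht']
  have hb : (G.subdivide r i w j t (h - t) x y).val (G.subdivide r i w j t (h - t) x y).base =
      G.val G.base := Function.update_of_ne (hne hV.mem_base) _ _
  rw [hb]
  have : edgesEnergy (G.subdivide r i w j t (h - t) x y).val
      (G.subdivide r i w j t (h - t) x y).edges =
      edgeEnergy t (G.val i) y + (edgeEnergy (h - t) y (G.val j) + edgesEnergy G.val r) := by
    simp only [Net.subdivide, edgesEnergy_cons, edgesEnergy_update hwr,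
      Function.update_self, Function.update_of_ne (hne iV), Function.update_of_ne (hne jV)]
  rw [this, hr, edgesEnergy_cons]
  linarith

/-- The new leaf has the value of the base, so the effect is a comparison of `edgeEnergy_self` with
a constant function on the same length. -/
theorem Valid.pendant (hG : G.Valid D properCond ℓ) (hS : G.Simple) {V : Finset ℕ}
    (hV : G.Spans V) {w : ℕ} (hw : w ∉ V) {β : ℝ} {x : E} (h0 : 0 < β) (hβ : G.total + β ≤ ℓ)
    (hp : β < π) (hd : dist (G.pos G.base) x ≤ β) :
    (G.pendant w β x).Valid D properCond ℓ ∧ (G.pendant w β x).Simple ∧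
    (G.pendant w β x).Spans (insert w V) ∧ (G.pendant w β x).total = G.total + β ∧
    (G.pendant w β x).energy ℓ ≤ G.energy ℓ ∧
    (G.val G.base ≠ 0 → (G.pendant w β x).energy ℓ < G.energy ℓ) := by
  have hne : ∀ {u}, u ∈ V → u ≠ w := fun hu h => hw (h ▸ hu)
  have bV := hV.mem_base
  have hwr : ∀ e ∈ G.edges, w ∉ e.1 := fun e he => hV.notMem_of_notMem hw he
  set new : Multiset (Sym2 ℕ × ℝ) := (s(G.base, w), β) ::ₘ 0 with hnew
  have hG' : G.pendant w β x = Net.mk (new + G.edges) (Function.update G.pos w x)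
      (Function.update G.val w (G.val G.base)) G.term G.base := by
    simp [Net.pendant, hnew]
  have c1 : Conn (new + G.edges) G.base w := Conn.of_mem (h := β) (by simp [hnew])
  have hnt : (new.map Prod.snd).sum = β := by simp [hnew]
  have hr' : G.edges = 0 + G.edges := by simp
  obtain ⟨hV', hS'⟩ := hG.addVertex hV hw x (G.val G.base) G.base bV (new := new) hr' (by
      simp only [hnew, Multiset.mem_cons, Multiset.notMem_zero, or_false, forall_eq]
      refine EdgeOk.mk symmCond_properCond ?_ ?_ ?_
      · rw [Function.update_self, Function.update_of_ne (hne bV)]; exact hd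
      · intro h; linarith
      · exact Or.inl hp) (by
      simp only [hnew, Multiset.mem_cons, Multiset.notMem_zero, or_false,
        forall_eq, Sym2.mem_iff, Finset.mem_insert]
      rintro v (rfl | rfl)
      exacts [Or.inr bV, Or.inl rfl])
    (fun _ _ _ h => absurd h (Multiset.notMem_zero _)) ⟨_, bV, c1⟩
    (by rw [hnt]; have : G.total = (G.edges.map Prod.snd).sum := rfl
        linarith)
  have hS'' := hS.replace (G' := Net.mk (new + G.edges) (Function.update G.pos w x)
      (Function.update G.val w (G.val G.base)) G.term G.base) hr' rfl hwr
    (by simp [hnew]) (by simp [hnew])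
    (by simpa [hnew] using hne bV)
  have ht' : (G.pendant w β x).total = G.total + β := by
    simp [total, Net.pendant, add_comm]
  have hb : (G.pendant w β x).val (G.pendant w β x).base = G.val G.base :=
    Function.update_of_ne (hne bV) _ _
  have hen : edgesEnergy (G.pendant w β x).val (G.pendant w β x).edges =
      edgeEnergy β (G.val G.base) (G.val G.base) + edgesEnergy G.val G.edges := by
    simp only [Net.pendant, edgesEnergy_cons, edgesEnergy_update hwr,
      Function.update_self, Function.update_of_ne (hne bV)]
  refine ⟨hG' ▸ hV', hG' ▸ hS'', hG' ▸ hS', ht', ?_, fun h => ?_⟩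
  · rw [energy_eq, energy_eq, ht', hb, hen]
    linarith [edgeEnergy_self_le h0 hp (G.val G.base)]
  · rw [energy_eq, energy_eq, ht', hb, hen]
    linarith [edgeEnergy_self_lt h0 hp h]

section Extremal

variable [NormedSpace ℝ E]
  (hF : ∀ G : Net k E ℕ, G.Valid D properCond ℓ → G.Simple → 0 ≤ G.energy ℓ)
  (hG : G.Valid D properCond ℓ) (hS : G.Simple)

include hF hG hS

-- Unspent length could be used for a pendant edge at the base, and the energy would become
-- negative. The minimum with 1 keeps this edge shorter than π.
omit [NormedSpace ℝ E] in
theorem total_eq_of_energy_nonpos (hE : G.energy ℓ ≤ 0) (hb : G.val G.base ≠ 0) : G.total = ℓ := by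
  by_contra hne
  have hlt : G.total < ℓ := lt_of_le_of_ne hG.total_le hne
  obtain ⟨V, hV⟩ := hG.exists_spans
  obtain ⟨w, hw⟩ := Infinite.exists_notMem_finset V
  have hβ : 0 < min (ℓ - G.total) 1 := lt_min (by linarith) one_pos
  obtain ⟨h1, h2, -, -, -, h3⟩ := hG.pendant hS hV hw (x := G.pos G.base) hβ
    (by linarith [min_le_left (ℓ - G.total) 1])
    ((min_le_right _ _).trans_lt (by linarith [pi_gt_three])) (by simpa using hβ.le)
  linarith [hF _ h1 h2, h3 hb]

omit [NormedSpace ℝ E] in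
/-- An edge with vanishing boundary values has no slack. -/
theorem dist_eq_of_val_eq_zero (ht : G.total = ℓ) (hE : G.energy ℓ ≤ 0) (hb : G.val G.base ≠ 0)
    {i j : ℕ} {h : ℝ} (hm : (s(i, j), h) ∈ G.edges) (hi : G.val i = 0) (hj : G.val j = 0) :
    dist (G.pos i) (G.pos j) = h := by
  obtain ⟨r, hr⟩ := Multiset.exists_cons_of_mem hm
  refine ((hG.edge_ok _ hm i j rfl).1.lt_or_eq).resolve_left fun hlt => ?_
  simp only at hlt
  set d := dist (G.pos i) (G.pos j) with hd
  have htot : h + (r.map Prod.snd).sum = ℓ := by rw [← ht]; simp [total, hr]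
  have ht' : ({ G with edges := (s(i, j), d) ::ₘ r } : Net k E ℕ).total = ℓ - (h - d) := by
    simp only [total, Multiset.map_cons, Multiset.sum_cons]; linarith
  have hmap : ∀ a b x, (s(a, b), x) ∈ G.edges → Conn ((s(i, j), d) ::ₘ r) a b := by
    rw [hr]
    exact Conn.map_cons id (Conn.of_mem (Multiset.mem_cons_self _ _))
      fun a b x hx => Conn.of_mem (Multiset.mem_cons_of_mem hx)
  have hsub : ∀ e ∈ r, e ∈ G.edges := fun e he => by rw [hr]; simp [he]
  -- With zero boundary values the edge has energy zero whatever its length. Shortening it is free,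
  -- and the reservoir gains.
  have hfin := hF { G with edges := (s(i, j), d) ::ₘ r }
    { edge_ok := fun e he => by
        rcases Multiset.mem_cons.1 he with rfl | he
        · exact EdgeOk.mk symmCond_properCond le_rfl (fun _ => hi.trans hj.symm) (Or.inr ⟨hi, hj⟩)
        · exact hG.edge_ok e (hsub e he)
      conn_edge := fun e he v hv => by
        rcases Multiset.mem_cons.1 he with rfl | he
        · exact (hG.conn_edge _ hm v hv).map id hmap
        · exact (hG.conn_edge _ (hsub e he) v hv).map id hmap
      conn_term := fun a => (hG.conn_term a).map id hmap
      pos_term := hG.pos_term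
      val_term := hG.val_term
      total_le := by rw [ht']; linarith }
    ⟨by have := hS.1; rw [hr] at this; simpa using this, by have := hS.2; rw [hr] at this; simpa using this⟩
  rw [energy_eq, ht'] at hfin
  rw [energy_eq, ht, hr, edgesEnergy_cons, hi, hj] at hE
  simp only [edgesEnergy_cons, hi, hj, edgeEnergy_zero_zero] at hfin hE
  have : 0 < (h - d) * G.val G.base ^ 2 := by
    have : 0 < h - d := by linarith
    positivity
  linarith

omit [NormedSpace ℝ E] in
/-- The value at a vertex of degree two minimizes the energy. -/
theorem edgeEnergy_add_le_of_degree_two (hE : G.energy ℓ ≤ 0) {i v j : ℕ} {h₁ h₂ : ℝ}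
    {r : Multiset (Sym2 ℕ × ℝ)} (hr : G.edges = (s(i, v), h₁) ::ₘ (s(v, j), h₂) ::ₘ r)
    (hvr : ∀ e ∈ r, v ∉ e.1) (hb : v ≠ G.base) (ht : ∀ a, v ≠ G.term a)
    (h1 : 0 < h₁) (p1 : h₁ < π) (h2 : 0 < h₂) (p2 : h₂ < π) (y : ℝ) :
    edgeEnergy h₁ (G.val i) (G.val v) + edgeEnergy h₂ (G.val v) (G.val j) ≤
      edgeEnergy h₁ (G.val i) y + edgeEnergy h₂ y (G.val j) := by
  have m1 : (s(i, v), h₁) ∈ G.edges := by rw [hr]; simp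
  have m2 : (s(v, j), h₂) ∈ G.edges := by rw [hr]; simp
  have iv : i ≠ v := fun h => hS.2 _ m1 (by simp [h])
  have jv : j ≠ v := fun h => hS.2 _ m2 (by simp [h])
  have hfin := hF { G with val := Function.update G.val v y }
    { edge_ok := fun e he => by
        rw [hr] at he
        rcases Multiset.mem_cons.1 he with rfl | he
        · exact EdgeOk.mk symmCond_properCond (hG.edge_ok _ m1 i v rfl).1
            (fun h => absurd h h1.ne') (Or.inl p1)
        rcases Multiset.mem_cons.1 he with rfl | he
        · exact EdgeOk.mk symmCond_properCond (hG.edge_ok _ m2 v j rfl).1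
            (fun h => absurd h h2.ne') (Or.inl p2)
        · exact (hG.edge_ok e (by rw [hr]; simp [he])).congr (fun _ _ => rfl) fun u hu =>
            Function.update_of_ne (fun h => hvr e he (by rwa [← h])) _ _
      conn_edge := hG.conn_edge
      conn_term := hG.conn_term
      pos_term := hG.pos_term
      val_term := fun a => (Function.update_of_ne (ht a).symm _ _).trans (hG.val_term a)
      total_le := hG.total_le } hS
  rw [energy_eq] at hE hfin
  have e1 : ({ G with val := Function.update G.val v y } : Net k E ℕ).total = G.total := rfl
  rw [e1] at hfin
  simp only [hr, edgesEnergy_cons, edgesEnergy_update hvr, Function.update_self,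
    Function.update_of_ne iv, Function.update_of_ne jv, Function.update_of_ne hb.symm] at hfin hE
  linarith

/-- The ends of an edge with slack: one of them has a positive value and the edge descends
from it. -/
theorem descending_of_slack (ht : G.total = ℓ) (hE : G.energy ℓ ≤ 0) (hb : G.val G.base ≠ 0)
    (h0 : ∀ v, 0 ≤ G.val v) {i j : ℕ} {h : ℝ} (hm : (s(i, j), h) ∈ G.edges)
    (hd : dist (G.pos i) (G.pos j) < h) :
    (0 < G.val i ∧ G.val j ≤ G.val i * cos h) ∨ (0 < G.val j ∧ G.val i ≤ G.val j * cos h) := by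
  obtain ⟨r, hr⟩ := Multiset.exists_cons_of_mem hm
  have hpos : 0 < G.val i ∨ 0 < G.val j := by
    by_contra! hcon
    exact hd.ne (dist_eq_of_val_eq_zero hF hG hS ht hE hb hm (le_antisymm hcon.1 (h0 i))
      (le_antisymm hcon.2 (h0 j)))
  have hh : 0 < h := dist_nonneg.trans_lt hd
  have hp : h < π := (hG.edge_ok _ hm i j rfl).2.2.resolve_right fun h => by
    rcases hpos with h' | h'
    · exact h'.ne' h.1
    · exact h'.ne' h.2
  have hs := sin_pos_of_length hh hp
  by_contra! hcon
  have hj : G.val i * cos h < G.val j := by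
    rcases (h0 i).eq_or_lt with h' | h'
    · rw [← h', zero_mul]; exact hpos.resolve_left (by rw [← h']; exact lt_irrefl _)
    · exact hcon.1 h'
  have hi : G.val j * cos h < G.val i := by
    rcases (h0 j).eq_or_lt with h' | h'
    · rw [← h', zero_mul]; exact hpos.resolve_right (by rw [← h']; exact lt_irrefl _)
    · exact hcon.2 h'
  set s := (G.val j - G.val i * cos h) / sin h with hsdef
  have hsp : 0 < s := div_pos (by linarith) hs
  have hend := exists_sinusoid hh hp (G.val i) (G.val j)
  rw [← hsdef] at hend
  have hend' : sinusoid s (-G.val i) h < 0 := by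
    have : sinusoid s (-G.val i) h * sin h = G.val j * cos h - G.val i := by
      unfold sinusoid
      rw [hsdef]
      field_simp
      have := sin_sq_add_cos_sq h
      have : sin h ^ 2 = 1 - cos h ^ 2 := by linarith
      rw [this]; ring
    by_contra! hc
    nlinarith
  -- If the edge descends from neither end, the sinusoid rises at first and falls at last, so it has
  -- an interior maximum at `t` and equals y cos (· - t).
  obtain ⟨t, htI, hte⟩ := intermediate_value_Ioo' hh.le
    (continuous_sinusoid s (-G.val i)).continuousOn ⟨hend', by simpa using hsp⟩
  set y := sinusoid (G.val i) s t with hy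
  have ts := sin_sq_add_cos_sq t
  have yi : G.val i = y * cos t := by
    have e1 : y * cos t - sinusoid s (-G.val i) t * sin t = G.val i * (sin t ^ 2 + cos t ^ 2) := by
      rw [hy]; unfold sinusoid; ring
    rw [hte, ts] at e1
    linarith
  have ys : s = y * sin t := by
    have e1 : y * sin t + sinusoid s (-G.val i) t * cos t = s * (sin t ^ 2 + cos t ^ 2) := by
      rw [hy]; unfold sinusoid; ring
    rw [hte, ts] at e1
    linarith
  have yj : G.val j = y * cos (h - t) := by
    rw [← hend, cos_sub]
    unfold sinusoid
    rw [ys, yi]; ring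
  have y0 : 0 < y := by
    have := sin_pos_of_length htI.1 (htI.2.trans hp)
    by_contra! hc
    nlinarith
  obtain ⟨V, hV⟩ := hG.exists_spans
  obtain ⟨w, hw⟩ := Infinite.exists_notMem_finset V
  have hne : ∀ {u}, u ∈ V → u ≠ w := fun hu h => hw (h ▸ hu)
  have iV : i ∈ V := hV.mem_edge _ hm i (Sym2.mem_mk_left _ _)
  have jV : j ∈ V := hV.mem_edge _ hm j (Sym2.mem_mk_right _ _)
  -- Cutting in proportion to the length distributes the slack over both parts. At the top `w` both
  -- parts descend, and the first one still has slack.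
  set x : E := AffineMap.lineMap (G.pos i) (G.pos j) (t / h) with hx
  have dx : dist (G.pos i) x < t := by
    rw [dist_lineMap_left_le hh htI.1.le, div_mul_eq_mul_div, div_lt_iff₀ hh]
    exact mul_lt_mul_of_pos_left hd htI.1
  have dx' : dist x (G.pos j) ≤ h - t := by
    rw [dist_lineMap_right_le hh htI.2.le]; exact mul_dist_le hh (by linarith [htI.2]) hd.le
  obtain ⟨v1, v2, -, v4, v5⟩ := hG.subdivide hS hV hw hr (y := y) htI.1 htI.2 dx.le dx' (Or.inl hp)
  have hsplit := edgeEnergy_split (G.val i) s htI.1 htI.2 hp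
  rw [hend] at hsplit
  refine not_descending_of_slack hF v1 v2 (v4.trans ht) ((v5 hsplit.symm.le).trans hE)
    (i := i) (v := w) (j := j) (h₁ := t) (h₂ := h - t) (r := r) rfl ?_ ?_ (by linarith [htI.2]) ?_ ?_
  · simpa [Net.subdivide, Function.update_of_ne (hne iV)] using dx
  · simpa [Net.subdivide] using y0
  · simp [Net.subdivide, Function.update_of_ne (hne iV), yi]
  · simp [Net.subdivide, Function.update_of_ne (hne jV), yj]

end Extremal

end Net

/-! ### Sliding a vertex of degree three. -/

open Real Filter Topology

namespace Net

open Classical in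
/-- The factor `ρ` on `A`, `σ` on `B`, and `1` elsewhere. -/
noncomputable def scaling (A B : Set ℕ) (ρ σ : ℝ) (u : ℕ) : ℝ :=
  if u ∈ A then ρ else if u ∈ B then σ else 1

theorem exists_edgesEnergy_scaling (A B : Set ℕ) (val : ℕ → ℝ) (m : Multiset (Sym2 ℕ × ℝ))
    (hA : ∀ i j h, (s(i, j), h) ∈ m → (i ∈ A ↔ j ∈ A))
    (hB : ∀ i j h, (s(i, j), h) ∈ m → (i ∈ B ↔ j ∈ B)) :
    ∃ EA EB E0 : ℝ, ∀ ρ σ, edgesEnergy (fun u => scaling A B ρ σ u * val u) m =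
      ρ ^ 2 * EA + σ ^ 2 * EB + E0 := by
  induction m using Multiset.induction with
  | empty => exact ⟨0, 0, 0, fun ρ σ => by simp [edgesEnergy]⟩
  | cons e m ih =>
    obtain ⟨EA, EB, E0, hE⟩ := ih (fun i j h hm => hA i j h (Multiset.mem_cons_of_mem hm))
      fun i j h hm => hB i j h (Multiset.mem_cons_of_mem hm)
    obtain ⟨e, h⟩ := e
    induction e using Sym2.ind with
    | _ i j =>
      have ha := hA i j h (Multiset.mem_cons_self _ _)
      have hb := hB i j h (Multiset.mem_cons_self _ _)
      by_cases iA : i ∈ A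
      · refine ⟨EA + edgeEnergy h (val i) (val j), EB, E0, fun ρ σ => ?_⟩
        rw [edgesEnergy_cons, hE]
        simp only [scaling, iA, ha.1 iA, if_true, edgeEnergy_smul]
        ring
      · have jA : j ∉ A := fun h => iA (ha.2 h)
        by_cases iB : i ∈ B
        · refine ⟨EA, EB + edgeEnergy h (val i) (val j), E0, fun ρ σ => ?_⟩
          rw [edgesEnergy_cons, hE]
          simp only [scaling, iA, jA, iB, hb.1 iB, if_true, if_false,
            edgeEnergy_smul]
          ring
        · have jB : j ∉ B := fun h => iB (hb.2 h)
          refine ⟨EA, EB, E0 + edgeEnergy h (val i) (val j), fun ρ σ => ?_⟩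
          rw [edgesEnergy_cons, hE]
          simp only [scaling, iA, jA, iB, jB, if_false, one_mul]
          ring

variable {k : ℕ} {E : Type} [NormedAddCommGroup E] [NormedSpace ℝ E] {D : Fin k → E} {ℓ : ℝ}
  {G : Net k E ℕ}

/-- Moving the vertex `v` along the edge to `a`, and scaling the values on the branches at `a`
and `b`. -/
theorem nonneg_of_scaling
    (hF : ∀ G : Net k E ℕ, G.Valid D properCond ℓ → G.Simple → 0 ≤ G.energy ℓ)
    (hG : G.Valid D properCond ℓ) (hS : G.Simple) (ht : G.total = ℓ)
    {i v a b : ℕ} {h₀ h₁ h₂ : ℝ} {r : Multiset (Sym2 ℕ × ℝ)}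
    (hr : G.edges = (s(i, v), h₀) ::ₘ (s(v, a), h₁) ::ₘ (s(v, b), h₂) ::ₘ r)
    (hvr : ∀ e ∈ r, v ∉ e.1) (hv : 0 < G.val v) (h1 : 0 < h₁) (h2 : 0 < h₂)
    (hab : ¬ Conn r a b) (hai : ¬ Conn r a i) (hbi : ¬ Conn r b i) {EA EB E0 : ℝ}
    (hEE : ∀ ρ σ, edgesEnergy (fun u => scaling {u | Conn r a u} {u | Conn r b u} ρ σ u * G.val u) r
      = ρ ^ 2 * EA + σ ^ 2 * EB + E0)
    (ρ σ : ℝ) {δ : ℝ} (hδ : 0 ≤ δ) (hδ1 : δ < h₁) (hδ0 : dist (G.pos i) (G.pos v) + δ ≤ h₀)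
    (hδ2 : h₂ + δ < π) :
    0 ≤ edgeEnergy h₀ (G.val i) (G.val v) + edgeEnergy (h₁ - δ) (G.val v) (ρ * G.val a) +
      edgeEnergy (h₂ + δ) (G.val v) (σ * G.val b) + (ρ ^ 2 * EA + σ ^ 2 * EB + E0) := by
  have m0 : (s(i, v), h₀) ∈ G.edges := by rw [hr]; simp
  have m1 : (s(v, a), h₁) ∈ G.edges := by rw [hr]; simp
  have m2 : (s(v, b), h₂) ∈ G.edges := by rw [hr]; simp
  have iv : i ≠ v := fun h => hS.2 _ m0 (by simp [h])
  have av : a ≠ v := fun h => hS.2 _ m1 (by simp [h])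
  have bv : b ≠ v := fun h => hS.2 _ m2 (by simp [h])
  have hnv : ∀ u, u ≠ v → ¬ Conn r u v := fun u hu hc => by
    obtain ⟨e, he⟩ := Multiset.exists_mem_of_ne_zero (hc.incident_ne_zero hu)
    exact hvr e (mem_incident.1 he).1 (mem_incident.1 he).2
  have k0 := hG.edge_ok _ m0 i v rfl
  have k1 := hG.edge_ok _ m1 v a rfl
  have k2 := hG.edge_ok _ m2 v b rfl
  have p1 : h₁ < π := k1.2.2.resolve_right fun h => hv.ne' h.1
  set sc := scaling {u | Conn r a u} {u | Conn r b u} ρ σ with hsc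
  have scv : sc v = 1 := by simp [hsc, scaling, hnv a av, hnv b bv]
  have sci : sc i = 1 := by simp [hsc, scaling, hai, hbi]
  have sca : sc a = ρ := by simp [hsc, scaling, Conn.refl]
  have scb : sc b = σ := by simp [hsc, scaling, Conn.refl, hab]
  -- The edge to `a` becomes shorter by δ and the edge to `b` longer by δ, so the total length is
  -- unchanged. The edge to `i` keeps its length, its slack allowing for the displacement.
  set x : E := AffineMap.lineMap (G.pos v) (G.pos a) (δ / h₁) with hx
  have dv : dist (G.pos v) x ≤ δ := by
    rw [dist_lineMap_left_le h1 hδ]; exact mul_dist_le h1 hδ k1.1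
  have da : dist x (G.pos a) ≤ h₁ - δ := by
    rw [dist_lineMap_right_le h1 hδ1.le]; exact mul_dist_le h1 (by linarith) k1.1
  have di : dist (G.pos i) x ≤ h₀ := by
    have := dist_triangle (G.pos i) (G.pos v) x
    linarith
  have db : dist x (G.pos b) ≤ h₂ + δ := by
    have := dist_triangle x (G.pos v) (G.pos b)
    have := k2.1
    simp only at this
    linarith [dist_comm x (G.pos v)]
  set es : Multiset (Sym2 ℕ × ℝ) :=
    (s(i, v), h₀) ::ₘ (s(v, a), h₁ - δ) ::ₘ (s(v, b), h₂ + δ) ::ₘ r with hes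
  have hmap : ∀ p q y, (s(p, q), y) ∈ G.edges → Conn es p q := by
    rw [hr]
    refine Conn.map_cons id (Conn.of_mem (h := h₀) (by simp [hes]))
      (Conn.map_cons id (Conn.of_mem (h := h₁ - δ) (by simp [hes]))
        (Conn.map_cons id (Conn.of_mem (h := h₂ + δ) (by simp [hes]))
          fun p q y hy => Conn.of_mem (h := y) (by simp [hes, hy])))
  have hfst : es.map Prod.fst = G.edges.map Prod.fst := by simp [hes, hr]
  have hmem : ∀ e ∈ es, ∃ e' ∈ G.edges, e'.1 = e.1 := fun e he => by
    have := Multiset.mem_map_of_mem Prod.fst he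
    rw [hfst] at this
    exact Multiset.mem_map.1 this
  have hvt : ∀ t, G.term t ≠ v := fun t h => hv.ne' (h ▸ hG.val_term t)
  have htot : (Net.mk es (Function.update G.pos v x) (fun u => sc u * G.val u) G.term G.base).total
      = ℓ := by
    rw [← ht]; simp only [total, hes, hr, Multiset.map_cons, Multiset.sum_cons]; ring
  have hfin := hF (Net.mk es (Function.update G.pos v x) (fun u => sc u * G.val u) G.term G.base)
    { edge_ok := fun e he => by
        rcases Multiset.mem_cons.1 he with rfl | he
        · refine EdgeOk.mk symmCond_properCond ?_ ?_ ?_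
          · simpa [Function.update_of_ne iv] using di
          · simpa [sci, scv] using k0.2.1
          · simpa [sci, scv] using k0.2.2
        rcases Multiset.mem_cons.1 he with rfl | he
        · refine EdgeOk.mk symmCond_properCond ?_ (fun h => by linarith) (Or.inl (by linarith))
          simpa [Function.update_of_ne av] using da
        rcases Multiset.mem_cons.1 he with rfl | he
        · refine EdgeOk.mk symmCond_properCond ?_ (fun h => by linarith) (Or.inl hδ2)
          simpa [Function.update_of_ne bv] using db
        · have hok := hG.edge_ok e (by rw [hr]; simp [he])
          intro p q hpq
          have hc : Conn r p q := Conn.of_mem (h := e.2) (by rw [← hpq]; exact he)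
          have heq : sc p = sc q := by
            have e1 : Conn r a p ↔ Conn r a q := ⟨fun h => h.trans hc, fun h => h.trans hc.symm⟩
            have e2 : Conn r b p ↔ Conn r b q := ⟨fun h => h.trans hc, fun h => h.trans hc.symm⟩
            rcases iff_iff_and_or_not_and_not.1 e1 with ⟨y1, y2⟩ | ⟨y1, y2⟩ <;>
            rcases iff_iff_and_or_not_and_not.1 e2 with ⟨y3, y4⟩ | ⟨y3, y4⟩ <;>
            simp [hsc, scaling, y1, y2, y3, y4]
          have hp : p ≠ v := fun h => hvr e he (by rw [hpq, h]; simp)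
          have hq : q ≠ v := fun h => hvr e he (by rw [hpq, h]; simp)
          obtain ⟨o1, o2, o3⟩ := hok p q hpq
          refine ⟨by simpa [Function.update_of_ne hp, Function.update_of_ne hq] using o1,
            fun h => by simp only; rw [heq, o2 h], o3.imp id fun h => by simp [h.1, h.2]⟩
      conn_edge := fun e he u hu => by
        obtain ⟨e', he', h⟩ := hmem e he
        exact (hG.conn_edge e' he' u (h ▸ hu)).map id hmap
      conn_term := fun t => (hG.conn_term t).map id hmap
      pos_term := fun t => (Function.update_of_ne (hvt t) _ _).trans (hG.pos_term t)
      val_term := fun t => by simp [hG.val_term t]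
      total_le := htot.le }
    ⟨by simpa only [hfst] using hS.1, fun e he => by
      obtain ⟨e', he', h⟩ := hmem e he
      exact h ▸ hS.2 e' he'⟩
  have hE2 : edgesEnergy (fun u => sc u * G.val u) r = _ := hEE ρ σ
  rw [energy_eq, htot] at hfin
  simp only [sub_self, zero_mul, sub_zero, hes, edgesEnergy_cons, hE2, sca, scb, sci, scv,
    one_mul] at hfin
  linarith

/-- The quadratic polynomial attains its minimum at 1, so its derivative vanishes there. -/
theorem eq_of_min_at_one {A B C : ℝ} (h : ∀ ρ : ℝ, 0 ≤ A * ρ ^ 2 - 2 * B * ρ + C)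
    (h1 : A - 2 * B + C ≤ 0) : A = B := by
  have key : ∀ t : ℝ, 0 ≤ A * t ^ 2 + 2 * (A - B) * t := fun t => by
    have := h (1 + t)
    nlinarith
  have hA : 0 ≤ A := by
    have := key 1
    have := key (-1)
    linarith
  by_contra hne
  have hne : A - B ≠ 0 := sub_ne_zero.2 hne
  -- The denominator A + 1, instead of A, covers the case A = 0.
  have := key (-(A - B) / (A + 1))
  have e : A * (-(A - B) / (A + 1)) ^ 2 + 2 * (A - B) * (-(A - B) / (A + 1)) =
      -((A - B) ^ 2 * (A + 2)) / (A + 1) ^ 2 := by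
    field_simp; ring
  rw [e] at this
  have : 0 < (A - B) ^ 2 * (A + 2) / (A + 1) ^ 2 := by positivity
  have e3 : -((A - B) ^ 2 * (A + 2)) / (A + 1) ^ 2 = -((A - B) ^ 2 * (A + 2) / (A + 1) ^ 2) := by
    ring
  linarith

/-- The energy of an edge from `v` to `a` whose length is changed by `-δ`, together with that of a
branch at `a` in equilibrium, after scaling. -/
theorem edgeEnergy_add_scaled {y s h δ : ℝ} (h0 : 0 < h) (hp : h < π) (hδ : 0 < h - δ)
    (hδp : h - δ < π) (hpos : sinusoid y s δ ≠ 0) {EA : ℝ}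
    (hEA : edgeEnergy h y (sinusoid y s h) + EA = -(y * s)) :
    edgeEnergy (h - δ) y (y / sinusoid y s δ * sinusoid y s h) + (y / sinusoid y s δ) ^ 2 * EA =
      -(y ^ 2 * sinusoid s (-y) δ / sinusoid y s δ) := by
  have e1 := edgeEnergy_sinusoid (a := 0) (b := h) y s (by linarith) (by linarith)
  have e2 := edgeEnergy_sinusoid (a := δ) (b := h) y s hδ hδp
  simp only [sub_zero, sinusoid_zero] at e1
  set p := sinusoid y s δ
  have e3 := edgeEnergy_smul (y / p) (h - δ) p (sinusoid y s h)
  rw [div_mul_cancel₀ _ hpos, e2] at e3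
  rw [e3]
  have : EA = -(sinusoid y s h * sinusoid s (-y) h) := by linarith
  rw [this]
  field_simp
  ring

/-- A vertex of degree three at which an edge with slack ends has no two ascending edges. -/
theorem not_ascending_of_slack
    (hF : ∀ G : Net k E ℕ, G.Valid D properCond ℓ → G.Simple → 0 ≤ G.energy ℓ)
    (hG : G.Valid D properCond ℓ) (hS : G.Simple) (ht : G.total = ℓ) (hE : G.energy ℓ ≤ 0)
    {i v a b : ℕ} {h₀ h₁ h₂ : ℝ} {r : Multiset (Sym2 ℕ × ℝ)}
    (hr : G.edges = (s(i, v), h₀) ::ₘ (s(v, a), h₁) ::ₘ (s(v, b), h₂) ::ₘ r)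
    (hvr : ∀ e ∈ r, v ∉ e.1) (hv : 0 < G.val v) (h1 : 0 < h₁) (h2 : 0 < h₂)
    (hab : ¬ Conn r a b) (hai : ¬ Conn r a i) (hbi : ¬ Conn r b i)
    (hslack : dist (G.pos i) (G.pos v) < h₀)
    (s1 : 0 < (G.val a - G.val v * cos h₁) / sin h₁)
    (s12 : (G.val a - G.val v * cos h₁) / sin h₁ ≤ (G.val b - G.val v * cos h₂) / sin h₂) :
    False := by
  have m1 : (s(v, a), h₁) ∈ G.edges := by rw [hr]; simp
  have m2 : (s(v, b), h₂) ∈ G.edges := by rw [hr]; simp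
  have p1 : h₁ < π := (hG.edge_ok _ m1 v a rfl).2.2.resolve_right fun h => hv.ne' h.1
  have p2 : h₂ < π := (hG.edge_ok _ m2 v b rfl).2.2.resolve_right fun h => hv.ne' h.1
  have q1 := sin_pos_of_length h1 p1
  have q2 := sin_pos_of_length h2 p2
  have g1 := exists_sinusoid h1 p1 (G.val v) (G.val a)
  have g2 := exists_sinusoid h2 p2 (G.val v) (G.val b)
  set c1 := (G.val a - G.val v * cos h₁) / sin h₁ with hc1
  set c2 := (G.val b - G.val v * cos h₂) / sin h₂ with hc2
  set y := G.val v with hy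
  obtain ⟨EA, EB, E0, hEE⟩ := exists_edgesEnergy_scaling {u | Conn r a u} {u | Conn r b u} G.val r
    (fun i j h hm => ⟨fun hc => Conn.trans hc (Conn.of_mem hm),
      fun hc => Conn.trans hc (Conn.of_mem hm).symm⟩)
    (fun i j h hm => ⟨fun hc => Conn.trans hc (Conn.of_mem hm),
      fun hc => Conn.trans hc (Conn.of_mem hm).symm⟩)
  have key := fun ρ σ δ => nonneg_of_scaling hF hG hS ht hr hvr hv h1 h2 hab hai hbi hEE ρ σ (δ := δ)
  have hE1 : edgesEnergy G.val r = EA + EB + E0 := by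
    have := hEE 1 1
    have e : (fun u => scaling {u | Conn r a u} {u | Conn r b u} 1 1 u * G.val u) = G.val := by
      funext u; simp [scaling]
    rw [e] at this
    linarith
  rw [energy_eq, ht, hr] at hE
  simp only [edgesEnergy_cons, hE1, sub_self, zero_mul, sub_zero] at hE
  -- Optimality under scaling of the branch at `a`, without moving `v`. The edge and its branch then
  -- have together the energy -y times the initial slope.
  have eq1 : edgeEnergy h₁ y (G.val a) + EA = -(y * c1) := by
    have : EA + G.val a ^ 2 * (cos h₁ / sin h₁) = y * G.val a / sin h₁ := by
      refine eq_of_min_at_one (C := edgeEnergy h₀ (G.val i) y + y ^ 2 * (cos h₁ / sin h₁) +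
        edgeEnergy h₂ y (G.val b) + EB + E0) (fun ρ => ?_) ?_
      · refine le_trans (key ρ 1 0 le_rfl h1 (by linarith) (by linarith)) (le_of_eq ?_)
        simp only [edgeEnergy, sub_zero, add_zero]
        ring
      · refine le_trans (le_of_eq ?_) hE
        simp only [edgeEnergy]
        ring
    have h3 : EA = y * G.val a / sin h₁ - G.val a ^ 2 * (cos h₁ / sin h₁) := by linarith
    rw [h3, hc1]
    unfold edgeEnergy
    field_simp
    ring
  have eq2 : edgeEnergy h₂ y (G.val b) + EB = -(y * c2) := by
    have : EB + G.val b ^ 2 * (cos h₂ / sin h₂) = y * G.val b / sin h₂ := by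
      refine eq_of_min_at_one (C := edgeEnergy h₀ (G.val i) y + y ^ 2 * (cos h₂ / sin h₂) +
        edgeEnergy h₁ y (G.val a) + EA + E0) (fun σ => ?_) ?_
      · refine le_trans (key 1 σ 0 le_rfl h1 (by linarith) (by linarith)) (le_of_eq ?_)
        simp only [edgeEnergy, sub_zero, add_zero]
        ring
      · refine le_trans (le_of_eq ?_) hE
        simp only [edgeEnergy]
        ring
    have h3 : EB = y * G.val b / sin h₂ - G.val b ^ 2 * (cos h₂ / sin h₂) := by linarith
    rw [h3, hc2]
    unfold edgeEnergy
    field_simp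
    ring
  obtain ⟨δ, δ0, δ1, δ2, δ3, δ4, δq⟩ : ∃ δ, 0 < δ ∧ δ < h₁ ∧ dist (G.pos i) (G.pos v) + δ ≤ h₀ ∧
      h₂ + δ < π ∧ δ < π / 2 ∧ 0 < sinusoid y c2 (-δ) := by
    have ev : ∀ᶠ δ in 𝓝[>] (0 : ℝ), 0 < sinusoid y c2 (-δ) := by
      have : Continuous fun δ => sinusoid y c2 (-δ) := (continuous_sinusoid y c2).comp continuous_neg
      have := (this.tendsto 0).eventually (lt_mem_nhds (a := 0) (by simpa using hv))
      exact this.filter_mono nhdsWithin_le_nhds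
    have m : ∀ {c : ℝ}, 0 < c → ∀ᶠ δ in 𝓝[>] (0 : ℝ), δ < c := fun hc =>
      (Iio_mem_nhds hc : _ ∈ 𝓝 (0 : ℝ)) |> fun h => mem_nhdsWithin_of_mem_nhds h
    obtain ⟨δ, a1, a2, a3, a4, a5, a6⟩ := (ev.and ((m h1).and ((m (sub_pos.2 hslack)).and
      ((m (sub_pos.2 p2)).and ((m (half_pos pi_pos)).and self_mem_nhdsWithin))))).exists
    exact ⟨δ, a6, a2, by linarith, by linarith, a5, a1⟩
  have hsd := sin_pos_of_length δ0 (by linarith)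
  have hcd : 0 < cos δ := cos_pos_of_mem_Ioo ⟨by linarith, δ4⟩
  have hpp : 0 < sinusoid y c1 δ := by unfold sinusoid; positivity
  -- The old sinusoids are kept, restarted at time δ towards `a` and at time -δ towards `b`, and the
  -- branches are rescaled so that the value at `v` remains `y`.
  have fin := key (y / sinusoid y c1 δ) (y / sinusoid y c2 (-δ)) δ δ0.le δ1 δ2 δ3
  rw [← g1] at eq1
  rw [← g2] at eq2
  have r1 := edgeEnergy_add_scaled (δ := δ) h1 p1 (by linarith) (by linarith) hpp.ne' eq1
  have r2 := edgeEnergy_add_scaled (δ := -δ) h2 p2 (by linarith) (by linarith) δq.ne' eq2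
  rw [g1] at r1 eq1
  rw [g2, sub_neg_eq_add] at r2
  rw [g2] at eq2
  have sq := sin_sq_add_cos_sq δ
  have t1 : y * c1 - y ^ 2 * sinusoid c1 (-y) δ / sinusoid y c1 δ =
      y * ((c1 ^ 2 + y ^ 2) * sin δ / sinusoid y c1 δ) := by
    have : sinusoid y c1 δ = y * cos δ + c1 * sin δ := rfl
    have h3 : sinusoid c1 (-y) δ = c1 * cos δ - y * sin δ := by unfold sinusoid; ring
    field_simp
    rw [h3, this]; ring
  have t2 : y ^ 2 * sinusoid c2 (-y) (-δ) / sinusoid y c2 (-δ) - y * c2 =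
      y * ((c2 ^ 2 + y ^ 2) * sin δ / sinusoid y c2 (-δ)) := by
    have : sinusoid y c2 (-δ) = y * cos δ - c2 * sin δ := by unfold sinusoid; simp; ring
    have h3 : sinusoid c2 (-y) (-δ) = c2 * cos δ + y * sin δ := by unfold sinusoid; simp
    field_simp
    rw [h3, this]; ring
  -- The left side is, up to the factor `y`, the loss towards `a`, and the right side the gain
  -- towards `b`. The gain has the larger numerator as c1 ≤ c2, and the smaller denominator as both
  -- slopes are positive.
  have t3 : (c1 ^ 2 + y ^ 2) * sin δ / sinusoid y c1 δ <
      (c2 ^ 2 + y ^ 2) * sin δ / sinusoid y c2 (-δ) := by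
    have hlt : sinusoid y c2 (-δ) < sinusoid y c1 δ := by
      unfold sinusoid
      rw [cos_neg, sin_neg]
      have := mul_pos s1 hsd
      have := mul_pos (s1.trans_le s12) hsd
      linarith
    have hle : (c1 ^ 2 + y ^ 2) * sin δ ≤ (c2 ^ 2 + y ^ 2) * sin δ := by gcongr
    have hp0 : 0 < (c1 ^ 2 + y ^ 2) * sin δ := by positivity
    calc _ < (c1 ^ 2 + y ^ 2) * sin δ / sinusoid y c2 (-δ) := by gcongr
      _ ≤ _ := by gcongr
  have t4 := mul_lt_mul_of_pos_left t3 hv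
  linarith

end Net

/-! ### Lengths, leaves and degrees in a minimal net. -/

open Real Filter Topology

namespace Net

theorem exists_of_card_incident_eq_three {m : Multiset (Sym2 ℕ × ℝ)} {i v : ℕ} {h : ℝ}
    (hm : (s(i, v), h) ∈ m) (hc : (incident m v).card = 3) : ∃ a b h₁ h₂ r,
      m = (s(i, v), h) ::ₘ (s(v, a), h₁) ::ₘ (s(v, b), h₂) ::ₘ r ∧ ∀ e ∈ r, v ∉ e.1 := by
  have hi : (s(i, v), h) ∈ incident m v := mem_incident.2 ⟨hm, Sym2.mem_mk_right _ _⟩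
  obtain ⟨t, ht⟩ := Multiset.exists_cons_of_mem hi
  rw [ht, Multiset.card_cons] at hc
  obtain ⟨x, y, rfl⟩ := Multiset.card_eq_two.1 (by omega : t.card = 2)
  obtain ⟨a, ha⟩ := exists_mem_incident (m := m) (v := v) (e := x) (by rw [ht]; simp)
  obtain ⟨b, hb⟩ := exists_mem_incident (m := m) (v := v) (e := y) (by rw [ht]; simp)
  obtain ⟨r, hr, hvr⟩ := eq_add_of_incident_eq ht
  refine ⟨a, b, x.2, y.2, r, ?_, hvr⟩
  rw [← ha, ← hb, hr]
  simp

variable {k : ℕ} {E : Type} [NormedAddCommGroup E] {D : Fin k → E} {ℓ : ℝ} {G : Net k E ℕ}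

/-- In a minimal net all edges have positive length. -/
theorem IsMinimal.length_pos (hG : G.IsMinimal D properCond 1 ℓ 0) (hD : Function.Injective D)
    {i j : ℕ} {h : ℝ} (hm : (s(i, j), h) ∈ G.edges) : 0 < h := by
  -- Ends of an edge of length zero have the same position and value. Identifying them keeps the
  -- number of edges and creates a loop, which is impossible in a minimal net.
  have key : ∀ i j : ℕ, (s(i, j), (0 : ℝ)) ∈ G.edges → j ≠ G.base → (∀ a, j ≠ G.term a) → False := by
    intro i j hm hb ht
    obtain ⟨o1, o2, -⟩ := hG.1.edge_ok _ hm i j rfl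
    have hp : G.pos i = G.pos j := dist_le_zero.1 o1
    have hv : G.val i = G.val j := o2 rfl
    have h2 : ∀ (F : ℕ → E), F i = F j → ∀ v, F (Function.update id j i v) = F v := by
      intro F hF v
      by_cases hvj : v = j
      · simp [hvj, hF]
      · simp [hvj]
    have h3 : ∀ (F : ℕ → ℝ), F i = F j → ∀ v, F (Function.update id j i v) = F v := by
      intro F hF v
      by_cases hvj : v = j
      · simp [hvj, hF]
      · simp [hvj]
    have hg := hG.1.relabel (Function.update id j i) (pos := G.pos) (val := G.val) Set.univ
      (fun _ _ _ _ => trivial) trivial (fun _ => trivial) (fun v _ => h2 G.pos hp v)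
      (fun v _ => h3 G.val hv v) hG.1.val_nonneg hG.1.val_le
    have hmin : (G.relabel (Function.update id j i) G.pos G.val).IsMinimal D properCond 1 ℓ 0 :=
      ⟨hg, fun G' h' => by simpa [Net.relabel] using hG.2 G' h'⟩
    have hij : i ≠ j := hG.ne_of_mem hm
    refine hmin.ne_of_mem (i := i) (j := i) (h := 0) ?_ rfl
    exact Multiset.mem_map.2 ⟨_, hm, by simp [hij]⟩
  have h0 := hG.1.toValid.length_nonneg hm
  refine lt_of_le_of_ne h0 fun hz => ?_
  change (0:ℝ) = h at hz
  subst hz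
  have hij : i ≠ j := hG.ne_of_mem hm
  obtain ⟨o1, o2, -⟩ := hG.1.edge_ok _ hm i j rfl
  have hv : G.val i = G.val j := o2 rfl
  have hp : G.pos i = G.pos j := dist_le_zero.1 o1
  by_cases hj : j ≠ G.base ∧ ∀ a, j ≠ G.term a
  · exact key i j hm hj.1 hj.2
  by_cases hi : i ≠ G.base ∧ ∀ a, i ≠ G.term a
  · exact key j i (Sym2.eq_swap ▸ hm) hi.1 hi.2
  -- What remains are ends which are terminals or the base. The base differs from terminals by its
  -- value, and terminals differ by their positions.
  have hj' : j = G.base ∨ ∃ a, j = G.term a := by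
    by_contra! hcon; exact hj hcon
  have hi' : i = G.base ∨ ∃ a, i = G.term a := by
    by_contra! hcon; exact hi hcon
  have hb := hG.1.val_base
  rcases hi' with hi' | ⟨a, hi'⟩ <;> rcases hj' with hj' | ⟨b, hj'⟩
  · exact hij (hi'.trans hj'.symm)
  · rw [hi', hj', hb, hG.1.val_term] at hv; exact one_ne_zero hv
  · rw [hi', hj', hb, hG.1.val_term] at hv; exact zero_ne_one hv
  · rw [hi', hj', hG.1.pos_term, hG.1.pos_term] at hp
    exact hij (by rw [hi', hj', hD hp])

theorem IsMinimal.base_ne_term (hG : G.IsMinimal D properCond 1 ℓ 0) (a : Fin k) :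
    G.base ≠ G.term a := fun h => by
  have := hG.1.val_base
  rw [h, hG.1.val_term] at this
  exact zero_ne_one this

/-- The base vertex of a minimal net can be placed such that an edge which leads to it as a leaf
has no slack. -/
theorem IsMinimal.exists_tight_leaf [NormedSpace ℝ E] [Nontrivial E]
    (hG : G.IsMinimal D properCond 1 ℓ 0) : ∃ G' : Net k E ℕ, G'.IsMinimal D properCond 1 ℓ 0 ∧
      ((incident G'.edges G'.base).card = 1 → ∀ i h, (s(i, G'.base), h) ∈ G'.edges →
        dist (G'.pos i) (G'.pos G'.base) = h) := by
  by_cases hc : (incident G.edges G.base).card = 1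
  swap
  · exact ⟨G, hG, fun h => absurd h hc⟩
  obtain ⟨e, he⟩ := Multiset.card_eq_one.1 hc
  obtain ⟨i, hi⟩ := exists_mem_incident (m := G.edges) (v := G.base) (e := e) (by simp [he])
  have hm : e ∈ G.edges := (mem_incident.1 (by rw [he]; simp : e ∈ incident G.edges G.base)).1
  obtain ⟨r, hr, hvr⟩ := eq_add_of_incident_eq he
  have hib : G.base ≠ i := hG.ne_of_mem (h := e.2) (hi ▸ hm)
  have h0 : 0 ≤ e.2 := hG.1.toValid.length_nonneg hm
  -- The base is not a terminal, so its position is free. As a leaf it may be moved to the distance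
  -- from its neighbour which equals the length of its edge.
  obtain ⟨u, hu⟩ := _root_.exists_norm_eq E h0
  have hd : dist (G.pos i) (G.pos i + u) = e.2 := by simp [hu]
  have hE : ∀ e' ∈ G.edges, G.base ∈ e'.1 → e' = e := fun e' he' hb => by
    have : e' ∈ incident G.edges G.base := mem_incident.2 ⟨he', hb⟩
    rw [he] at this
    simpa using this
  refine ⟨{ G with pos := Function.update G.pos G.base (G.pos i + u) }, ⟨?_, hG.2⟩, ?_⟩
  · exact
    { hG.1 with
      edge_ok := fun e' he' => by
        by_cases hb : G.base ∈ e'.1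
        · rw [hE e' he' hb, hi]
          obtain ⟨o1, o2, o3⟩ := hG.1.edge_ok e hm G.base i (congrArg Prod.fst hi)
          refine EdgeOk.mk symmCond_properCond ?_ o2 o3
          simp only [Function.update_self, Function.update_of_ne hib.symm]
          rw [dist_comm, hd]
        · exact (hG.1.edge_ok e' he').congr
            (fun v hv => Function.update_of_ne (fun h => hb (by rwa [← h])) _ _) fun _ _ => rfl
      pos_term := fun a =>
        (Function.update_of_ne (hG.base_ne_term a).symm _ _).trans (hG.1.pos_term a) }
  · intro _ j h hj
    have h1 := hE _ hj (Sym2.mem_mk_right _ _)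
    have h2 : s(j, G.base) = s(G.base, i) := by
      have := congrArg Prod.fst h1
      simp only at this
      rw [this, hi]
    have hji : j = i := by
      rcases Sym2.eq_iff.1 h2 with ⟨-, h3⟩ | ⟨h3, -⟩
      · exact absurd h3 hib
      · exact h3
    have hh : h = e.2 := congrArg Prod.snd h1
    simp only [Function.update_self, hji, Function.update_of_ne hib.symm, hd, hh]

theorem eq_zero_of_quadratic_nonneg {A C : ℝ} (h : ∀ t : ℝ, 0 ≤ A * t ^ 2 + 2 * C * t) :
    0 ≤ A ∧ C = 0 := by
  have hA : 0 ≤ A := by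
    have := h 1
    have := h (-1)
    linarith
  refine ⟨hA, ?_⟩
  by_contra hne
  have := h (-C / (A + 1))
  have e : A * (-C / (A + 1)) ^ 2 + 2 * C * (-C / (A + 1)) = -(C ^ 2 * (A + 2) / (A + 1) ^ 2) := by
    field_simp; ring
  have : 0 < C ^ 2 * (A + 2) / (A + 1) ^ 2 := by positivity
  linarith

/-- The energy is quadratic in the middle value, with leading coefficient cot h₁ + cot h₂. These are
the second and the first order conditions. -/
theorem critical_of_minimal {h₁ h₂ a b y₀ : ℝ}
    (h : ∀ y, edgeEnergy h₁ a y₀ + edgeEnergy h₂ y₀ b ≤ edgeEnergy h₁ a y + edgeEnergy h₂ y b) :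
    0 ≤ cos h₁ / sin h₁ + cos h₂ / sin h₂ ∧
      (cos h₁ / sin h₁ + cos h₂ / sin h₂) * y₀ = a / sin h₁ + b / sin h₂ := by
  have := eq_zero_of_quadratic_nonneg (A := cos h₁ / sin h₁ + cos h₂ / sin h₂)
    (C := (cos h₁ / sin h₁ + cos h₂ / sin h₂) * y₀ - (a / sin h₁ + b / sin h₂)) fun t => by
      have := h (y₀ + t)
      unfold edgeEnergy at this
      refine le_trans (sub_nonneg.2 this) (le_of_eq ?_)
      ring
  exact ⟨this.1, sub_eq_zero.1 this.2⟩

section Structure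

variable [NormedSpace ℝ E]
  (hF : ∀ G : Net k E ℕ, G.Valid D properCond ℓ → G.Simple → 0 ≤ G.energy ℓ)
  (hG : G.IsMinimal D properCond 1 ℓ 0)

include hF hG

omit [NormedSpace ℝ E] in
theorem IsMinimal.total_eq : G.total = ℓ :=
  total_eq_of_energy_nonpos hF hG.1.toValid hG.simple (energy_le_capped hG.1)
    (by rw [hG.1.val_base]; exact one_ne_zero)

/-- In a minimal net all vertices but the terminals and the base vertex have degree at least
three. -/
theorem IsMinimal.three_le_card_incident (hD : Function.Injective D) {v : ℕ}
    (hc : Conn G.edges G.base v) (hb : v ≠ G.base) (ht : ∀ a, v ≠ G.term a) :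
    3 ≤ (incident G.edges v).card := by
  have h2 := hG.two_le_card_incident hc hb ht
  by_contra hlt
  obtain ⟨i, j, h₁, h₂, r, hr, -, hvr⟩ := exists_of_card_incident_eq_two
    (by omega : (incident G.edges v).card = 2)
  have m1 : (s(i, v), h₁) ∈ G.edges := by rw [hr]; simp
  have m2 : (s(v, j), h₂) ∈ G.edges := by rw [hr]; simp
  have hV := hG.1.toValid
  have hE := energy_le_capped hG.1
  have l1 := hG.length_pos hD m1
  have l2 := hG.length_pos hD m2
  have c1 := (hV.edge_ok _ m1 i v rfl).2.2
  have c2 := (hV.edge_ok _ m2 v j rfl).2.2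
  have yi := hG.1.val_nonneg i
  have yv := hG.1.val_nonneg v
  have yj := hG.1.val_nonneg j
  have zero : ¬ (G.val i = 0 ∧ G.val v = 0 ∧ G.val j = 0) := by
    rintro ⟨e1, e2, e3⟩
    refine hG.not_merge symmCond_properCond hr hvr hb ht (Or.inr ⟨e1, e3⟩) ?_
    have : ∀ h : ℝ, 0 < h → cappedEnergy 1 h 0 0 = 0 := fun h h0 => by
      simp only [cappedEnergy, edgeEnergy_zero_zero]
      exact max_eq_left (by nlinarith)
    rw [e1, e2, e3, this _ l1, this _ l2, this _ (by linarith), add_zero]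
  -- An edge of length at least π has zero boundary values. Cutting it at distance 1 from `v` leaves
  -- two edges shorter than π at `v`, and the balance of slopes there contradicts a positive value
  -- at `j`.
  have long : ∀ {i j : ℕ} {h₁ h₂ : ℝ} {r : Multiset (Sym2 ℕ × ℝ)},
      G.edges = (s(i, v), h₁) ::ₘ (s(v, j), h₂) ::ₘ r → (∀ e ∈ r, v ∉ e.1) → 0 < h₂ →
      0 ≤ G.val j → ¬ (G.val i = 0 ∧ G.val v = 0 ∧ G.val j = 0) → π ≤ h₁ → False := by
    intro i j h₁ h₂ r hr hvr l2 yj zero hpi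
    have m1 : (s(i, v), h₁) ∈ G.edges := by rw [hr]; simp
    have m2 : (s(v, j), h₂) ∈ G.edges := by rw [hr]; simp
    have c1 := (hV.edge_ok _ m1 i v rfl).2.2
    have c2 := (hV.edge_ok _ m2 v j rfl).2.2
    obtain ⟨zi, zv⟩ := c1.resolve_left (not_lt.2 hpi)
    have zj : 0 < G.val j := lt_of_le_of_ne yj fun h => zero ⟨zi, zv, h.symm⟩
    have p2 : h₂ < π := c2.resolve_right fun h => zj.ne' h.2
    obtain ⟨V, hVs⟩ := hV.exists_spans
    obtain ⟨w, hw⟩ := Infinite.exists_notMem_finset V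
    have hne : ∀ {u}, u ∈ V → u ≠ w := fun hu h => hw (h ▸ hu)
    have vV : v ∈ V := hVs.mem_edge _ m1 v (Sym2.mem_mk_right _ _)
    have jV : j ∈ V := hVs.mem_edge _ m2 j (Sym2.mem_mk_right _ _)
    have iV : i ∈ V := hVs.mem_edge _ m1 i (Sym2.mem_mk_left _ _)
    set x : E := AffineMap.lineMap (G.pos i) (G.pos v) ((h₁ - 1) / h₁) with hx
    have k1 := (hV.edge_ok _ m1 i v rfl).1
    have hp3 := pi_gt_three
    have d1 : dist (G.pos i) x ≤ h₁ - 1 := by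
      rw [dist_lineMap_left_le (by linarith) (by linarith)]
      exact mul_dist_le (by linarith) (by linarith) k1
    have d2 : dist x (G.pos v) ≤ h₁ - (h₁ - 1) := by
      rw [dist_lineMap_right_le (by linarith) (by linarith)]
      exact mul_dist_le (by linarith) (by linarith) k1
    obtain ⟨v1, v2, -, -, v5⟩ := hV.subdivide hG.simple hVs hw hr (y := 0) (by linarith)
      (by linarith) d1 d2 (Or.inr ⟨zi, zv, rfl⟩)
    have hE' := (v5 (by simp [zi, zv])).trans hE
    rw [sub_sub_cancel] at v1 v2 hE'
    have hmin := edgeEnergy_add_le_of_degree_two hF v1 v2 hE' (i := w) (v := v) (j := j) (h₁ := 1)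
      (h₂ := h₂) (r := (s(i, w), h₁ - 1) ::ₘ r)
      (by
        simp only [Net.subdivide]
        rw [Multiset.cons_swap, Multiset.cons_swap (s(i, w), h₁ - 1)])
      (by
        simp only [Multiset.mem_cons, forall_eq_or_imp, Sym2.mem_iff, not_or]
        exact ⟨⟨(hG.ne_of_mem m1).symm, hne vV⟩, hvr⟩) hb ht one_pos (by linarith) l2 p2
    simp only [Net.subdivide, Function.update_self, Function.update_of_ne (hne vV),
      Function.update_of_ne (hne jV)] at hmin
    have := (critical_of_minimal hmin).2
    rw [zv] at this
    have := div_pos zj (sin_pos_of_length l2 p2)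
    simp only [mul_zero, zero_div, zero_add] at *
    linarith
  rcases lt_or_ge h₁ π with p1 | p1
  swap
  · exact long hr hvr l2 yj zero p1
  rcases lt_or_ge h₂ π with p2 | p2
  swap
  · refine long (i := j) (j := i) (h₁ := h₂) (h₂ := h₁) (r := r) ?_ hvr l1 yi
      (fun h => zero ⟨h.2.2, h.2.1, h.1⟩) p2
    rw [hr, Multiset.cons_swap, Sym2.eq_swap, Sym2.eq_swap (a := i)]
  have q1 := sin_pos_of_length l1 p1
  have q2 := sin_pos_of_length l2 p2
  rcases lt_or_ge (h₁ + h₂) π with p3 | p3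
  · exact hG.not_merge symmCond_properCond hr hvr hb ht (Or.inl p3)
      (cappedEnergy_add_le l1.le l2.le p3 (fun h => absurd h l1.ne') fun h => absurd h l2.ne')
  have hmin := edgeEnergy_add_le_of_degree_two hF hV hG.simple hE hr hvr hb ht l1 p1 l2 p2
  obtain ⟨hA, hB⟩ := critical_of_minimal hmin
  -- Since h₁ + h₂ is between π and 2π, the leading coefficient is nonpositive, hence zero. The
  -- first order condition then makes both neighbouring values vanish, and an edge with zero
  -- boundary values may have any length.
  have hsin : sin (h₁ + h₂) ≤ 0 := by
    have := sin_nonneg_of_nonneg_of_le_pi (x := h₁ + h₂ - π) (by linarith) (by linarith)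
    rw [sin_sub_pi] at this
    linarith
  have hAe : cos h₁ / sin h₁ + cos h₂ / sin h₂ = sin (h₁ + h₂) / (sin h₁ * sin h₂) := by
    rw [sin_add]; field_simp; ring
  have hA0 : cos h₁ / sin h₁ + cos h₂ / sin h₂ = 0 := by
    refine le_antisymm ?_ hA
    rw [hAe]
    exact div_nonpos_of_nonpos_of_nonneg hsin (by positivity)
  rw [hA0, zero_mul] at hB
  have b1 := div_nonneg yi q1.le
  have b2 := div_nonneg yj q2.le
  have zi : G.val i = 0 := ((div_eq_zero_iff).1 (by linarith)).resolve_right q1.ne'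
  have zj : G.val j = 0 := ((div_eq_zero_iff).1 (by linarith)).resolve_right q2.ne'
  refine hG.not_merge symmCond_properCond hr hvr hb ht (Or.inr ⟨zi, zj⟩) ?_
  have h0 : cappedEnergy 1 (h₁ + h₂) 0 0 = 0 := by
    simp only [cappedEnergy, edgeEnergy_zero_zero]
    exact max_eq_left (by linarith)
  rw [zi, zj, h0]
  refine le_trans (le_of_eq ?_) (add_le_add (edgeEnergy_le_cappedEnergy _ _ _ _)
    (edgeEnergy_le_cappedEnergy _ _ _ _))
  have : edgeEnergy h₁ 0 (G.val v) + edgeEnergy h₂ (G.val v) 0 =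
      G.val v ^ 2 * (cos h₁ / sin h₁ + cos h₂ / sin h₂) := by unfold edgeEnergy; ring
  rw [this, hA0, mul_zero]

end Structure

end Net

/-! ### Counting the edges with slack, and straightening them. -/

open Real Filter Topology

namespace Net

variable {k : ℕ} {E : Type} [NormedAddCommGroup E] {D : Fin k → E} {ℓ : ℝ} {G : Net k E ℕ}

/-- The edge is longer than the distance of its ends. -/
def Loose (pos : ℕ → E) (e : Sym2 ℕ × ℝ) : Prop :=
  ∃ i j, e.1 = s(i, j) ∧ dist (pos i) (pos j) < e.2

theorem loose_mk {pos : ℕ → E} {i j : ℕ} {h : ℝ} :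
    Loose pos (s(i, j), h) ↔ dist (pos i) (pos j) < h := by
  refine ⟨?_, fun h => ⟨i, j, rfl, h⟩⟩
  rintro ⟨a, b, hab, hd⟩
  rcases Sym2.eq_iff.1 hab with ⟨rfl, rfl⟩ | ⟨rfl, rfl⟩
  · exact hd
  · rwa [dist_comm]

theorem loose_congr {pos pos' : ℕ → E} {e : Sym2 ℕ × ℝ} (h : ∀ v ∈ e.1, pos' v = pos v) :
    Loose pos' e ↔ Loose pos e := by
  obtain ⟨e, l⟩ := e
  induction e using Sym2.ind with
  | _ i j =>
    simp only [Sym2.mem_iff, forall_eq_or_imp, forall_eq] at h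
    rw [loose_mk, loose_mk, h.1, h.2]

/-- The edge `e` has slack and descends from its end `v`. -/
def Charges (G : Net k E ℕ) (e : Sym2 ℕ × ℝ) (v : ℕ) : Prop :=
  ∃ i, e.1 = s(i, v) ∧ dist (G.pos i) (G.pos v) < e.2 ∧ 0 < G.val v ∧ G.val i ≤ G.val v * cos e.2

section Structure

variable [NormedSpace ℝ E]
  (hF : ∀ G : Net k E ℕ, G.Valid D properCond ℓ → G.Simple → 0 ≤ G.energy ℓ)
  (hG : G.IsMinimal D properCond 1 ℓ 0)

include hF hG

theorem IsMinimal.exists_charges {e : Sym2 ℕ × ℝ} (he : e ∈ G.edges) (hl : Loose G.pos e) :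
    ∃ v, G.Charges e v := by
  obtain ⟨e, h⟩ := e
  induction e using Sym2.ind with
  | _ i j =>
    rw [loose_mk] at hl
    rcases descending_of_slack hF hG.1.toValid hG.simple (hG.total_eq hF) (energy_le_capped hG.1)
      (by rw [hG.1.val_base]; exact one_ne_zero) hG.1.val_nonneg he hl with h | h
    · exact ⟨i, j, Sym2.eq_swap, by rwa [dist_comm], h.1, h.2⟩
    · exact ⟨j, i, rfl, hl, h.1, h.2⟩

/-- By `not_descending_of_slack` no second edge descends from a charged vertex, so the values on all
its other edges rise at first. -/
theorem IsMinimal.lt_of_charges (hD : Function.Injective D) {e : Sym2 ℕ × ℝ} {v j : ℕ} {h : ℝ}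
    {r : Multiset (Sym2 ℕ × ℝ)} (hr : G.edges = e ::ₘ (s(v, j), h) ::ₘ r) (hc : G.Charges e v) :
    G.val v * cos h < G.val j := by
  obtain ⟨i, hi, hd, hv, hle⟩ := hc
  by_contra! hcon
  obtain ⟨e, h'⟩ := e
  simp only at hi hd hle
  subst hi
  exact not_descending_of_slack hF hG.1.toValid hG.simple (hG.total_eq hF) (energy_le_capped hG.1)
    hr hd hv (hG.length_pos hD (i := v) (j := j) (by rw [hr]; simp)) hle hcon

theorem IsMinimal.charges_unique (hD : Function.Injective D) {e e' : Sym2 ℕ × ℝ} {v : ℕ}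
    (he : e ∈ G.edges) (he' : e' ∈ G.edges) (hc : G.Charges e v) (hc' : G.Charges e' v) :
    e = e' := by
  by_contra hne
  obtain ⟨r, hr⟩ := Multiset.exists_cons_of_mem he
  have : e' ∈ r := by
    rw [hr] at he'
    exact (Multiset.mem_cons.1 he').resolve_left (Ne.symm hne)
  obtain ⟨r', hr'⟩ := Multiset.exists_cons_of_mem this
  obtain ⟨j, hj, -, -, hle⟩ := hc'
  have : e' = (s(v, j), e'.2) := Prod.ext (hj.trans Sym2.eq_swap) rfl
  have := hG.lt_of_charges hF hD (e := e) (v := v) (j := j) (h := e'.2) (r := r')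
    (by rw [hr, hr', ← this]) hc
  linarith

/-- At degree three the other two edges would ascend. They lead to different branches, as all edges
are bridges, and `not_ascending_of_slack` applies with their slopes in the right order. -/
theorem IsMinimal.four_le_card_incident (hD : Function.Injective D) {e : Sym2 ℕ × ℝ} {v : ℕ}
    (he : e ∈ G.edges) (hc : G.Charges e v) (hb : v ≠ G.base) : 4 ≤ (incident G.edges v).card := by
  have hc' := hc
  obtain ⟨i, hi, hd, hv, hle⟩ := hc
  obtain ⟨e, h⟩ := e
  simp only at hi hd hle
  subst hi
  have h3 := hG.three_le_card_incident hF hD (v := v)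
    (hG.1.conn_edge _ he v (Sym2.mem_mk_right _ _)) hb
    fun a h => hv.ne' (h ▸ hG.1.val_term a)
  by_contra hlt
  obtain ⟨a, b, h₁, h₂, r, hr, hvr⟩ := exists_of_card_incident_eq_three he
    (by omega : (incident G.edges v).card = 3)
  have hr2 : G.edges = (s(i, v), h) ::ₘ (s(v, b), h₂) ::ₘ (s(v, a), h₁) ::ₘ r := by
    rw [hr]; congr 1; exact Multiset.cons_swap _ _ _
  have hra : G.edges = (s(v, a), h₁) ::ₘ (s(i, v), h) ::ₘ (s(v, b), h₂) ::ₘ r := by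
    rw [hr, Multiset.cons_swap]
  have hrb : G.edges = (s(v, b), h₂) ::ₘ (s(i, v), h) ::ₘ (s(v, a), h₁) ::ₘ r := by
    rw [hr2, Multiset.cons_swap]
  have m1 : (s(v, a), h₁) ∈ G.edges := by rw [hr]; simp
  have m2 : (s(v, b), h₂) ∈ G.edges := by rw [hr]; simp
  have l1 := hG.length_pos hD m1
  have l2 := hG.length_pos hD m2
  have p1 : h₁ < π := (hG.1.edge_ok _ m1 v a rfl).2.2.resolve_right fun h => hv.ne' h.1
  have p2 : h₂ < π := (hG.1.edge_ok _ m2 v b rfl).2.2.resolve_right fun h => hv.ne' h.1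
  have s1 := div_pos (sub_pos.2 (hG.lt_of_charges hF hD hr hc')) (sin_pos_of_length l1 p1)
  have s2 := div_pos (sub_pos.2 (hG.lt_of_charges hF hD hr2 hc')) (sin_pos_of_length l2 p2)
  have hab : ¬ Conn r a b := fun hcon => hG.not_conn hra
    (Conn.trans (Conn.of_mem (h := h₂) (by simp)) (hcon.mono fun e he => by simp [he]).symm)
  have hai : ¬ Conn r a i := fun hcon => hG.not_conn hra
    (Conn.trans (Conn.of_mem (h := h) (by simp [Sym2.eq_swap]))
      (hcon.mono fun e he => by simp [he]).symm)
  have hbi : ¬ Conn r b i := fun hcon => hG.not_conn hrb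
    (Conn.trans (Conn.of_mem (h := h) (by simp [Sym2.eq_swap]))
      (hcon.mono fun e he => by simp [he]).symm)
  rcases le_total ((G.val a - G.val v * cos h₁) / sin h₁) ((G.val b - G.val v * cos h₂) / sin h₂)
    with hs | hs
  · exact not_ascending_of_slack hF hG.1.toValid hG.simple (hG.total_eq hF)
      (energy_le_capped hG.1) hr hvr hv l1 l2 hab hai hbi hd s1 hs
  · exact not_ascending_of_slack hF hG.1.toValid hG.simple (hG.total_eq hF)
      (energy_le_capped hG.1) hr2 hvr hv l2 l1 (fun h => hab h.symm) hbi hai hd s2 hs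

open Classical in
/-- The number of vertices and edges with slack of a minimal net. -/
theorem IsMinimal.card_add_card_loose_le (hD : Function.Injective D) (a₀ : Fin k)
    (hleaf : (incident G.edges G.base).card = 1 → ∀ i h, (s(i, G.base), h) ∈ G.edges →
        dist (G.pos i) (G.pos G.base) = h) {V : Finset ℕ} (hV : G.Spans V) :
    V.card + (G.edges.filter (Loose G.pos)).card ≤ 2 * k := by
  set L := G.edges.filter (Loose G.pos) with hL
  have hex : ∀ e ∈ L, ∃ v, G.Charges e v := fun e he =>
    hG.exists_charges hF (Multiset.mem_filter.1 he).1 (Multiset.mem_filter.1 he).2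
  choose! f hf using hex
  set Q := L.toFinset.image f with hQ
  set T := insert G.base (Finset.univ.image G.term) with hT
  have hLn : L.Nodup := (Multiset.Nodup.of_map _ hG.nodup).filter _
  have hQL : Q.card = L.card := by
    rw [hQ, Finset.card_image_of_injOn, Multiset.toFinset_card_of_nodup hLn]
    intro e he e' he' hee
    have h1 := Multiset.mem_toFinset.1 he
    have h2 := Multiset.mem_toFinset.1 he'
    exact hG.charges_unique hF hD (Multiset.mem_filter.1 h1).1 (Multiset.mem_filter.1 h2).1
      (hf e h1) (hee ▸ hf e' h2)
  have hQV : Q ⊆ V := by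
    intro v hv
    obtain ⟨e, he, rfl⟩ := Finset.mem_image.1 hv
    have h1 := Multiset.mem_toFinset.1 he
    obtain ⟨i, hi, -⟩ := hf e h1
    exact hV.mem_edge e (Multiset.mem_filter.1 h1).1 _ (by rw [hi]; exact Sym2.mem_mk_right _ _)
  have hTc : T.card ≤ k + 1 := by
    refine (Finset.card_insert_le _ _).trans ?_
    have := Finset.card_image_le (s := Finset.univ) (f := G.term)
    simp only [Finset.card_univ, Fintype.card_fin] at this
    omega
  have hTV : T ⊆ V := by
    intro v hv
    rcases Finset.mem_insert.1 hv with rfl | hv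
    · exact hV.mem_base
    · obtain ⟨a, -, rfl⟩ := Finset.mem_image.1 hv
      exact hV.mem_term a
  -- A free vertex has degree at least three, and four if charged. Terminals and the base receive a
  -- bonus of 2. Terminals have the value zero and are never charged, and a charged base is not a
  -- leaf, as the edge at a leaf base has no slack.
  have hdeg : ∀ v ∈ V, 3 + (if v ∈ Q then 1 else 0) ≤
      (incident G.edges v).card + 2 * (if v ∈ T then 1 else 0) := by
    intro v hv
    have hch : v ∈ Q → ∃ e ∈ G.edges, G.Charges e v := fun hvQ => by
      obtain ⟨e, he, rfl⟩ := Finset.mem_image.1 hvQ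
      have h1 := Multiset.mem_toFinset.1 he
      exact ⟨e, (Multiset.mem_filter.1 h1).1, hf e h1⟩
    have h1 : 1 ≤ (incident G.edges v).card := by
      rw [Nat.one_le_iff_ne_zero, Ne, Multiset.card_eq_zero]
      by_cases hvb : v = G.base
      · rw [hvb]
        exact (hV.conn _ (hV.mem_term a₀)).symm.incident_ne_zero (hG.base_ne_term a₀).symm
      · exact (hV.conn v hv).incident_ne_zero (Ne.symm hvb)
    by_cases hvb : v = G.base
    · have hT' : v ∈ T := by simp [hT, hvb]
      by_cases hvQ : v ∈ Q
      · obtain ⟨e, he, i, hi, hd, -⟩ := hch hvQ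
        have : (incident G.edges v).card ≠ 1 := fun h => by
          subst hvb
          refine hd.ne (hleaf h i e.2 ?_)
          rw [← hi]; exact he
        simp only [hvQ, hT', if_true]; omega
      · simp only [hvQ, hT', if_true, if_false]; omega
    · by_cases hvt : ∃ a, v = G.term a
      · obtain ⟨a, ha⟩ := hvt
        have hT' : v ∈ T := by simp [hT, ha]
        have hvQ : v ∉ Q := fun h => by
          obtain ⟨e, he, i, -, -, hp, -⟩ := hch h
          rw [ha, hG.1.val_term] at hp
          exact lt_irrefl _ hp
        simp only [hvQ, hT', if_true, if_false]; omega
      · have hvt' : ∀ a, v ≠ G.term a := fun a h => hvt ⟨a, h⟩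
        have hT' : v ∉ T := by
          simp only [hT, Finset.mem_insert, Finset.mem_image, Finset.mem_univ, true_and, not_or]
          exact ⟨hvb, fun ⟨a, h⟩ => hvt' a h.symm⟩
        have h3 := hG.three_le_card_incident hF hD (hV.conn v hv) hvb hvt'
        by_cases hvQ : v ∈ Q
        · obtain ⟨e, he, hc⟩ := hch hvQ
          have := hG.four_le_card_incident hF hD he hc hvb
          simp only [hvQ, hT', if_true, if_false]; omega
        · simp only [hvQ, hT', if_false]; omega
  have hsum := Finset.sum_le_sum hdeg
  rw [Finset.sum_add_distrib, Finset.sum_add_distrib, ← Finset.mul_sum,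
    sum_incident_card V hV.mem_edge (fun e he => hG.not_isDiag he)] at hsum
  simp only [Finset.sum_const, smul_eq_mul, Finset.sum_ite_mem, mul_one] at hsum
  rw [Finset.inter_eq_right.2 hQV, Finset.inter_eq_right.2 hTV] at hsum
  -- In total 3|V| + |L| ≤ 2(|V| - 1) + 2(k + 1).
  have := hG.card_edges_add_one hV
  omega

end Structure

/-- A net whose edges are as long as the distances of their ends. -/
def Tight (G : Net k E ℕ) : Prop := ∀ e ∈ G.edges, ¬ Loose G.pos e

variable [NormedSpace ℝ E] [Nontrivial E]

omit [NormedSpace ℝ E] [Nontrivial E] in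
theorem exists_norm_eq_one_and_smul [NormedSpace ℝ E] [Nontrivial E] (p q : E) :
    ∃ u : E, ‖u‖ = 1 ∧ q - p = dist p q • u := by
  rcases eq_or_ne p q with rfl | h
  · obtain ⟨u, hu⟩ := _root_.exists_norm_eq E zero_le_one
    exact ⟨u, hu, by simp⟩
  · have : dist p q ≠ 0 := dist_ne_zero.2 h
    refine ⟨(dist p q)⁻¹ • (q - p), ?_, by rw [smul_inv_smul₀ this]⟩
    rw [norm_smul, norm_inv, Real.norm_eq_abs, abs_of_nonneg dist_nonneg, ← dist_eq_norm, dist_comm q,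
      inv_mul_cancel₀ this]

open Classical in
/-- Breaking the edges with slack into two straight edges. -/
theorem exists_tight (n : ℕ) (hG : G.Valid D properCond ℓ) (hS : G.Simple) {V : Finset ℕ}
    (hV : G.Spans V) (hn : (G.edges.filter (Loose G.pos)).card = n) :
    ∃ (G' : Net k E ℕ) (V' : Finset ℕ), G'.Valid D properCond ℓ ∧ G'.Simple ∧ G'.Spans V' ∧
      G'.Tight ∧ G'.total = G.total ∧ G'.energy ℓ ≤ G.energy ℓ ∧ V'.card = V.card + n ∧
      G'.edges.card = G.edges.card + n ∧ G'.val G'.base = G.val G.base := by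
  induction n generalizing G V with
  | zero =>
    refine ⟨G, V, hG, hS, hV, fun e he hl => ?_, rfl, le_rfl, rfl, rfl, rfl⟩
    rw [Multiset.card_eq_zero, Multiset.filter_eq_nil] at hn
    exact hn e he hl
  | succ n ih =>
    obtain ⟨e, he⟩ := Multiset.exists_mem_of_ne_zero
      (s := G.edges.filter (Loose G.pos)) (fun h => by rw [h] at hn; simp at hn)
    obtain ⟨he, hl⟩ := Multiset.mem_filter.1 he
    obtain ⟨r, hr⟩ := Multiset.exists_cons_of_mem he
    obtain ⟨e, h⟩ := e
    induction e using Sym2.ind with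
    | _ i j =>
      have hl' := hl
      rw [loose_mk] at hl'
      set d := dist (G.pos i) (G.pos j) with hd
      have d0 : 0 ≤ d := dist_nonneg
      have h0 : 0 < h := d0.trans_lt hl'
      obtain ⟨w, hw⟩ := Infinite.exists_notMem_finset V
      have hne : ∀ {u}, u ∈ V → u ≠ w := fun hu h => hw (h ▸ hu)
      have iV : i ∈ V := hV.mem_edge _ he i (Sym2.mem_mk_left _ _)
      have jV : j ∈ V := hV.mem_edge _ he j (Sym2.mem_mk_right _ _)
      have hwr : ∀ e ∈ r, w ∉ e.1 := fun e he => hV.notMem_of_notMem hw (by rw [hr]; simp [he])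
      obtain ⟨u, hu, hpq⟩ := exists_norm_eq_one_and_smul (G.pos i) (G.pos j)
      -- The line from `i` overshoots `j` by half of the slack and returns. This works in dimension
      -- one, and when both ends have the same position.
      set x := G.pos j + ((h - d) / 2) • u with hx
      have di : dist (G.pos i) x = (h + d) / 2 := by
        have e1 : x - G.pos i = ((h + d) / 2) • u := by
          have : x - G.pos i = (G.pos j - G.pos i) + ((h - d) / 2) • u := by rw [hx]; abel
          rw [this, hpq, ← add_smul]; congr 1; ring
        rw [dist_comm, dist_eq_norm, e1, norm_smul, hu, Real.norm_eq_abs, abs_of_nonneg (by linarith),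
          mul_one]
      have dj : dist x (G.pos j) = h - (h + d) / 2 := by
        have e1 : x - G.pos j = ((h - d) / 2) • u := by rw [hx]; abel
        rw [dist_eq_norm, e1, norm_smul, hu, Real.norm_eq_abs, abs_of_nonneg (by linarith)]
        ring
      -- The value of the optimal sinusoid at the cut leaves the energy unchanged. If the boundary
      -- values are zero, zero is taken.
      obtain ⟨y, hy, hye⟩ : ∃ y, (h < π ∨ (G.val i = 0 ∧ G.val j = 0 ∧ y = 0)) ∧
          edgeEnergy ((h + d) / 2) (G.val i) y + edgeEnergy (h - (h + d) / 2) y (G.val j) ≤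
            edgeEnergy h (G.val i) (G.val j) := by
        rcases (hG.edge_ok _ he i j rfl).2.2 with hp | ⟨zi, zj⟩
        · have := edgeEnergy_split (t := (h + d) / 2) (G.val i)
            ((G.val j - G.val i * cos h) / sin h) (by linarith) (by linarith) hp
          rw [exists_sinusoid h0 hp] at this
          exact ⟨_, Or.inl hp, this.symm.le⟩
        · exact ⟨0, Or.inr ⟨zi, zj, rfl⟩, by simp [zi, zj]⟩
      obtain ⟨v1, v2, v3, v4, v5⟩ := hG.subdivide hS hV hw hr (x := x) (y := y)
        (t := (h + d) / 2) (by linarith) (by linarith) di.le dj.le hy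
      have hcount : (((s(i, w), (h + d) / 2) ::ₘ (s(w, j), h - (h + d) / 2) ::ₘ r).filter
          (Loose (Function.update G.pos w x))).card = n := by
        rw [Multiset.filter_cons_of_neg, Multiset.filter_cons_of_neg]
        · rw [hr, Multiset.filter_cons_of_pos _ hl, Multiset.card_cons] at hn
          rw [← Nat.succ.inj hn]
          congr 1
          exact Multiset.filter_congr fun e he => loose_congr fun v hv =>
            Function.update_of_ne (fun h => hwr e he (by rwa [← h])) _ _
        · rw [loose_mk, Function.update_self, Function.update_of_ne (hne jV), dj]
          exact lt_irrefl _
        · rw [loose_mk, Function.update_self, Function.update_of_ne (hne iV), di]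
          exact lt_irrefl _
      obtain ⟨G', V', w1, w2, w3, w4, w5, w6, w7, w8, w9⟩ := ih v1 v2 v3 hcount
      refine ⟨G', V', w1, w2, w3, w4, w5.trans v4, w6.trans (v5 hye), ?_, ?_, ?_⟩
      · rw [w7, Finset.card_insert_of_notMem hw]; omega
      · rw [w8, hr]; simp only [Net.subdivide, Multiset.card_cons]; omega
      · rw [w9]; exact Function.update_of_ne (hne hV.mem_base) _ _

omit [NormedSpace ℝ E] [Nontrivial E] in
/-- Attaching edges at the base vertex until the total length is `ℓ`. -/
theorem exists_total_eq (n : ℕ) (hG : G.Valid D properCond ℓ) (hS : G.Simple) {V : Finset ℕ}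
    (hV : G.Spans V) (hn : ℓ - G.total ≤ n) :
    ∃ (G' : Net k E ℕ) (V' : Finset ℕ), G'.Valid D properCond ℓ ∧ G'.Simple ∧ G'.Spans V' ∧
      G'.total = ℓ ∧ G'.energy ℓ ≤ G.energy ℓ := by
  induction n generalizing G V with
  | zero =>
    exact ⟨G, V, hG, hS, hV, le_antisymm hG.total_le (by simpa using hn), le_rfl⟩
  | succ n ih =>
    rcases hG.total_le.eq_or_lt with h | hlt
    · exact ⟨G, V, hG, hS, hV, h, le_rfl⟩
    obtain ⟨w, hw⟩ := Infinite.exists_notMem_finset V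
    have hβ : 0 < min (ℓ - G.total) 1 := lt_min (by linarith) one_pos
    obtain ⟨h1, h2, h3, h4, h5, -⟩ := hG.pendant hS hV hw (x := G.pos G.base) hβ
      (by linarith [min_le_left (ℓ - G.total) 1])
      ((min_le_right _ _).trans_lt (by linarith [pi_gt_three])) (by simpa using hβ.le)
    obtain ⟨G', V', w1, w2, w3, w4, w5⟩ := ih h1 h2 h3 (by
      rw [h4]
      push_cast at hn
      rcases min_cases (ℓ - G.total) 1 with ⟨h, -⟩ | ⟨h, -⟩ <;> rw [h]
      · have : (0 : ℝ) ≤ n := Nat.cast_nonneg n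
        linarith
      · linarith)
    exact ⟨G', V', w1, w2, w3, w4, w5.trans h5⟩

theorem exists_tight_total_eq (hG : G.Valid D properCond ℓ) (hS : G.Simple) :
    ∃ (G' : Net k E ℕ) (V' : Finset ℕ), G'.Valid D properCond ℓ ∧ G'.Simple ∧ G'.Spans V' ∧
      G'.Tight ∧ G'.total = ℓ ∧ G'.energy ℓ ≤ G.energy ℓ := by
  obtain ⟨V, hV⟩ := hG.exists_spans
  obtain ⟨n, hn⟩ := exists_nat_ge (ℓ - G.total)
  obtain ⟨G₁, V₁, a1, a2, a3, a4, a5⟩ := exists_total_eq n hG hS hV hn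
  obtain ⟨G₂, V₂, b1, b2, b3, b4, b5, b6, -⟩ := exists_tight _ a1 a2 a3 rfl
  exact ⟨G₂, V₂, b1, b2, b3, b4, b5.trans a4, b6.trans a5⟩

/-- A minimal net gives a tight tree with at most `2k` vertices. -/
theorem exists_tight_tree (hF : ∀ G : Net k E ℕ, G.Valid D properCond ℓ → G.Simple → 0 ≤ G.energy ℓ)
    (hD : Function.Injective D) (a₀ : Fin k) (hG : G.Good D properCond 1 ℓ 0) :
    ∃ (G' : Net k E ℕ) (V' : Finset ℕ), G'.Valid D properCond ℓ ∧ G'.Simple ∧ G'.Spans V' ∧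
      G'.Tight ∧ G'.total = ℓ ∧ G'.energy ℓ ≤ 0 ∧ V'.card ≤ 2 * k ∧
      G'.edges.card + 1 = V'.card ∧ G'.val G'.base = 1 := by
  obtain ⟨G₁, h1⟩ := exists_isMinimal hG
  obtain ⟨G₂, h2, hleaf⟩ := h1.exists_tight_leaf
  obtain ⟨V, hV⟩ := h2.1.toValid.exists_spans
  have hc := h2.card_add_card_loose_le hF hD a₀ hleaf hV
  obtain ⟨G₃, V₃, b1, b2, b3, b4, b5, b6, b7, b8, b9⟩ := exists_tight _ h2.1.toValid h2.simple hV rfl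
  refine ⟨G₃, V₃, b1, b2, b3, b4, b5.trans (h2.total_eq hF), b6.trans (energy_le_capped h2.1), ?_,
    ?_, b9.trans h2.1.val_base⟩
  · rw [b7]; exact hc
  · have := h2.card_edges_add_one hV
    omega

end Net

/-! ### From tight nets to metric graphs. -/

open Real Filter Topology

/-- A straight segment is a curve parametrized by arc length. -/
theorem hasUnitSpeedOn_lineMap {E : Type} [NormedAddCommGroup E] [NormedSpace ℝ E] {p q : E} :
    Set.InjOn (fun t : ℝ => AffineMap.lineMap p q (t / dist p q)) (Set.Icc 0 (dist p q)) ∧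
    HasUnitSpeedOn (fun t : ℝ => (AffineMap.lineMap p q (t / dist p q) : E))
      (Set.Icc 0 (dist p q)) := by
  rcases eq_or_ne p q with rfl | h
  · have hs : (Set.Icc 0 (dist p p)).Subsingleton := by
      rw [dist_self, Set.Icc_self]; exact Set.subsingleton_singleton
    exact ⟨hs.injOn _, hasConstantSpeedOnWith_of_subsingleton _ hs 1⟩
  · have hd : 0 < dist p q := dist_pos.2 h
    have hiso : ∀ x y : ℝ, dist (AffineMap.lineMap p q (x / dist p q) : E)
        (AffineMap.lineMap p q (y / dist p q)) = dist x y := fun x y => by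
      rw [dist_lineMap_lineMap, Real.dist_eq, Real.dist_eq, ← sub_div, abs_div, abs_of_pos hd,
        div_mul_cancel₀ _ hd.ne']
    refine ⟨fun x _ y _ hxy => ?_, fun x hx y hy => ?_⟩
    · exact dist_eq_zero.1 ((hiso x y).symm.trans (dist_eq_zero.2 hxy))
    · have := (monotone_id (α := ℝ)).monotoneOn (Set.Icc 0 (dist p q)) |>.eVariationOn_eq hx hy
      rw [NNReal.coe_one, one_mul, ← id_eq y, ← id_eq x, ← this]
      unfold eVariationOn
      refine iSup_congr fun u => Finset.sum_congr rfl fun i _ => ?_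
      rw [edist_dist, edist_dist, hiso]
      rfl

namespace MetricGraph

open Classical in
theorem edgeSum_eq_sum_edges {n : ℕ} (g : SimpleGraph (Fin n)) (f : Sym2 (Fin n) → ℝ) :
    ∑ p ∈ Finset.univ.filter (fun p : Fin n × Fin n => p.1 < p.2 ∧ g.Adj p.1 p.2), f s(p.1, p.2) =
      ∑ e ∈ g.edgeFinset, f e := by
  refine Finset.sum_nbij (fun p => s(p.1, p.2)) ?_ ?_ ?_ fun _ _ => rfl
  · intro p hp
    simpa using (Finset.mem_filter.1 hp).2.2
  · intro p hp q hq hpq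
    have hp := (Finset.mem_filter.1 hp).2.1
    have hq := (Finset.mem_filter.1 hq).2.1
    rcases Sym2.eq_iff.1 hpq with ⟨h1, h2⟩ | ⟨h1, h2⟩
    · exact Prod.ext h1 h2
    · rw [h1, h2] at hp
      exact absurd hp (not_lt.2 hq.le)
  · intro e he
    induction e using Sym2.ind with
    | _ i j =>
      have hadj : g.Adj i j := by simpa using he
      rcases lt_trichotomy i j with h | h | h
      · exact ⟨(i, j), by simp [h, hadj], rfl⟩
      · exact absurd h hadj.ne
      · exact ⟨(j, i), by simp [h, hadj.symm], Sym2.eq_swap⟩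

variable {Γ : MetricGraph} {W : Set (Fin Γ.numV)}

theorem edgeSum_const_mul (c : ℝ) (F : Fin Γ.numV → Fin Γ.numV → ℝ) :
    Γ.edgeSum (fun i j => c * F i j) = c * Γ.edgeSum F := by
  unfold edgeSum; rw [Finset.mul_sum]

theorem edgeSum_sub (F F' : Fin Γ.numV → Fin Γ.numV → ℝ) :
    Γ.edgeSum (fun i j => F i j - F' i j) = Γ.edgeSum F - Γ.edgeSum F' := by
  unfold edgeSum; rw [Finset.sum_sub_distrib]

open Classical in
theorem edgeSum_congr {F F' : Fin Γ.numV → Fin Γ.numV → ℝ}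
    (h : ∀ i j, Γ.graph.Adj i j → F i j = F' i j) : Γ.edgeSum F = Γ.edgeSum F' :=
  Finset.sum_congr rfl fun _ hp => h _ _ (Finset.mem_filter.1 hp).2.2

open Classical in
theorem edgeSum_nonneg {F : Fin Γ.numV → Fin Γ.numV → ℝ}
    (h : ∀ i j, Γ.graph.Adj i j → 0 ≤ F i j) : 0 ≤ Γ.edgeSum F :=
  Finset.sum_nonneg fun _ hp => h _ _ (Finset.mem_filter.1 hp).2.2

theorem sqIntegral_nonneg (u : Γ.Fn ℝ) : 0 ≤ Γ.sqIntegral u :=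
  edgeSum_nonneg fun i j h =>
    intervalIntegral.integral_nonneg (Γ.len_nonneg i j h) fun _ _ => sq_nonneg _

theorem gradSqIntegral_nonneg (u : Γ.Fn ℝ) : 0 ≤ Γ.gradSqIntegral u :=
  edgeSum_nonneg fun i j h =>
    intervalIntegral.integral_nonneg (Γ.len_nonneg i j h) fun _ _ => sq_nonneg _

/-- The multiples of a function on a metric graph. -/
def Fn.smul (c : ℝ) (u : Γ.Fn ℝ) : Γ.Fn ℝ where
  vert i := c * u.vert i
  edge i j x := c * u.edge i j x
  edge_zero i j h := by rw [u.edge_zero i j h]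
  edge_symm i j h x hx := by rw [u.edge_symm i j h x hx]

theorem exists_mem_rayleighValues {u : Γ.Fn ℝ} (hu : Γ.IsH10 W u) (hs : 0 < Γ.sqIntegral u) :
    Γ.gradSqIntegral u / Γ.sqIntegral u ∈ Γ.rayleighValues W := by
  set c := (√(Γ.sqIntegral u))⁻¹ with hc
  have hc2 : c ^ 2 = (Γ.sqIntegral u)⁻¹ := by rw [hc, inv_pow, sq_sqrt hs.le]
  have hder : ∀ i j, deriv ((u.smul c).edge i j) = fun x => c * deriv (u.edge i j) x := by
    intro i j
    funext x
    exact deriv_const_mul_field c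
  refine ⟨u.smul c, ⟨fun i j h => ⟨(hu.1 i j h).1.const_mul c, ?_⟩, fun i hi => ?_⟩, ?_, ?_⟩
  · rw [hder]; exact (hu.1 i j h).2.const_mul c
  · simp [Fn.smul, hu.2 i hi]
  · have : Γ.sqIntegral (u.smul c) = c ^ 2 * Γ.sqIntegral u := by
      unfold sqIntegral
      rw [← edgeSum_const_mul]
      refine edgeSum_congr fun i j _ => ?_
      rw [← intervalIntegral.integral_const_mul]
      simp only [Fn.smul, mul_pow]
    rw [this, hc2, inv_mul_cancel₀ hs.ne']
  · have : Γ.gradSqIntegral (u.smul c) = c ^ 2 * Γ.gradSqIntegral u := by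
      unfold gradSqIntegral
      rw [← edgeSum_const_mul]
      refine edgeSum_congr fun i j _ => ?_
      rw [← intervalIntegral.integral_const_mul, hder]
      simp only [mul_pow]
    rw [this, hc2, div_eq_inv_mul]

end MetricGraph

theorem isH1_of_contDiff {f : ℝ → ℝ} (hf : ContDiff ℝ 1 f) (L : ℝ) : MetricGraph.IsH1 f L := by
  refine ⟨hf.contDiffOn.absolutelyContinuousOnInterval, ?_⟩
  have hc : Continuous (deriv f) := hf.continuous_deriv le_rfl
  obtain ⟨C, hC⟩ := isCompact_Icc.exists_bound_of_continuousOn (s := Set.Icc 0 L) hc.continuousOn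
  exact MemLp.of_bound hc.aestronglyMeasurable C
    ((ae_restrict_iff' measurableSet_Icc).2 (ae_of_all _ hC))

theorem hasDerivAt_sinusoid_mul (x s ω t : ℝ) :
    HasDerivAt (fun t => sinusoid x s (ω * t)) (ω * sinusoid s (-x) (ω * t)) t := by
  have := (hasDerivAt_sinusoid x s (ω * t)).comp t ((hasDerivAt_id t).const_mul ω)
  simpa [mul_comm, Function.comp_def] using this

theorem contDiff_sinusoid_mul (x s ω : ℝ) : ContDiff ℝ 1 fun t => sinusoid x s (ω * t) := by
  unfold sinusoid; fun_prop

/-- The Dirichlet energy minus `ω²` times the `L²` norm, for the extremal function on an edge. -/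
theorem integral_sinusoid {ω L x y : ℝ} (hω : 0 < ω) (hL : 0 ≤ L)
    (hp : ω * L < π ∨ (x = 0 ∧ y = 0)) :
    (∫ t in (0 : ℝ)..L, (deriv (fun t => sinusoid x ((y - x * cos (ω * L)) / sin (ω * L)) (ω * t)) t) ^ 2) -
      ω ^ 2 * ∫ t in (0 : ℝ)..L, (sinusoid x ((y - x * cos (ω * L)) / sin (ω * L)) (ω * t)) ^ 2 =
    ω * edgeEnergy (ω * L) x y := by
  rcases hL.eq_or_lt with rfl | hL
  · simp
  set s := (y - x * cos (ω * L)) / sin (ω * L) with hs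
  have hd : deriv (fun t => sinusoid x s (ω * t)) = fun t => ω * sinusoid s (-x) (ω * t) := by
    funext t; exact (hasDerivAt_sinusoid_mul x s ω t).deriv
  have c1 : Continuous fun t => sinusoid x s (ω * t) := (contDiff_sinusoid_mul x s ω).continuous
  have c2 : Continuous fun t => sinusoid s (-x) (ω * t) := (contDiff_sinusoid_mul s (-x) ω).continuous
  have key : (∫ t in (0 : ℝ)..L, (ω * sinusoid s (-x) (ω * t)) ^ 2) -
      ω ^ 2 * ∫ t in (0 : ℝ)..L, (sinusoid x s (ω * t)) ^ 2 =
      ω * (sinusoid x s (ω * L) * sinusoid s (-x) (ω * L)) - ω * (x * s) := by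
    rw [← intervalIntegral.integral_const_mul, ← intervalIntegral.integral_sub
      (by apply Continuous.intervalIntegrable; fun_prop) (by apply Continuous.intervalIntegrable; fun_prop)]
    have := intervalIntegral.integral_eq_sub_of_hasDerivAt (a := 0) (b := L)
      (f := fun t => ω * (sinusoid x s (ω * t) * sinusoid s (-x) (ω * t)))
      (f' := fun t => (ω * sinusoid s (-x) (ω * t)) ^ 2 - ω ^ 2 * sinusoid x s (ω * t) ^ 2)
      (fun t _ => by
        have := ((hasDerivAt_sinusoid_mul x s ω t).mul (hasDerivAt_sinusoid_mul s (-x) ω t)).const_mul ω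
        refine HasDerivAt.congr_deriv this ?_
        have : sinusoid (-x) (-s) (ω * t) = - sinusoid x s (ω * t) := by unfold sinusoid; ring
        rw [this]; ring)
      (by apply Continuous.intervalIntegrable; fun_prop)
    rw [this]
    simp
  rw [hd, key]
  rcases hp with hp | ⟨rfl, rfl⟩
  · have h0 : 0 < ω * L := by positivity
    have e := edgeEnergy_sinusoid (a := 0) (b := ω * L) x s (by linarith) (by linarith)
    simp only [sub_zero, sinusoid_zero] at e
    rw [hs, exists_sinusoid h0 hp x y, ← hs] at e
    rw [hs, exists_sinusoid h0 hp x y, ← hs, e]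
    ring
  · have : s = 0 := by simp [hs]
    simp [this, sinusoid]

/-- On both sides stands the sinusoid with the value `y` at 0 and `x` at `h`, which is unique for h
< π. It makes the function on an edge independent of the orientation. -/
theorem sinusoid_reverse {h x y t : ℝ} (h0 : 0 < h) (hp : h < π ∨ (x = 0 ∧ y = 0)) :
    sinusoid y ((x - y * cos h) / sin h) t = sinusoid x ((y - x * cos h) / sin h) (h - t) := by
  rcases hp with hp | ⟨rfl, rfl⟩
  · have h1 := (sin_pos_of_length h0 hp).ne'
    unfold sinusoid
    rw [cos_sub, sin_sub]
    field_simp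
    have : sin h ^ 2 = 1 - cos h ^ 2 := by linarith [sin_sq_add_cos_sq h]
    ring_nf
    rw [this]; ring
  · simp [sinusoid]

namespace MetricGraph

variable {n d : ℕ}

/-- The metric graph with straight edges between given points. -/
noncomputable def straight (g : SimpleGraph (Fin n)) (p : Fin n → EuclideanSpace ℝ (Fin d)) :
    MetricGraph where
  numV := n
  graph := g
  len i j := dist (p i) (p j)
  len_symm _ _ := dist_comm _ _
  len_nonneg _ _ _ := dist_nonneg

/-- The straight immersion. -/
noncomputable def straightImmersion (g : SimpleGraph (Fin n))
    (p : Fin n → EuclideanSpace ℝ (Fin d)) : (straight g p).Fn (EuclideanSpace ℝ (Fin d)) where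
  vert i := p i
  edge i j t := AffineMap.lineMap (p i) (p j) (t / dist (p i) (p j))
  edge_zero _ _ _ := by simp
  edge_symm i j _ x hx := by
    change _ = AffineMap.lineMap (p i) (p j) ((dist (p i) (p j) - x) / dist (p i) (p j))
    rw [dist_comm (p j)]
    rcases eq_or_ne (p i) (p j) with h | h
    · rw [h]; simp
    · rw [sub_div, div_self (dist_ne_zero.2 h), AffineMap.lineMap_apply_one_sub]

theorem isImmersion_straight (g : SimpleGraph (Fin n)) (p : Fin n → EuclideanSpace ℝ (Fin d)) :
    (straight g p).IsImmersion (straightImmersion g p) :=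
  fun _ _ _ => hasUnitSpeedOn_lineMap

/-- The function on a straight metric graph which is a sinusoid on every edge. -/
noncomputable def sinusoidFn (g : SimpleGraph (Fin n)) (p : Fin n → EuclideanSpace ℝ (Fin d))
    {ω : ℝ} (hω : 0 < ω) (y : Fin n → ℝ) (hy0 : ∀ i j, g.Adj i j → dist (p i) (p j) = 0 → y i = y j)
    (hy : ∀ i j, g.Adj i j → properCond (ω * dist (p i) (p j)) (y i) (y j)) :
    (straight g p).Fn ℝ where
  vert := y
  edge i j t := sinusoid (y i)
    ((y j - y i * cos (ω * dist (p i) (p j))) / sin (ω * dist (p i) (p j))) (ω * t)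
  edge_zero _ _ _ := by simp
  edge_symm i j hij x hx := by
    change x ∈ Set.Icc 0 (dist (p i) (p j)) at hx
    change _ = sinusoid (y i) ((y j - y i * cos (ω * dist (p i) (p j))) /
      sin (ω * dist (p i) (p j))) (ω * (dist (p i) (p j) - x))
    simp only [dist_comm (p j)]
    rcases (dist_nonneg (x := p i) (y := p j)).eq_or_lt with h | h
    · rw [← h] at hx ⊢
      have : x = 0 := le_antisymm hx.2 hx.1
      simp [this, hy0 i j hij h.symm]
    · rw [mul_sub, sinusoid_reverse (by positivity) (hy i j hij)]

theorem isH10_sinusoidFn {g : SimpleGraph (Fin n)} {p : Fin n → EuclideanSpace ℝ (Fin d)}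
    {ω : ℝ} (hω : 0 < ω) {y : Fin n → ℝ} (hy0 hy) {W : Set (Fin n)} (hW : ∀ i ∈ W, y i = 0) :
    (straight g p).IsH10 W (sinusoidFn g p hω y hy0 hy) :=
  ⟨fun _ _ _ => isH1_of_contDiff (contDiff_sinusoid_mul _ _ _) _, hW⟩

theorem gradSq_sinusoidFn {g : SimpleGraph (Fin n)} {p : Fin n → EuclideanSpace ℝ (Fin d)}
    {ω : ℝ} (hω : 0 < ω) {y : Fin n → ℝ} (hy0 hy) :
    (straight g p).gradSqIntegral (sinusoidFn g p hω y hy0 hy) -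
      ω ^ 2 * (straight g p).sqIntegral (sinusoidFn g p hω y hy0 hy) =
    ω * (straight g p).edgeSum fun i j => edgeEnergy (ω * dist (p i) (p j)) (y i) (y j) := by
  unfold gradSqIntegral sqIntegral
  rw [← edgeSum_const_mul, ← edgeSum_sub, ← edgeSum_const_mul]
  exact edgeSum_congr fun i j hij => integral_sinusoid hω dist_nonneg (hy i j hij)

open Classical in
/-- If the sinusoid function vanishes, then its values at the ends of an edge are equal. -/
theorem eq_of_sqIntegral_eq_zero {g : SimpleGraph (Fin n)} {p : Fin n → EuclideanSpace ℝ (Fin d)}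
    {ω : ℝ} (hω : 0 < ω) {y : Fin n → ℝ} (hy0 hy)
    (h0 : (straight g p).sqIntegral (sinusoidFn g p hω y hy0 hy) = 0) {i j : Fin n}
    (hij : g.Adj i j) : y i = y j := by
  set u := sinusoidFn g p hω y hy0 hy with hu
  have key : ∀ i j, i < j → g.Adj i j → dist (p i) (p j) ≠ 0 → y i = 0 ∧ y j = 0 := by
    intro i j hlt hij hd
    have hd0 : 0 < dist (p i) (p j) := lt_of_le_of_ne dist_nonneg hd.symm
    have hz : ∫ x in (0 : ℝ)..dist (p i) (p j), (u.edge i j x) ^ 2 = 0 := by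
      refine (Finset.sum_eq_zero_iff_of_nonneg (fun q _ => ?_)).1 h0 (i, j)
        (Finset.mem_filter.2 ⟨Finset.mem_univ _, hlt, hij⟩)
      exact intervalIntegral.integral_nonneg dist_nonneg fun _ _ => sq_nonneg _
    have hcont : Continuous (u.edge i j) := (contDiff_sinusoid_mul _ _ _).continuous
    have hall : ∀ c ∈ Set.Icc 0 (dist (p i) (p j)), u.edge i j c = 0 := by
      intro c hc
      by_contra hne
      have := intervalIntegral.integral_pos hd0 (hcont.pow 2).continuousOn
        (fun _ _ => sq_nonneg _)
        ⟨c, hc, lt_of_le_of_ne (sq_nonneg _) (pow_ne_zero 2 hne).symm⟩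
      exact this.ne' hz
    have e1 := hall 0 ⟨le_rfl, hd0.le⟩
    have e2 := hall _ ⟨hd0.le, le_rfl⟩
    rw [u.edge_zero i j hij] at e1
    refine ⟨e1, ?_⟩
    have e3 := u.edge_symm j i hij.symm (dist (p i) (p j)) ⟨hd0.le, (dist_comm _ _).le⟩
    have e4 : (straight g p).len j i - dist (p i) (p j) = 0 := sub_eq_zero.2 (dist_comm _ _)
    rw [e4, u.edge_zero j i hij.symm, e2] at e3
    exact e3.symm
  by_cases hd : dist (p i) (p j) = 0
  · exact hy0 i j hij hd
  · rcases lt_trichotomy i j with h | h | h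
    · have := key i j h hij hd; rw [this.1, this.2]
    · rw [h]
    · have := key j i h hij.symm (by rwa [dist_comm]); rw [this.1, this.2]

end MetricGraph

namespace Net

variable {k d : ℕ} {D : Fin k → EuclideanSpace ℝ (Fin d)}
  {G : Net k (EuclideanSpace ℝ (Fin d)) ℕ}

theorem edgeSum_straight {n : ℕ} {σ : Fin n → ℕ} (hS : G.Simple)
    (hσ : Function.Injective σ) (hV : ∀ e ∈ G.edges, ∀ v ∈ e.1, v ∈ Set.range σ)
    (p : Fin n → EuclideanSpace ℝ (Fin d)) (f : Sym2 ℕ → ℝ) :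
    (MetricGraph.straight (indexGraph σ G.edges) p).edgeSum (fun i j => f s(σ i, σ j)) =
      (G.edges.map fun e => f e.1).sum := by
  classical
  have h1 := MetricGraph.edgeSum_eq_sum_edges (indexGraph σ G.edges) fun e => f (e.map σ)
  have h2 : ∑ e ∈ (indexGraph σ G.edges).edgeFinset, f (e.map σ) =
      ∑ e ∈ (G.edges.map Prod.fst).toFinset, f e := by
    rw [← image_edgeFinset_indexGraph hV hS.2, Finset.sum_image]
    intro x _ y _ hxy
    exact Sym2.map.injective hσ hxy
  have h3 : ∑ e ∈ (G.edges.map Prod.fst).toFinset, f e = (G.edges.map fun e => f e.1).sum := by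
    unfold Finset.sum
    rw [Multiset.toFinset_val, Multiset.dedup_eq_self.2 hS.1, Multiset.map_map]
    rfl
  rw [← h3, ← h2]
  refine Eq.trans ?_ h1
  unfold MetricGraph.edgeSum
  refine Finset.sum_congr ?_ fun _ _ => rfl
  ext p
  exact ⟨fun h => Finset.mem_filter.2 ⟨Finset.mem_univ _, (Finset.mem_filter.1 h).2⟩,
    fun h => Finset.mem_filter.2 ⟨Finset.mem_univ _, (Finset.mem_filter.1 h).2⟩⟩

theorem Tight.dist_eq {D : Fin k → EuclideanSpace ℝ (Fin d)} {P : ℝ → ℝ → ℝ → Prop} {ℓ : ℝ}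
    (hT : G.Tight) (hG : G.Valid D P ℓ) {i j : ℕ} {h : ℝ} (hm : (s(i, j), h) ∈ G.edges) :
    dist (G.pos i) (G.pos j) = h :=
  le_antisymm (hG.edge_ok _ hm i j rfl).1 (not_lt.1 fun h => hT _ hm (loose_mk.2 h))

/-- A tight net of full length gives an admissible metric graph and a function on it. -/
theorem exists_metricGraph {ω l : ℝ} (hω : 0 < ω) (a₀ : Fin k)
    (hG : G.Valid (fun a => ω • D a) properCond (ω * l)) (hS : G.Simple) {V : Finset ℕ}
    (hV : G.Spans V) (hT : G.Tight) (ht : G.total = ω * l) :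
    ∃ (Γ : MetricGraph) (W : Set (Fin Γ.numV)) (u : Γ.Fn ℝ),
      Γ.IsAdmissible (Set.range D) l W ∧ Γ.IsH10 W u ∧
      Γ.gradSqIntegral u - ω ^ 2 * Γ.sqIntegral u = ω * G.energy (ω * l) ∧
      (Γ.sqIntegral u = 0 → G.val G.base = 0) ∧ Γ.numV = V.card ∧
      Nat.card Γ.graph.edgeSet = G.edges.card := by
  obtain ⟨σ, hσ, hr⟩ := exists_enum V
  have hVr : ∀ e ∈ G.edges, ∀ v ∈ e.1, v ∈ Set.range σ := fun e he v hv => by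
    rw [hr]; exact hV.mem_edge e he v hv
  -- The net lives at the scale where the eigenvalue is 1; positions are scaled back.
  set p : Fin V.card → EuclideanSpace ℝ (Fin d) := fun i => ω⁻¹ • G.pos (σ i) with hp
  have hdist : ∀ i j, ω * dist (p i) (p j) = dist (G.pos (σ i)) (G.pos (σ j)) := fun i j => by
    rw [hp, dist_smul₀, norm_inv, Real.norm_eq_abs, abs_of_pos hω, mul_inv_cancel_left₀ hω.ne']
  set g := indexGraph σ G.edges with hg
  have hadj : ∀ i j, g.Adj i j → (s(σ i, σ j), ω * dist (p i) (p j)) ∈ G.edges := by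
    intro i j hij
    obtain ⟨⟨h, hm⟩, -⟩ := indexGraph_adj.1 hij
    rw [hdist, hT.dist_eq hG hm]
    exact hm
  have hy0 : ∀ i j, g.Adj i j → dist (p i) (p j) = 0 → G.val (σ i) = G.val (σ j) :=
    fun i j hij hd => (hG.edge_ok _ (hadj i j hij) _ _ rfl).2.1 (by simp [hd])
  have hy : ∀ i j, g.Adj i j → properCond (ω * dist (p i) (p j)) (G.val (σ i)) (G.val (σ j)) :=
    fun i j hij => (hG.edge_ok _ (hadj i j hij) _ _ rfl).2.2
  set u := MetricGraph.sinusoidFn g p hω (fun i => G.val (σ i)) hy0 hy with hu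
  -- Tightness makes the length of an edge a function of its ends, so sums over the multiset of
  -- edges become sums over the simple graph.
  have hsum : ∀ (f : ℝ → ℝ → ℝ → ℝ) (hf : ∀ h x y, f h x y = f h y x),
      (MetricGraph.straight g p).edgeSum
        (fun i j => f (dist (G.pos (σ i)) (G.pos (σ j))) (G.val (σ i)) (G.val (σ j))) =
      (G.edges.map fun e => Sym2.lift ⟨f e.2, hf e.2⟩ (e.1.map G.val)).sum := by
    intro f hf
    have := edgeSum_straight hS hσ hVr p (Sym2.lift ⟨fun i j => f (dist (G.pos i) (G.pos j))
      (G.val i) (G.val j), fun i j => by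
        change f _ _ _ = f (dist (G.pos j) (G.pos i)) (G.val j) (G.val i)
        rw [dist_comm, hf]⟩)
    refine this.trans ?_
    congr 1
    refine Multiset.map_congr rfl ?_
    rintro ⟨e, h⟩ he
    induction e using Sym2.ind with
    | _ i j =>
      simp only [Sym2.lift_mk, Sym2.map_mk]
      rw [hT.dist_eq hG he]
  have hbr : G.base ∈ Set.range σ := by rw [hr]; exact hV.mem_base
  refine ⟨MetricGraph.straight g p, {i | σ i ∈ Set.range G.term}, u,
    ⟨hV.connected hσ hr, ?_, MetricGraph.straightImmersion g p,
      MetricGraph.isImmersion_straight g p, ?_⟩,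
    MetricGraph.isH10_sinusoidFn hω _ _ ?_, ?_, ?_, rfl, card_edgeSet_indexGraph hσ hVr hS.2 hS.1⟩
  · have := hsum (fun h _ _ => h) fun _ _ _ => rfl
    have h2 : (MetricGraph.straight g p).edgeSum
        (fun i j => dist (G.pos (σ i)) (G.pos (σ j))) = ω * (MetricGraph.straight g p).totalLength := by
      rw [MetricGraph.totalLength, ← MetricGraph.edgeSum_const_mul]
      exact MetricGraph.edgeSum_congr fun i j _ => (hdist i j).symm
    rw [h2] at this
    have h3 : (G.edges.map fun e => Sym2.lift ⟨fun _ _ => e.2, fun _ _ => rfl⟩ (e.1.map G.val)).sum =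
        G.total := by
      unfold total
      congr 1
      refine Multiset.map_congr rfl ?_
      rintro ⟨e, h⟩ _
      induction e using Sym2.ind with
      | _ i j => rfl
    exact mul_left_cancel₀ hω.ne' (this.trans (h3.trans ht))
  · ext x
    constructor
    · rintro ⟨i, ⟨a, ha⟩, rfl⟩
      refine ⟨a, ?_⟩
      change D a = ω⁻¹ • G.pos (σ i)
      rw [← ha, hG.pos_term, inv_smul_smul₀ hω.ne']
    · rintro ⟨a, rfl⟩
      have : G.term a ∈ Set.range σ := by rw [hr]; exact hV.mem_term a
      obtain ⟨i, hi⟩ := this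
      refine ⟨i, ⟨a, hi.symm⟩, ?_⟩
      change ω⁻¹ • G.pos (σ i) = D a
      rw [hi, hG.pos_term, inv_smul_smul₀ hω.ne']
  · rintro i ⟨a, ha⟩
    rw [← ha, hG.val_term]
  · rw [hu, MetricGraph.gradSq_sinusoidFn, energy, ht, sub_self, zero_mul, sub_zero]
    congr 1
    refine Eq.trans (MetricGraph.edgeSum_congr fun i j _ => ?_) (hsum edgeEnergy edgeEnergy_comm)
    exact congrArg (fun t => edgeEnergy t _ _) (hdist i j)
  · intro h0
    -- If the function vanishes, the values agree along edges, hence everywhere, and at a terminal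
    -- the value is zero.
    have hval : ∀ a b, g.Adj a b → G.val (σ a) = G.val (σ b) := fun a b hab =>
      MetricGraph.eq_of_sqIntegral_eq_zero hω hy0 hy h0 hab
    have hconn : ∀ {x y : ℕ}, Conn G.edges x y → G.val x = G.val y := by
      intro x y hc
      induction hc with
      | rel x y h =>
        obtain ⟨h, hm⟩ := h
        obtain ⟨a, ha⟩ := hVr _ hm x (Sym2.mem_mk_left _ _)
        obtain ⟨b, hb⟩ := hVr _ hm y (Sym2.mem_mk_right _ _)
        rw [← ha, ← hb]
        refine hval a b (indexGraph_adj.2 ⟨⟨h, by rw [ha, hb]; exact hm⟩, fun hab => ?_⟩)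
        exact hS.2 _ hm (by simp [← ha, ← hb, hab])
      | refl => rfl
      | symm x y _ ih => exact ih.symm
      | trans x y z _ _ h1 h2 => exact h1.trans h2
    rw [hconn (hG.conn_term a₀), hG.val_term]

end Net

/-! ### Lower bounds for the energy of a function on an interval. -/

open Real Filter Topology

theorem intervalIntegrable_sq_deriv {f : ℝ → ℝ} {L a b : ℝ}
    (hf : MemLp (deriv f) 2 (volume.restrict (Set.Icc 0 L))) (h0 : 0 ≤ a) (hab : a ≤ b) (hb : b ≤ L) :
    IntervalIntegrable (fun t => deriv f t ^ 2) volume a b := by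
  have h1 : IntegrableOn (fun t => deriv f t ^ 2) (Set.Icc 0 L) := hf.integrable_sq
  rw [intervalIntegrable_iff_integrableOn_Icc_of_le hab]
  exact h1.mono_set (Set.Icc_subset_Icc h0 hb)

/-- Sinusoids minimize the energy for given boundary values. -/
theorem edgeEnergy_le_integral {f : ℝ → ℝ} {a b ω : ℝ} (hω : 0 < ω) (hab : a < b)
    (hp : ω * (b - a) < π) (hf : AbsolutelyContinuousOnInterval f a b)
    (hf2 : IntervalIntegrable (fun t => deriv f t ^ 2) volume a b) :
    ω * edgeEnergy (ω * (b - a)) (f a) (f b) ≤ ∫ t in a..b, (deriv f t ^ 2 - ω ^ 2 * f t ^ 2) := by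
  set h := ω * (b - a) with hh
  have h0 : 0 < h := mul_pos hω (by linarith)
  set s := (f b - f a * cos h) / sin h with hs
  set g : ℝ → ℝ := fun t => sinusoid (f a) s (ω * (t - a)) with hg
  set g' : ℝ → ℝ := fun t => ω * sinusoid s (-f a) (ω * (t - a)) with hg'
  -- The shift keeps ω(t - a) + η in (0, π) on the closed interval, so the cotangent below, a
  -- solution of the Riccati equation c' = -(ω² + c²), is regular there.
  set η := (π - h) / 2 with hη
  set c : ℝ → ℝ := fun t => ω * (cos (ω * (t - a) + η) / sin (ω * (t - a) + η)) with hc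
  have hsin : ∀ t ∈ Set.Icc a b, 0 < sin (ω * (t - a) + η) := fun t ht => by
    have e1 : 0 ≤ ω * (t - a) := mul_nonneg hω.le (by linarith [ht.1])
    have e2 : ω * (t - a) ≤ h := mul_le_mul_of_nonneg_left (by linarith [ht.2]) hω.le
    exact sin_pos_of_length (by linarith) (by linarith)
  have dlin : ∀ t, HasDerivAt (fun t => ω * (t - a)) ω t := fun t => by
    simpa using ((hasDerivAt_id t).sub_const a).const_mul ω
  have dg : ∀ t, HasDerivAt g (g' t) t := fun t => by
    refine ((hasDerivAt_sinusoid (f a) s (ω * (t - a))).comp t (dlin t)).congr_deriv ?_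
    rw [hg']; ring
  have dg' : ∀ t, HasDerivAt g' (-(ω ^ 2 * g t)) t := fun t => by
    refine (((hasDerivAt_sinusoid s (-f a) (ω * (t - a))).comp t (dlin t)).const_mul ω).congr_deriv ?_
    simp only [hg, sinusoid]; ring
  have dc : ∀ t ∈ Set.Icc a b, HasDerivAt c (-(ω ^ 2 + c t ^ 2)) t := fun t ht => by
    have hs0 := (hsin t ht).ne'
    have d1 := ((dlin t).add_const η).cos.fun_div ((dlin t).add_const η).sin hs0
    refine (d1.const_mul ω).congr_deriv ?_
    simp only [hc]
    field_simp
    ring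
  have cg : ContDiff ℝ 1 g := by unfold g sinusoid; fun_prop
  have cg' : ContDiff ℝ 1 g' := by unfold g' sinusoid; fun_prop
  have cc : ContDiffOn ℝ 1 c (Set.uIcc a b) := by
    rw [Set.uIcc_of_le hab.le]
    refine ContDiffOn.mul contDiffOn_const (ContDiffOn.div (by fun_prop) (by fun_prop) fun t ht => (hsin t ht).ne')
  have ag := cg.contDiffOn (s := Set.uIcc a b) |>.absolutelyContinuousOnInterval
  have ag' := cg'.contDiffOn (s := Set.uIcc a b) |>.absolutelyContinuousOnInterval
  have ac := cc.absolutelyContinuousOnInterval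
  have aw := hf.sub ag
  -- A calibration: its boundary values depend only on those of f, and f'² - ω²f² - Φ' is the square
  -- of f' - g' - c(f - g) almost everywhere.
  set Φ : ℝ → ℝ := g * g' + ((fun t => 2 * g' t) * (f - g) + c * ((f - g) * (f - g))) with hΦ
  have aΦ : AbsolutelyContinuousOnInterval Φ a b :=
    (ag.mul ag').add (((ag'.const_mul 2).mul aw).add (ac.mul (aw.mul aw)))
  have gb : g b = f b := by
    simp only [hg]; rw [← hh, hs, exists_sinusoid h0 hp]
  have ga : g a = f a := by simp [hg]
  have hint := aΦ.integral_deriv_eq_sub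
  have hval : Φ b - Φ a = ω * edgeEnergy h (f a) (f b) := by
    have e := edgeEnergy_sinusoid (a := 0) (b := h) (f a) s (by linarith) (by linarith)
    simp only [sub_zero, sinusoid_zero] at e
    have e2 : sinusoid (f a) s h = f b := gb
    rw [e2] at e
    rw [e]
    simp only [hΦ, Pi.add_apply, Pi.mul_apply, Pi.sub_apply, ga, gb, sub_self, mul_zero, add_zero]
    simp only [hg', ← hh, sub_self, mul_zero, sinusoid_zero]
    ring
  rw [← hval, ← hint]
  have hfc := hf.continuousOn
  refine intervalIntegral.integral_mono_ae_restrict hab.le aΦ.intervalIntegrable_deriv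
    (hf2.sub ((hfc.pow 2).intervalIntegrable.const_mul _)) ?_
  have hd := hf.ae_differentiableAt
  rw [Set.uIcc_of_le hab.le] at hd
  rw [Filter.EventuallyLE, ae_restrict_iff' measurableSet_Icc]
  filter_upwards [hd] with t ht htI
  have df := (ht htI).hasDerivAt
  have dw := df.sub (dg t)
  have dΦ : HasDerivAt Φ _ t := ((dg t).mul (dg' t)).add
    ((((dg' t).const_mul 2).mul dw).add ((dc t htI).mul (dw.mul dw)))
  rw [dΦ.deriv]
  simp only [Pi.sub_apply, Pi.mul_apply]
  nlinarith [sq_nonneg (deriv f t - g' t - c t * (f t - g t))]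

theorem neg_le_integral {f : ℝ → ℝ} {a b ω M : ℝ} (hab : a ≤ b)
    (hf : ContinuousOn f (Set.Icc a b)) (hM : ∀ t ∈ Set.Icc a b, |f t| ≤ M)
    (hf2 : IntervalIntegrable (fun t => deriv f t ^ 2) volume a b) :
    -(ω ^ 2 * M ^ 2 * (b - a)) ≤ ∫ t in a..b, (deriv f t ^ 2 - ω ^ 2 * f t ^ 2) := by
  have h1 : ∫ _ in a..b, -(ω ^ 2 * M ^ 2) = -(ω ^ 2 * M ^ 2 * (b - a)) := by
    rw [intervalIntegral.integral_const, smul_eq_mul]; ring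
  rw [← h1]
  have hi : IntervalIntegrable (fun t => f t ^ 2) volume a b :=
    ContinuousOn.intervalIntegrable (by rw [Set.uIcc_of_le hab]; exact hf.pow 2)
  refine intervalIntegral.integral_mono_on hab intervalIntegrable_const
    (hf2.sub (hi.const_mul _)) fun t ht => ?_
  have := sq_le_sq' (by linarith [neg_abs_le (f t), hM t ht]) ((le_abs_self _).trans (hM t ht))
  have := mul_le_mul_of_nonneg_left this (sq_nonneg ω)
  nlinarith [sq_nonneg (deriv f t)]

/-- The capped energy bounds the energy of a function on an interval from below. -/
theorem cappedEnergy_le_integral {f : ℝ → ℝ} {a b ω M : ℝ} (hω : 0 < ω) (hM0 : 0 < M) (hab : a ≤ b)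
    (hp : ω * (b - a) < π) (hf : AbsolutelyContinuousOnInterval f a b)
    (hM : ∀ t ∈ Set.Icc a b, |f t| ≤ M)
    (hf2 : IntervalIntegrable (fun t => deriv f t ^ 2) volume a b) :
    cappedEnergy 1 (ω * (b - a)) (|f a| / M) (|f b| / M) ≤
      (ω * M ^ 2)⁻¹ * ∫ t in a..b, (deriv f t ^ 2 - ω ^ 2 * f t ^ 2) := by
  rcases hab.eq_or_lt with rfl | hlt
  · simp [cappedEnergy]
  have hc : ContinuousOn f (Set.Icc a b) := by
    have := hf.continuousOn
    rwa [Set.uIcc_of_le hab] at this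
  have h0 : 0 < ω * (b - a) := mul_pos hω (by linarith)
  rw [← div_eq_inv_mul, le_div_iff₀ (by positivity)]
  unfold cappedEnergy
  rw [max_mul_of_nonneg _ _ (by positivity)]
  refine max_le ?_ ?_
  · refine le_trans (le_of_eq ?_) (le_trans (mul_le_mul_of_nonneg_left
      (edgeEnergy_abs_le h0.le hp.le (f a) (f b)) hω.le) (edgeEnergy_le_integral hω hlt hp hf hf2))
    have := edgeEnergy_smul M⁻¹ (ω * (b - a)) |f a| |f b|
    rw [div_eq_inv_mul, div_eq_inv_mul, this]
    field_simp
  · refine le_trans (le_of_eq ?_) (neg_le_integral (ω := ω) hab hc hM hf2)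
    ring

/-! ### From competitors to nets. -/

open Real Filter Topology

/-- Two partitions into `m` equal parts. -/
theorem exists_partition {L t : ℝ} (ht : t ∈ Set.Icc 0 L) {m : ℕ} (hm : 0 < m) :
    ∃ τ : ℕ → ℝ, τ 0 = 0 ∧ τ m = t ∧ τ (2 * m) = L ∧ Monotone τ ∧
      ∀ q, τ (q + 1) - τ q ≤ L / m := by
  have hm' : (0 : ℝ) < m := Nat.cast_pos.2 hm
  set τ : ℕ → ℝ := fun q => t * (min q m : ℕ) / m + (L - t) * (q - m : ℕ) / m with hτ
  have step : ∀ q, τ (q + 1) - τ q = t / m ∨ τ (q + 1) - τ q = (L - t) / m := by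
    intro q
    rcases lt_or_ge q m with h | h
    · left
      simp only [hτ, min_eq_left (Nat.succ_le_of_lt h), min_eq_left h.le,
        Nat.sub_eq_zero_of_le h.le, Nat.sub_eq_zero_of_le (Nat.succ_le_of_lt h)]
      push_cast; ring
    · right
      simp only [hτ, min_eq_right h, min_eq_right (h.trans q.le_succ), Nat.succ_sub h,
        Nat.succ_eq_add_one]
      push_cast; ring
  have ht0 := ht.1
  have ht1 : 0 ≤ L - t := sub_nonneg.2 ht.2
  refine ⟨τ, by simp [hτ], ?_, ?_, monotone_nat_of_le_succ fun q => ?_, fun q => ?_⟩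
  · simp [hτ, hm'.ne']
  · have : 2 * m - m = m := by omega
    simp only [hτ, this, min_eq_right (by omega : m ≤ 2 * m)]
    field_simp; ring
  · rcases step q with h | h
    · have : 0 ≤ t / m := by positivity
      linarith
    · have : 0 ≤ (L - t) / m := by positivity
      linarith
  · rcases step q with h | h <;> rw [h] <;> gcongr <;> linarith

namespace MetricGraph

variable {Γ : MetricGraph} {X : Type}

theorem Fn.edge_len (f : Γ.Fn X) {i j : Fin Γ.numV} (h : Γ.graph.Adj i j) :
    f.edge i j (Γ.len i j) = f.vert j := by
  have := f.edge_symm i j h 0 ⟨le_rfl, Γ.len_nonneg i j h⟩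
  rw [f.edge_zero j i h.symm, sub_zero] at this
  exact this.symm

open Classical in
theorem len_le_totalLength {i j : Fin Γ.numV} (hlt : i < j) (h : Γ.graph.Adj i j) :
    Γ.len i j ≤ Γ.totalLength :=
  Finset.single_le_sum (f := fun p : Fin Γ.numV × Fin Γ.numV => Γ.len p.1 p.2)
    (fun _ hp => Γ.len_nonneg _ _ (Finset.mem_filter.1 hp).2.2)
    (Finset.mem_filter.2 ⟨Finset.mem_univ (i, j), hlt, h⟩)

theorem IsImmersion.dist_le {d : ℕ} {γ : Γ.Fn (EuclideanSpace ℝ (Fin d))} (hγ : Γ.IsImmersion γ)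
    {i j : Fin Γ.numV} (h : Γ.graph.Adj i j) {x y : ℝ} (h0 : 0 ≤ x) (hxy : x ≤ y)
    (hy : y ≤ Γ.len i j) : dist (γ.edge i j x) (γ.edge i j y) ≤ y - x := by
  have hx' : x ∈ Set.Icc 0 (Γ.len i j) := ⟨h0, hxy.trans hy⟩
  have hy' : y ∈ Set.Icc 0 (Γ.len i j) := ⟨h0.trans hxy, hy⟩
  have h1 := eVariationOn.edist_le (γ.edge i j) (s := Set.Icc 0 (Γ.len i j) ∩ Set.Icc x y)
    (x := x) (y := y) ⟨hx', le_rfl, hxy⟩ ⟨hy', hxy, le_rfl⟩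
  rw [(hγ i j h).2 hx' hy', NNReal.coe_one, one_mul, edist_dist] at h1
  exact (ENNReal.ofReal_le_ofReal_iff (by linarith)).1 h1

theorem IsH10.continuousOn {W : Set (Fin Γ.numV)} {u : Γ.Fn ℝ} (hu : Γ.IsH10 W u)
    {i j : Fin Γ.numV} (h : Γ.graph.Adj i j) :
    ContinuousOn (u.edge i j) (Set.Icc 0 (Γ.len i j)) := by
  have := (hu.1 i j h).1.continuousOn
  rwa [Set.uIcc_of_le (Γ.len_nonneg i j h)] at this

open Classical in
/-- The maximum of `|u|`. -/
theorem exists_max {W : Set (Fin Γ.numV)} {u : Γ.Fn ℝ} (hu : Γ.IsH10 W u)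
    (h1 : Γ.sqIntegral u = 1) : ∃ i j t, i < j ∧ Γ.graph.Adj i j ∧ t ∈ Set.Icc 0 (Γ.len i j) ∧
      1 ≤ u.edge i j t ^ 2 * Γ.totalLength ∧
      ∀ i' j' t', i' < j' → Γ.graph.Adj i' j' → t' ∈ Set.Icc 0 (Γ.len i' j') →
        |u.edge i' j' t'| ≤ |u.edge i j t| := by
  have hmax : ∀ i j, ∃ t, Γ.graph.Adj i j → t ∈ Set.Icc 0 (Γ.len i j) ∧
      ∀ x ∈ Set.Icc 0 (Γ.len i j), |u.edge i j x| ≤ |u.edge i j t| := by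
    intro i j
    by_cases h : Γ.graph.Adj i j
    · obtain ⟨t, ht, hm⟩ := isCompact_Icc.exists_isMaxOn
        (Set.nonempty_Icc.2 (Γ.len_nonneg i j h)) (hu.continuousOn h).abs
      exact ⟨t, fun _ => ⟨ht, fun x hx => hm hx⟩⟩
    · exact ⟨0, fun h' => absurd h' h⟩
  choose t ht using hmax
  set S := Finset.univ.filter
    (fun p : Fin Γ.numV × Fin Γ.numV => p.1 < p.2 ∧ Γ.graph.Adj p.1 p.2) with hS
  have hne : S.Nonempty := by
    by_contra hcon
    rw [Finset.not_nonempty_iff_eq_empty] at hcon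
    have : Γ.sqIntegral u = 0 := by
      unfold sqIntegral edgeSum
      rw [← hS, hcon, Finset.sum_empty]
    rw [this] at h1
    exact zero_ne_one h1
  obtain ⟨p, hp, hpm⟩ := S.exists_max_image (fun p => |u.edge p.1 p.2 (t p.1 p.2)|) hne
  obtain ⟨-, hlt, hadj⟩ := Finset.mem_filter.1 hp
  have hbd : ∀ i' j' t', i' < j' → Γ.graph.Adj i' j' → t' ∈ Set.Icc 0 (Γ.len i' j') →
      |u.edge i' j' t'| ≤ |u.edge p.1 p.2 (t p.1 p.2)| := fun i' j' t' h1 h2 h3 =>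
    ((ht i' j' h2).2 t' h3).trans
      (hpm (i', j') (Finset.mem_filter.2 ⟨Finset.mem_univ _, h1, h2⟩))
  refine ⟨p.1, p.2, t p.1 p.2, hlt, hadj, (ht _ _ hadj).1, ?_, hbd⟩
  -- The integral of u² is at most the squared maximum of |u| times the total length.
  rw [← h1, totalLength, ← edgeSum_const_mul]
  refine Finset.sum_le_sum fun q hq => ?_
  obtain ⟨-, qlt, qadj⟩ := Finset.mem_filter.1 hq
  have hi : ∫ _ in (0 : ℝ)..Γ.len q.1 q.2, u.edge p.1 p.2 (t p.1 p.2) ^ 2 =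
      u.edge p.1 p.2 (t p.1 p.2) ^ 2 * Γ.len q.1 q.2 := by
    rw [intervalIntegral.integral_const, smul_eq_mul, sub_zero, mul_comm]
  refine le_trans ?_ hi.le
  refine intervalIntegral.integral_mono_on (Γ.len_nonneg _ _ qadj)
    (ContinuousOn.intervalIntegrable (by
      rw [Set.uIcc_of_le (Γ.len_nonneg _ _ qadj)]; exact (hu.continuousOn qadj).pow 2))
    intervalIntegrable_const fun x hx => ?_
  exact sq_le_sq.2 (hbd _ _ _ qlt qadj hx)

end MetricGraph

namespace Net

open Classical in
/-- The vertices of a good net can be relabelled by natural numbers. -/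
theorem Good.exists_nat {k : ℕ} {E α : Type} [NormedAddCommGroup E]
    {D : Fin k → E} {P : ℝ → ℝ → ℝ → Prop} {c ℓ η : ℝ} {G : Net k E α} (hG : G.Good D P c ℓ η) :
    ∃ G' : Net k E ℕ, G'.Good D P c ℓ η := by
  obtain ⟨V, hV⟩ := hG.toValid.exists_spans
  obtain ⟨f, hf⟩ := Set.countable_iff_exists_injOn.1 V.countable_toSet
  have : Nonempty α := ⟨G.base⟩
  have hinv := hf.leftInvOn_invFunOn
  exact ⟨_, hG.relabel f (pos := G.pos ∘ Function.invFunOn f V)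
    (val := G.val ∘ Function.invFunOn f V) V hV.mem_edge hV.mem_base hV.mem_term
    (fun v hv => congrArg G.pos (hinv hv)) (fun v hv => congrArg G.val (hinv hv))
    (fun v => hG.val_nonneg _) fun v => hG.val_le _⟩

open Classical MetricGraph in
/-- A competitor gives a net of almost the same energy. -/
theorem exists_good_of_mem_rayleighValues {k d : ℕ} {D : Fin k → EuclideanSpace ℝ (Fin d)}
    {l ω e : ℝ} (hω : 0 < ω) (hl : 0 < l) {Γ : MetricGraph} {W : Set (Fin Γ.numV)}
    (hΓ : Γ.IsAdmissible (Set.range D) l W) (he : e ∈ Γ.rayleighValues W) (hωe : ω ^ 2 ≤ e) :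
    ∃ G : Net k (EuclideanSpace ℝ (Fin d)) ℕ,
      G.Good (fun a => ω • D a) shortCond 1 (ω * l) (l * (e - ω ^ 2) / ω) := by
  obtain ⟨hconn, htot, γ, hγ, hγW⟩ := hΓ
  obtain ⟨u, hu, hu1, hue⟩ := he
  obtain ⟨i₀, j₀, t₀, hlt₀, hadj₀, ht₀, hM1, hMb⟩ := exists_max hu hu1
  set M := |u.edge i₀ j₀ t₀| with hM
  have hMsq : u.edge i₀ j₀ t₀ ^ 2 = M ^ 2 := (sq_abs _).symm
  rw [hMsq, htot] at hM1
  have hM0 : 0 < M := by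
    refine lt_of_le_of_ne (abs_nonneg _) fun h => ?_
    rw [← h] at hM1
    norm_num at hM1
  -- Cutting into m + 1 parts makes all scaled pieces at most π/2 long.
  obtain ⟨m, hm⟩ := exists_nat_ge (2 * (ω * l) / π)
  have hm1 : 0 < m + 1 := Nat.succ_pos m
  have hm2 : ω * l / (m + 1 : ℕ) ≤ π / 2 := by
    rw [div_le_iff₀ pi_pos] at hm
    rw [div_le_iff₀ (by positivity)]
    push_cast
    nlinarith [pi_pos]
  generalize m + 1 = n at hm1 hm2
  have hτex : ∀ i j, ∃ τ : ℕ → ℝ, Γ.graph.Adj i j → τ 0 = 0 ∧ τ (2 * n) = Γ.len i j ∧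
      Monotone τ ∧ (∀ q, τ (q + 1) - τ q ≤ Γ.len i j / n) ∧ (i = i₀ → j = j₀ → τ n = t₀) := by
    intro i j
    by_cases h : Γ.graph.Adj i j
    · by_cases hij : i = i₀ ∧ j = j₀
      · obtain ⟨rfl, rfl⟩ := hij
        obtain ⟨τ, h1, h2, h3, h4, h5⟩ := exists_partition ht₀ hm1
        exact ⟨τ, fun _ => ⟨h1, h3, h4, h5, fun _ _ => h2⟩⟩
      · obtain ⟨τ, h1, h2, h3, h4, h5⟩ := exists_partition (t := 0)
          ⟨le_rfl, Γ.len_nonneg i j h⟩ hm1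
        exact ⟨τ, fun _ => ⟨h1, h3, h4, h5, fun h1 h2 => absurd ⟨h1, h2⟩ hij⟩⟩
    · exact ⟨fun _ => 0, fun h' => absurd h' h⟩
  choose τ hτ using hτex
  set S := Finset.univ.filter
    (fun p : Fin Γ.numV × Fin Γ.numV => p.1 < p.2 ∧ Γ.graph.Adj p.1 p.2) with hS
  have hSm : ∀ {p : Fin Γ.numV × Fin Γ.numV}, p ∈ S → p.1 < p.2 ∧ Γ.graph.Adj p.1 p.2 :=
    fun hp => (Finset.mem_filter.1 hp).2
  have hmem : ∀ {i j}, Γ.graph.Adj i j → ∀ {q}, q ≤ 2 * n → τ i j q ∈ Set.Icc 0 (Γ.len i j) := by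
    intro i j h q hq
    obtain ⟨h1, h2, h3, -⟩ := hτ i j h
    exact ⟨by rw [← h1]; exact h3 (Nat.zero_le _), by rw [← h2]; exact h3 hq⟩
  -- The end nodes of an edge are vertices of the graph, shared by all edges there. Only interior
  -- nodes are new.
  set node : Fin Γ.numV × Fin Γ.numV → ℕ → Fin Γ.numV ⊕ (Fin Γ.numV × Fin Γ.numV × ℕ) :=
    fun p q => if q = 0 then Sum.inl p.1 else if q = 2 * n then Sum.inl p.2
      else Sum.inr (p.1, p.2, q) with hnode
  set pos : Fin Γ.numV ⊕ (Fin Γ.numV × Fin Γ.numV × ℕ) → EuclideanSpace ℝ (Fin d) :=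
    Sum.elim (fun i => ω • γ.vert i) (fun x => ω • γ.edge x.1 x.2.1 (τ x.1 x.2.1 x.2.2)) with hpos
  -- At nodes of edges the quotient is at most 1 already. The minimum only secures this bound for
  -- labels which do not occur.
  set val : Fin Γ.numV ⊕ (Fin Γ.numV × Fin Γ.numV × ℕ) → ℝ :=
    Sum.elim (fun i => min 1 (|u.vert i| / M))
      (fun x => min 1 (|u.edge x.1 x.2.1 (τ x.1 x.2.1 x.2.2)| / M)) with hval
  have hnode0 : ∀ p, node p 0 = Sum.inl p.1 := fun p => by simp [hnode]
  have hnode2 : ∀ p, node p (2 * n) = Sum.inl p.2 := fun p => by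
    have : n ≠ 0 := hm1.ne'
    simp [hnode, this]
  have hposn : ∀ p ∈ S, ∀ q ≤ 2 * n, pos (node p q) = ω • γ.edge p.1 p.2 (τ p.1 p.2 q) := by
    intro p hp q hq
    have hadj := (hSm hp).2
    obtain ⟨h1, h2, -⟩ := hτ p.1 p.2 hadj
    by_cases hq0 : q = 0
    · rw [hq0, hnode0, h1, γ.edge_zero _ _ hadj]; rfl
    by_cases hq2 : q = 2 * n
    · rw [hq2, hnode2, h2, γ.edge_len hadj]; rfl
    · simp [hnode, hq0, hq2, hpos]
  have hvaln : ∀ p ∈ S, ∀ q ≤ 2 * n, val (node p q) = |u.edge p.1 p.2 (τ p.1 p.2 q)| / M := by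
    intro p hp q hq
    have hadj := (hSm hp).2
    obtain ⟨h1, h2, -⟩ := hτ p.1 p.2 hadj
    have hle : |u.edge p.1 p.2 (τ p.1 p.2 q)| / M ≤ 1 := by
      rw [div_le_one hM0]; exact hMb _ _ _ (hSm hp).1 hadj (hmem hadj hq)
    rw [← min_eq_right hle]
    by_cases hq0 : q = 0
    · rw [hq0, hnode0, h1, u.edge_zero _ _ hadj]; rfl
    by_cases hq2 : q = 2 * n
    · rw [hq2, hnode2, h2, u.edge_len hadj]; rfl
    · simp [hnode, hq0, hq2, hval]
  set T := S ×ˢ Finset.range (2 * n) with hT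
  set edges : Multiset (Sym2 (Fin Γ.numV ⊕ (Fin Γ.numV × Fin Γ.numV × ℕ)) × ℝ) :=
    T.val.map fun x => (s(node x.1 x.2, node x.1 (x.2 + 1)),
      ω * (τ x.1.1 x.1.2 (x.2 + 1) - τ x.1.1 x.1.2 x.2)) with hedges
  have hTm : ∀ {x : (Fin Γ.numV × Fin Γ.numV) × ℕ}, x ∈ T → x.1 ∈ S ∧ x.2 + 1 ≤ 2 * n := fun hx =>
    ⟨(Finset.mem_product.1 hx).1, Finset.mem_range.1 (Finset.mem_product.1 hx).2⟩
  have hedge : ∀ y ∈ edges, ∃ p q, p ∈ S ∧ q + 1 ≤ 2 * n ∧ y = (s(node p q, node p (q + 1)),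
      ω * (τ p.1 p.2 (q + 1) - τ p.1 p.2 q)) := by
    intro y hy
    obtain ⟨x, hx, rfl⟩ := Multiset.mem_map.1 hy
    exact ⟨x.1, x.2, (hTm hx).1, (hTm hx).2, rfl⟩
  have hstep : ∀ p ∈ S, ∀ q, q + 1 ≤ 2 * n → Conn edges (node p q) (node p (q + 1)) := by
    intro p hp q hq
    exact Conn.of_mem (h := ω * (τ p.1 p.2 (q + 1) - τ p.1 p.2 q)) (Multiset.mem_map.2
      ⟨(p, q), Finset.mem_product.2 ⟨hp, Finset.mem_range.2 hq⟩, rfl⟩)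
  have hchain : ∀ p ∈ S, ∀ q, q ≤ 2 * n → Conn edges (Sum.inl p.1) (node p q) := by
    intro p hp q
    induction q with
    | zero => intro _; rw [hnode0]; exact Conn.refl _
    | succ q ih => exact fun hq => (ih (by omega)).trans (hstep p hp q hq)
  have hadjc : ∀ i j, Γ.graph.Adj i j → Conn edges (Sum.inl i) (Sum.inl j) := by
    have : ∀ i j, i < j → Γ.graph.Adj i j → Conn edges (Sum.inl i) (Sum.inl j) := by
      intro i j hlt h
      have := hchain (i, j) (Finset.mem_filter.2 ⟨Finset.mem_univ _, hlt, h⟩) _ le_rfl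
      rwa [hnode2] at this
    intro i j h
    rcases lt_trichotomy i j with hlt | hlt | hlt
    · exact this i j hlt h
    · exact absurd hlt h.ne
    · exact (this j i hlt h.symm).symm
  have hinl : ∀ i j, Conn edges (Sum.inl i) (Sum.inl j) := fun i j =>
    conn_of_reachable (σ := Sum.inl) hadjc (hconn.preconnected i j)
  -- The base is the node with index `n` on this edge; the partition there was chosen to pass
  -- through the maximum point of |u|.
  have hp₀ : (i₀, j₀) ∈ S := Finset.mem_filter.2 ⟨Finset.mem_univ _, hlt₀, hadj₀⟩
  have hbase : ∀ i, Conn edges (node (i₀, j₀) n) (Sum.inl i) := fun i =>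
    ((hinl i i₀).trans (hchain _ hp₀ n (by omega))).symm
  have hterm : ∀ a, ∃ i ∈ W, γ.vert i = D a := fun a => by
    have : D a ∈ γ.vert '' W := by rw [hγW]; exact ⟨a, rfl⟩
    exact this
  choose term htW htD using hterm
  have hsumtot : (edges.map Prod.snd).sum = ω * l := by
    have : (edges.map Prod.snd).sum =
        ∑ x ∈ T, ω * (τ x.1.1 x.1.2 (x.2 + 1) - τ x.1.1 x.1.2 x.2) := by
      rw [hedges, Multiset.map_map]; rfl
    rw [this, hT, Finset.sum_product, ← htot, totalLength, ← edgeSum_const_mul]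
    refine Finset.sum_congr rfl fun p hp => ?_
    obtain ⟨h1, h2, -⟩ := hτ p.1 p.2 (hSm hp).2
    rw [← Finset.mul_sum]
    refine (congrArg (ω * ·) (Finset.sum_range_sub (τ p.1 p.2) (2 * n))).trans ?_
    simp only [h1, h2, sub_zero]
  have hlen : ∀ p ∈ S, ∀ q, ω * (τ p.1 p.2 (q + 1) - τ p.1 p.2 q) ≤ π / 2 := by
    intro p hp q
    refine le_trans ?_ hm2
    have h1 := (hτ p.1 p.2 (hSm hp).2).2.2.2.1 q
    have h2 := len_le_totalLength (hSm hp).1 (hSm hp).2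
    rw [htot] at h2
    rw [mul_div_assoc]
    refine mul_le_mul_of_nonneg_left (h1.trans ?_) hω.le
    gcongr
  have hmono : ∀ p ∈ S, ∀ q, τ p.1 p.2 q ≤ τ p.1 p.2 (q + 1) := fun p hp q =>
    (hτ p.1 p.2 (hSm hp).2).2.2.1 q.le_succ
  have hcap : (edges.map fun x => symCapped 1 x.2 (x.1.map val)).sum ≤
      (ω * M ^ 2)⁻¹ * (e - ω ^ 2) := by
    have : (edges.map fun x => symCapped 1 x.2 (x.1.map val)).sum =
        ∑ x ∈ T, cappedEnergy 1 (ω * (τ x.1.1 x.1.2 (x.2 + 1) - τ x.1.1 x.1.2 x.2))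
          (val (node x.1 x.2)) (val (node x.1 (x.2 + 1))) := by
      rw [hedges, Multiset.map_map]; rfl
    have hE : e - ω ^ 2 = Γ.edgeSum fun i j =>
        ∫ t in (0 : ℝ)..Γ.len i j, (deriv (u.edge i j) t ^ 2 - ω ^ 2 * u.edge i j t ^ 2) := by
      have h1 : e - ω ^ 2 = Γ.gradSqIntegral u - ω ^ 2 * Γ.sqIntegral u := by rw [hue, hu1, mul_one]
      rw [h1]
      unfold gradSqIntegral sqIntegral
      rw [← edgeSum_const_mul, ← edgeSum_sub]
      refine edgeSum_congr fun i j h => ?_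
      have hL := Γ.len_nonneg i j h
      rw [intervalIntegral.integral_sub
        (intervalIntegrable_sq_deriv (hu.1 i j h).2 le_rfl hL le_rfl)
        (ContinuousOn.intervalIntegrable (by
          rw [Set.uIcc_of_le hL]; exact ((hu.continuousOn h).pow 2).const_mul _)),
        intervalIntegral.integral_const_mul]
    rw [this, hE, ← edgeSum_const_mul, hT, Finset.sum_product]
    refine Finset.sum_le_sum fun p hp => ?_
    have hadj := (hSm hp).2
    obtain ⟨h1, h2, h3, -⟩ := hτ p.1 p.2 hadj
    have hii : ∀ {a b}, 0 ≤ a → a ≤ b → b ≤ Γ.len p.1 p.2 → IntervalIntegrable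
        (fun t => deriv (u.edge p.1 p.2) t ^ 2 - ω ^ 2 * u.edge p.1 p.2 t ^ 2) volume a b := by
      intro a b ha hab hb
      refine (intervalIntegrable_sq_deriv (hu.1 _ _ hadj).2 ha hab hb).sub
        (ContinuousOn.intervalIntegrable ?_)
      rw [Set.uIcc_of_le hab]
      exact ((((hu.continuousOn hadj).pow 2).const_mul _)).mono (Set.Icc_subset_Icc ha hb)
    have hadd := intervalIntegral.sum_integral_adjacent_intervals (a := τ p.1 p.2) (n := 2 * n)
      (f := fun t => deriv (u.edge p.1 p.2) t ^ 2 - ω ^ 2 * u.edge p.1 p.2 t ^ 2)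
      (μ := volume) (fun q hq => hii (hmem hadj hq.le).1 (hmono p hp q) (hmem hadj hq).2)
    rw [h1, h2] at hadd
    refine le_trans ?_ (mul_le_mul_of_nonneg_left hadd.le (by positivity))
    rw [Finset.mul_sum]
    refine Finset.sum_le_sum fun q hq => ?_
    dsimp only
    have hq' := Finset.mem_range.1 hq
    rw [hvaln p hp q hq'.le, hvaln p hp (q + 1) hq']
    have m1 := hmem hadj hq'.le
    have m2 := hmem hadj (q := q + 1) hq'
    refine cappedEnergy_le_integral hω hM0 (hmono p hp q)
      ((hlen p hp q).trans_lt (by linarith [pi_pos])) ((hu.1 _ _ hadj).1.mono ?_)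
      (fun t ht => hMb _ _ _ (hSm hp).1 hadj ⟨m1.1.trans ht.1, ht.2.trans m2.2⟩)
      (intervalIntegrable_sq_deriv (hu.1 _ _ hadj).2 m1.1 (hmono p hp q) m2.2)
    rw [Set.uIcc_of_le (hmono p hp q), Set.uIcc_of_le (Γ.len_nonneg _ _ hadj)]
    exact Set.Icc_subset_Icc m1.1 m2.2
  have hgood : (Net.mk edges pos val (fun a => Sum.inl (term a)) (node (i₀, j₀) n)).Good
      (fun a => ω • D a) shortCond 1 (ω * l) (l * (e - ω ^ 2) / ω) :=
    { edge_ok := fun y hy => by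
        obtain ⟨p, q, hp, hq, rfl⟩ := hedge y hy
        refine EdgeOk.mk symmCond_shortCond ?_ ?_ (hlen p hp q)
        · simp only
          rw [hposn p hp q (by omega), hposn p hp (q + 1) hq, dist_smul₀, Real.norm_eq_abs,
            abs_of_pos hω]
          exact mul_le_mul_of_nonneg_left (hγ.dist_le (hSm hp).2 (hmem (hSm hp).2 (by omega)).1
            (hmono p hp q) (hmem (hSm hp).2 hq).2) hω.le
        · intro h
          simp only
          rw [hvaln p hp q (by omega), hvaln p hp (q + 1) hq]
          have : τ p.1 p.2 (q + 1) = τ p.1 p.2 q :=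
            sub_eq_zero.1 ((mul_eq_zero.1 h).resolve_left hω.ne')
          rw [this]
      conn_edge := fun y hy v hv => by
        obtain ⟨p, q, hp, hq, rfl⟩ := hedge y hy
        rcases Sym2.mem_iff.1 hv with rfl | rfl
        · exact (hbase p.1).trans (hchain p hp q (by omega))
        · exact (hbase p.1).trans (hchain p hp (q + 1) hq)
      conn_term := fun a => hbase _
      pos_term := fun a => congrArg (ω • ·) (htD a)
      val_term := fun a => by
        change min 1 (|u.vert (term a)| / M) = 0
        rw [hu.2 _ (htW a)]
        simp
      total_le := hsumtot.le
      val_nonneg := fun v => by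
        rcases v with i | x
        · exact le_min zero_le_one (by positivity)
        · exact le_min zero_le_one (by positivity)
      val_le := fun v => by
        rcases v with i | x
        · exact min_le_left _ _
        · exact min_le_left _ _
      val_base := by
        simp only
        rw [hvaln _ hp₀ n (by omega), (hτ i₀ j₀ hadj₀).2.2.2.2 rfl rfl]
        exact div_self hM0.ne'
      capped_le := by
        unfold capped
        have : (Net.mk edges pos val (fun a => Sum.inl (term a)) (node (i₀, j₀) n)).total = ω * l :=
          hsumtot
        rw [this, sub_self, zero_mul, sub_zero]
        refine hcap.trans ?_
        -- This is 1 ≤ M²l, a consequence of the normalization of `u`.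
        have h1 : (ω * M ^ 2)⁻¹ ≤ l / ω := by
          rw [inv_le_comm₀ (by positivity) (by positivity), inv_div, div_le_iff₀ hl]
          nlinarith
        refine (mul_le_mul_of_nonneg_right h1 (by linarith)).trans (le_of_eq ?_)
        ring }
  exact hgood.exists_nat

end Net

/-! ### Rayleigh quotients exist and are bounded away from zero. -/

open Real Filter Topology

namespace MetricGraph

variable {Γ : MetricGraph} {W : Set (Fin Γ.numV)}

open Classical in
/-- On a metric graph of positive length there are nonzero functions which vanish at all
vertices. -/
theorem rayleighValues_nonempty (h : 0 < Γ.totalLength) : (Γ.rayleighValues W).Nonempty := by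
  obtain ⟨p, hp, hpos⟩ : ∃ p ∈ Finset.univ.filter
      (fun p : Fin Γ.numV × Fin Γ.numV => p.1 < p.2 ∧ Γ.graph.Adj p.1 p.2), 0 < Γ.len p.1 p.2 :=
    Finset.exists_lt_of_sum_lt (f := fun _ => 0) (by rw [Finset.sum_const_zero]; exact h)
  obtain ⟨-, hlt, hadj⟩ := Finset.mem_filter.1 hp
  set L := Γ.len p.1 p.2 with hL
  set u : Γ.Fn ℝ :=
    { vert := fun _ => 0
      -- A half wave on one edge of positive length, and zero on all others.
      edge := fun i j x => if s(i, j) = s(p.1, p.2) then sin (π * x / L) else 0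
      edge_zero := fun i j _ => by simp
      edge_symm := fun i j _ x _ => by
        rw [Sym2.eq_swap (a := j)]
        by_cases hij : s(i, j) = s(p.1, p.2)
        · have hlen : Γ.len i j = L := by
            rcases Sym2.eq_iff.1 hij with ⟨h1, h2⟩ | ⟨h1, h2⟩
            · rw [h1, h2]
            · rw [h1, h2, Γ.len_symm]
          simp only [hij, if_true, hlen]
          have : π * (L - x) / L = π - π * x / L := by field_simp
          rw [this, sin_pi_sub]
        · simp only [hij, if_false] } with hu
  have hsm : ∀ i j, ContDiff ℝ 1 (u.edge i j) := by
    intro i j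
    by_cases hij : s(i, j) = s(p.1, p.2)
    · simp only [hu, hij, if_true]; fun_prop
    · simp only [hu, hij, if_false]; exact contDiff_const
  refine ⟨_, exists_mem_rayleighValues (u := u)
    ⟨fun i j _ => isH1_of_contDiff (hsm i j) _, fun _ _ => rfl⟩ ?_⟩
  have h1 : 0 < ∫ x in (0 : ℝ)..L, u.edge p.1 p.2 x ^ 2 := by
    refine intervalIntegral.integral_pos hpos ((hsm _ _).continuous.pow 2).continuousOn
      (fun _ _ => sq_nonneg _) ⟨L / 2, ⟨by linarith, by linarith⟩, ?_⟩
    have : π * (L / 2) / L = π / 2 := by field_simp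
    simp [hu, this]
  exact h1.trans_le (Finset.single_le_sum
    (f := fun p : Fin Γ.numV × Fin Γ.numV => ∫ x in (0 : ℝ)..Γ.len p.1 p.2, u.edge p.1 p.2 x ^ 2)
    (fun q hq => intervalIntegral.integral_nonneg
      (Γ.len_nonneg _ _ (Finset.mem_filter.1 hq).2.2) fun _ _ => sq_nonneg _) hp)

open Classical in
/-- The oscillation of a function along a path is bounded by the sum of its oscillations on the
edges. -/
theorem abs_sub_le_edgeSum {y : Fin Γ.numV → ℝ} {A : Fin Γ.numV → Fin Γ.numV → ℝ}
    (hA : ∀ i j, i < j → Γ.graph.Adj i j → |y i - y j| ≤ A i j) {i j : Fin Γ.numV}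
    (h : Γ.graph.Reachable i j) : |y i - y j| ≤ Γ.edgeSum A := by
  set B : Sym2 (Fin Γ.numV) → ℝ := Sym2.lift ⟨fun i j => A (min i j) (max i j),
    fun i j => by
      change A (min i j) (max i j) = A (min j i) (max j i)
      rw [min_comm i j, max_comm i j]⟩ with hB
  have hsum : Γ.edgeSum A = ∑ e ∈ Γ.graph.edgeFinset, B e := by
    rw [← edgeSum_eq_sum_edges]
    refine Finset.sum_congr rfl fun p hp => ?_
    have := (Finset.mem_filter.1 hp).2.1.le
    simp [hB, min_eq_left this, max_eq_right this]
  have hBe : ∀ i j, Γ.graph.Adj i j → |y i - y j| ≤ B s(i, j) := by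
    intro i j hij
    rcases lt_trichotomy i j with hlt | hlt | hlt
    · simpa [hB, min_eq_left hlt.le, max_eq_right hlt.le] using hA i j hlt hij
    · exact absurd hlt hij.ne
    · rw [abs_sub_comm]
      simpa [hB, min_eq_right hlt.le, max_eq_left hlt.le] using hA j i hlt hij.symm
  have hwalk : ∀ {i j} (p : Γ.graph.Walk i j), |y i - y j| ≤ (p.edges.map B).sum := by
    intro i j p
    induction p with
    | nil => simp
    | cons h p ih =>
      rw [SimpleGraph.Walk.edges_cons, List.map_cons, List.sum_cons]
      exact (abs_sub_le _ _ _).trans (add_le_add (hBe _ _ h) ih)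
  obtain ⟨p, hp⟩ := h.exists_isPath
  refine (hwalk p).trans ?_
  rw [hsum, ← List.sum_toFinset B hp.isTrail.edges_nodup]
  refine Finset.sum_le_sum_of_subset_of_nonneg ?_ ?_
  · intro e he
    exact SimpleGraph.mem_edgeFinset.2 (p.edges_subset_edgeSet (List.mem_toFinset.1 he))
  · intro e he _
    induction e using Sym2.ind with
    | _ i j => exact (abs_nonneg _).trans (hBe i j (by simpa using he))

/-- A Poincaré inequality. -/
theorem inv_le_of_mem_rayleighValues {l e : ℝ} (hl : 0 < l) (hc : Γ.graph.Connected)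
    (ht : Γ.totalLength = l) (hW : W.Nonempty) (he : e ∈ Γ.rayleighValues W) :
    (4 * l ^ 2)⁻¹ ≤ e := by
  obtain ⟨u, hu, hu1, hue⟩ := he
  obtain ⟨i, j, t, hlt, hadj, htI, hM, -⟩ := exists_max hu hu1
  obtain ⟨v, hv⟩ := hW
  -- The weight in |u'| ≤ 1/(2a) + a u'²/2. With this choice the constant terms use up exactly half
  -- of the lower bound 1/√l for the maximum of |u|.
  set a := 2 * (l * √l) with ha
  have hsl : 0 < √l := sqrt_pos.2 hl
  have ha0 : 0 < a := by positivity
  set A : Fin Γ.numV → Fin Γ.numV → ℝ := fun i j =>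
    (2 * a)⁻¹ * Γ.len i j + a / 2 * ∫ x in (0 : ℝ)..Γ.len i j, deriv (u.edge i j) x ^ 2 with hA
  have hosc : ∀ i j, Γ.graph.Adj i j → ∀ s ∈ Set.Icc 0 (Γ.len i j),
      |u.vert i - u.edge i j s| ≤ A i j := by
    intro i j hij s hs
    have hac := (hu.1 i j hij).1
    have hmono := hac.mono (c := 0) (d := s) (by
      rw [Set.uIcc_of_le hs.1, Set.uIcc_of_le (Γ.len_nonneg i j hij)]
      exact Set.Icc_subset_Icc le_rfl hs.2)
    have hint := hmono.integral_deriv_eq_sub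
    have h2 := intervalIntegrable_sq_deriv (hu.1 i j hij).2 le_rfl (Γ.len_nonneg i j hij) le_rfl
    have h2s := intervalIntegrable_sq_deriv (hu.1 i j hij).2 le_rfl hs.1 hs.2
    rw [← u.edge_zero i j hij, abs_sub_comm, ← hint]
    refine (intervalIntegral.abs_integral_le_integral_abs hs.1).trans ?_
    have hb : ∫ x in (0 : ℝ)..s, |deriv (u.edge i j) x| ≤
        ∫ x in (0 : ℝ)..s, ((2 * a)⁻¹ + a / 2 * deriv (u.edge i j) x ^ 2) := by
      refine intervalIntegral.integral_mono_on hs.1 hmono.intervalIntegrable_deriv.abs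
        (intervalIntegrable_const.add (h2s.const_mul _)) fun x _ => ?_
      have h3 : 0 ≤ (a * |deriv (u.edge i j) x| - 1) ^ 2 / (2 * a) := by positivity
      have h4 : (a * |deriv (u.edge i j) x| - 1) ^ 2 / (2 * a) =
          (2 * a)⁻¹ + a / 2 * deriv (u.edge i j) x ^ 2 - |deriv (u.edge i j) x| := by
        rw [← sq_abs (deriv (u.edge i j) x)]
        field_simp; ring
      linarith
    refine hb.trans ?_
    rw [intervalIntegral.integral_add intervalIntegrable_const (h2s.const_mul _),
      intervalIntegral.integral_const, intervalIntegral.integral_const_mul, smul_eq_mul, sub_zero]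
    have h5 : ∫ x in (0 : ℝ)..s, deriv (u.edge i j) x ^ 2 ≤
        ∫ x in (0 : ℝ)..Γ.len i j, deriv (u.edge i j) x ^ 2 :=
      intervalIntegral.integral_mono_interval le_rfl hs.1 hs.2
        (ae_of_all _ fun _ => sq_nonneg _) h2
    have h6 : s * (2 * a)⁻¹ ≤ (2 * a)⁻¹ * Γ.len i j := by
      rw [mul_comm]; exact mul_le_mul_of_nonneg_left hs.2 (by positivity)
    exact add_le_add h6 (mul_le_mul_of_nonneg_left h5 (by positivity))
  have hA0 : ∀ i j, Γ.graph.Adj i j → 0 ≤ A i j := fun i j h =>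
    (abs_nonneg _).trans (hosc i j h 0 ⟨le_rfl, Γ.len_nonneg i j h⟩)
  have hpath := abs_sub_le_edgeSum (y := u.vert) (A := A) (fun i j _ h => by
    have := hosc i j h _ ⟨Γ.len_nonneg i j h, le_rfl⟩
    rwa [u.edge_len h] at this) (hc.preconnected i v)
  have hedge : A i j ≤ Γ.edgeSum A := by
    classical
    exact Finset.single_le_sum (f := fun p : Fin Γ.numV × Fin Γ.numV => A p.1 p.2)
      (fun q hq => hA0 _ _ (Finset.mem_filter.1 hq).2.2)
      (Finset.mem_filter.2 ⟨Finset.mem_univ (i, j), hlt, hadj⟩)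
  have hAs : Γ.edgeSum A = (2 * a)⁻¹ * l + a / 2 * e := by
    have : Γ.edgeSum A = (2 * a)⁻¹ * Γ.totalLength + a / 2 * Γ.gradSqIntegral u := by
      unfold totalLength gradSqIntegral
      rw [← edgeSum_const_mul, ← edgeSum_const_mul]
      exact Finset.sum_add_distrib
    rw [this, ht, hue]
  rw [hu.2 v hv, sub_zero] at hpath
  have h1 := hosc i j hadj t htI
  have h2 : |u.edge i j t| ≤ 2 * ((2 * a)⁻¹ * l + a / 2 * e) := by
    rw [← hAs]
    have := abs_sub_abs_le_abs_sub (u.edge i j t) (u.vert i)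
    rw [abs_sub_comm] at this
    linarith
  have h3 : 2 * ((2 * a)⁻¹ * l + a / 2 * e) = (2 * √l)⁻¹ + a * e := by
    rw [ha]; field_simp
  rw [h3] at h2
  rw [ht, ← sq_abs] at hM
  have h4 : (√l)⁻¹ ≤ |u.edge i j t| := by
    refine le_of_sq_le_sq ?_ (abs_nonneg _)
    rw [inv_pow, sq_sqrt hl.le, inv_le_iff_one_le_mul₀ hl]
    exact hM
  have h5 : (√l)⁻¹ = (2 * √l)⁻¹ + (2 * √l)⁻¹ := by field_simp; norm_num
  have h6 : (2 * √l)⁻¹ ≤ a * e := by linarith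
  have h7 : (2 * √l)⁻¹ = a * (4 * l ^ 2)⁻¹ := by
    rw [ha]; field_simp
    rw [sq_sqrt hl.le]; ring
  rw [h7] at h6
  exact le_of_mul_le_mul_left h6 ha0

end MetricGraph

/-! ### Nets from connected sets of finite length. -/

open Real Filter Topology

open scoped NNReal in
/-- A set of length less than `L` has an open cover by small sets whose diameters add up to at
most `L`. -/
theorem exists_open_cover_of_hausdorffMeasure_lt {X : Type} [MetricSpace X] [MeasurableSpace X]
    [BorelSpace X] {C : Set X} {L δ : ℝ} (hδ : 0 < δ)
    (hC : Measure.hausdorffMeasure 1 C < ENNReal.ofReal L) :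
    ∃ (U : ℕ → Set X) (w : ℕ → ℝ), (∀ n, IsOpen (U n)) ∧ C ⊆ ⋃ n, U n ∧
      (∀ n, ∀ x ∈ U n, ∀ y ∈ U n, dist x y ≤ w n) ∧ (∀ n, 0 ≤ w n) ∧ (∀ n, w n ≤ δ) ∧
      ∀ s : Finset ℕ, ∑ n ∈ s, w n ≤ L := by
  obtain ⟨a, ha1, ha2⟩ := exists_between hC
  rw [Measure.hausdorffMeasure_apply] at ha1
  have hδ' : 0 < ENNReal.ofReal (δ / 2) := ENNReal.ofReal_pos.2 (by linarith)
  have h1 := (le_iSup₂ (f := fun (r : ℝ≥0∞) (_ : 0 < r) =>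
    ⨅ (t : ℕ → Set X) (_ : C ⊆ ⋃ n, t n) (_ : ∀ n, Metric.ediam (t n) ≤ r),
      ∑' n, ⨆ _ : (t n).Nonempty, Metric.ediam (t n) ^ (1 : ℝ)) _ hδ').trans_lt ha1
  simp only [iInf_lt_iff] at h1
  obtain ⟨t, ht1, ht2, ht3⟩ := h1
  have hsup : ∀ n, (⨆ _ : (t n).Nonempty, Metric.ediam (t n) ^ (1 : ℝ)) = Metric.ediam (t n) := by
    intro n
    rcases (t n).eq_empty_or_nonempty with h | h <;> simp [h]
  simp only [hsup] at ht3
  have hpos : min ((ENNReal.ofReal L - a) / 2) (ENNReal.ofReal (δ / 4)) ≠ 0 := by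
    have h2 : 0 < (ENNReal.ofReal L - a) / 2 := ENNReal.half_pos (tsub_pos_of_lt ha2).ne'
    have h3 : 0 < ENNReal.ofReal (δ / 4) := ENNReal.ofReal_pos.2 (by linarith)
    exact (lt_min h2 h3).ne'
  -- Radii for thickening the cover to an open one. Their sum is small enough both for the total L
  -- and for the bound δ on each diameter.
  obtain ⟨η, hη0, hη⟩ := ENNReal.exists_pos_sum_of_countable hpos ℕ
  have hb : ∀ n, Metric.ediam (t n) + 2 * (η n : ℝ≥0∞) ≤ ENNReal.ofReal δ := by
    intro n
    have h3 : (η n : ℝ≥0∞) ≤ ENNReal.ofReal (δ / 4) :=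
      (ENNReal.le_tsum n).trans (hη.le.trans (min_le_right _ _))
    calc _ ≤ ENNReal.ofReal (δ / 2) + 2 * ENNReal.ofReal (δ / 4) := by
          gcongr; exact ht2 n
      _ = ENNReal.ofReal δ := by
          rw [← ENNReal.ofReal_ofNat 2, ← ENNReal.ofReal_mul (by norm_num),
            ← ENNReal.ofReal_add (by linarith) (by linarith)]
          congr 1; ring
  have hfin : ∀ n, Metric.ediam (t n) + 2 * (η n : ℝ≥0∞) ≠ ⊤ := fun n =>
    ne_top_of_le_ne_top ENNReal.ofReal_ne_top (hb n)
  refine ⟨fun n => Metric.thickening (η n) (t n),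
    fun n => (Metric.ediam (t n) + 2 * (η n : ℝ≥0∞)).toReal, fun n => Metric.isOpen_thickening,
    ht1.trans (Set.iUnion_mono fun n => Metric.self_subset_thickening (hη0 n) _), ?_,
    fun n => ENNReal.toReal_nonneg, fun n => ENNReal.toReal_le_of_le_ofReal hδ.le (hb n), ?_⟩
  · intro n x hx y hy
    rw [dist_edist]
    exact ENNReal.toReal_mono (hfin n)
      ((Metric.edist_le_ediam_of_mem hx hy).trans (Metric.ediam_thickening_le _))
  · intro s
    rw [← ENNReal.toReal_sum fun n _ => hfin n]
    have hL : 0 ≤ L := by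
      by_contra h
      rw [ENNReal.ofReal_of_nonpos (by linarith)] at hC
      exact not_lt_zero hC
    refine ENNReal.toReal_le_of_le_ofReal hL ?_
    calc ∑ n ∈ s, (Metric.ediam (t n) + 2 * (η n : ℝ≥0∞))
        ≤ ∑' n, (Metric.ediam (t n) + 2 * (η n : ℝ≥0∞)) := ENNReal.sum_le_tsum s
      _ = ∑' n, Metric.ediam (t n) + 2 * ∑' n, (η n : ℝ≥0∞) := by
          rw [ENNReal.tsum_add, ENNReal.tsum_mul_left]
      _ ≤ a + 2 * ((ENNReal.ofReal L - a) / 2) := by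
          gcongr
          exact hη.le.trans (min_le_left _ _)
      _ = ENNReal.ofReal L := by
          rw [ENNReal.mul_div_cancel (by norm_num) (by norm_num), add_tsub_cancel_of_le ha2.le]

/-- Two indices are adjacent if the corresponding sets meet. -/
def intersectionGraph {X : Type} (U : ℕ → Set X) : SimpleGraph ℕ where
  Adj n m := n ≠ m ∧ (U n ∩ U m).Nonempty
  symm := ⟨fun _ _ h => ⟨h.1.symm, by rw [Set.inter_comm]; exact h.2⟩⟩
  loopless := ⟨fun _ h => h.1 rfl⟩

/-- Otherwise the sets reachable from `i` and the remaining ones have open unions which both meet C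
and cover it. They share a point of C, so a reachable set meets an unreachable one. -/
theorem IsPreconnected.reachable_intersectionGraph {X : Type} [TopologicalSpace X] {C : Set X}
    (hC : IsPreconnected C) {U : ℕ → Set X} (hU : ∀ n, IsOpen (U n)) (hCU : C ⊆ ⋃ n, U n)
    {x y : X} (hx : x ∈ C) (hy : y ∈ C) {i j : ℕ} (hi : x ∈ U i) (hj : y ∈ U j) :
    (intersectionGraph U).Reachable i j := by
  by_contra hn
  obtain ⟨z, -, hz1, hz2⟩ := hC (⋃ n ∈ {n | (intersectionGraph U).Reachable i n}, U n)
    (⋃ n ∈ {n | ¬ (intersectionGraph U).Reachable i n}, U n)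
    (isOpen_biUnion fun n _ => hU n) (isOpen_biUnion fun n _ => hU n)
    (fun z hz => by
      obtain ⟨n, hn⟩ := Set.mem_iUnion.1 (hCU hz)
      by_cases h : (intersectionGraph U).Reachable i n
      · exact Or.inl (Set.mem_biUnion (show n ∈ {n | _} from h) hn)
      · exact Or.inr (Set.mem_biUnion (show n ∈ {n | _} from h) hn))
    ⟨x, hx, Set.mem_biUnion (show i ∈ {n | _} from SimpleGraph.Reachable.refl _) hi⟩
    ⟨y, hy, Set.mem_biUnion (show j ∈ {n | _} from hn) hj⟩
  obtain ⟨n, hn1, hn2⟩ := Set.mem_iUnion₂.1 hz1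
  obtain ⟨m, hm1, hm2⟩ := Set.mem_iUnion₂.1 hz2
  apply hm1
  rcases eq_or_ne n m with rfl | hnm
  · exact hn1
  · exact SimpleGraph.Reachable.trans hn1
      (SimpleGraph.Adj.reachable (show (intersectionGraph U).Adj n m from ⟨hnm, z, hn2, hm2⟩))

/-- A network of total length at most `T` which joins the points of `S` to the point `o`, with
edges of length at most `δ`, and which touches the sets `U i` with `i ∈ I`. -/
structure Network {X : Type} [MetricSpace X] (U : ℕ → Set X) (δ : ℝ) (o : X) (S : Set X)
    (I : Finset ℕ) (T : ℝ) (m : Multiset (Sym2 X × ℝ)) : Prop where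
  edge_ok : ∀ e ∈ m, ∀ x y, e.1 = s(x, y) → dist x y ≤ e.2 ∧ e.2 ≤ δ
  conn_edge : ∀ e ∈ m, ∀ x ∈ e.1, Conn m o x
  conn : ∀ x ∈ S, Conn m o x
  touch : ∀ i ∈ I, ∃ x ∈ U i, Conn m o x
  length_le : (m.map Prod.snd).sum ≤ T

namespace Network

variable {X : Type} [MetricSpace X] {U : ℕ → Set X} {δ : ℝ} {o : X} {S : Set X} {I : Finset ℕ}
  {T : ℝ} {m : Multiset (Sym2 X × ℝ)}

/-- Adding an edge to a network. -/
theorem cons (hm : Network U δ o S I T m) {x y : X} {r : ℝ} (hx : Conn m o x) (h : dist x y ≤ r)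
    (hr : r ≤ δ) : Network U δ o (insert y S) I (T + r) ((s(x, y), r) ::ₘ m) := by
  have hmono : ∀ {z}, Conn m o z → Conn ((s(x, y), r) ::ₘ m) o z := fun hz =>
    hz.mono fun e he => Multiset.mem_cons_of_mem he
  have hy : Conn ((s(x, y), r) ::ₘ m) o y :=
    (hmono hx).trans (Conn.of_mem (Multiset.mem_cons_self _ _))
  refine ⟨?_, ?_, ?_, fun i hi => ?_, ?_⟩
  · intro e he a b hab
    rcases Multiset.mem_cons.1 he with rfl | he
    · rcases Sym2.eq_iff.1 hab with ⟨rfl, rfl⟩ | ⟨rfl, rfl⟩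
      · exact ⟨h, hr⟩
      · exact ⟨by rwa [dist_comm], hr⟩
    · exact hm.edge_ok e he a b hab
  · intro e he z hz
    rcases Multiset.mem_cons.1 he with rfl | he
    · rcases Sym2.mem_iff.1 hz with rfl | rfl
      · exact hmono hx
      · exact hy
    · exact hmono (hm.conn_edge e he z hz)
  · rintro z (rfl | hz)
    · exact hy
    · exact hmono (hm.conn z hz)
  · obtain ⟨z, hz, hc⟩ := hm.touch i hi
    exact ⟨z, hz, hmono hc⟩
  · have := hm.length_le
    simp only [Multiset.map_cons, Multiset.sum_cons]; linarith

/-- A point is joined to a network along a chain of sets, each set of the chain which the network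
does not touch being crossed once. -/
theorem exists_join {w : ℕ → ℝ} (hw : ∀ n, ∀ x ∈ U n, ∀ y ∈ U n, dist x y ≤ w n)
    (hwδ : ∀ n, w n ≤ δ) (hm : Network U δ o S I (∑ i ∈ I, w i + T) m) {i j : ℕ}
    (c : (intersectionGraph U).Walk i j) (hc : c.IsPath) (hj : j ∈ I) {y : X} (hy : y ∈ U i) :
    ∃ I' m', I ⊆ I' ∧ (∀ n ∈ I', n ∈ I ∨ n ∈ c.support) ∧
      Network U δ o (insert y S) I' (∑ i ∈ I', w i + (T + δ)) m' := by
  -- Inside a set which is already touched one more edge suffices; it is paid for by the additional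
  -- δ.
  have hjoin : ∀ i ∈ I, ∀ y ∈ U i,
      ∃ m', Network U δ o (insert y S) I (∑ i ∈ I, w i + (T + δ)) m' := by
    intro i hi y hy
    obtain ⟨x, hx, hox⟩ := hm.touch i hi
    have key := hm.cons hox ((hw _ x hx y hy).trans (hwδ _)) le_rfl
    rw [add_assoc] at key
    exact ⟨_, key⟩
  induction c generalizing y with
  | nil =>
    obtain ⟨m', hm'⟩ := hjoin _ hj y hy
    exact ⟨I, m', subset_rfl, fun n hn => Or.inl hn, hm'⟩
  | @cons i i' j h c ih =>
    by_cases hi : i ∈ I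
    · obtain ⟨m', hm'⟩ := hjoin _ hi y hy
      exact ⟨I, m', subset_rfl, fun n hn => Or.inl hn, hm'⟩
    · rw [SimpleGraph.Walk.cons_isPath_iff] at hc
      obtain ⟨x, hx, hx'⟩ := h.2
      obtain ⟨I', m', hI, hI', hm'⟩ := ih hc.1 hj hx'
      have hiI : i ∉ I' := fun h => (hI' i h).elim hi hc.2
      -- Crossing a set which is new to the network is paid for by its own term in the sum over
      -- `insert i I'`.
      have key := hm'.cons (hm'.conn x (Set.mem_insert _ _)) (hw _ x hx y hy) (hwδ i)
      refine ⟨insert i I', _, hI.trans (Finset.subset_insert _ _), fun n hn => ?_,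
        key.edge_ok, key.conn_edge, fun z hz => key.conn z ?_, fun n hn => ?_, ?_⟩
      · rcases Finset.mem_insert.1 hn with rfl | hn
        · exact Or.inr (by simp)
        · exact (hI' n hn).imp id fun h => by simp [h]
      · rcases hz with rfl | hz
        · exact Set.mem_insert _ _
        · exact Set.mem_insert_of_mem _ (Set.mem_insert_of_mem _ hz)
      · rcases Finset.mem_insert.1 hn with rfl | hn
        · exact ⟨y, hy, key.conn y (Set.mem_insert _ _)⟩
        · exact key.touch n hn
      · rw [Finset.sum_insert hiI]
        linarith [key.length_le]

/-- Finitely many points of a connected set are joined by a network whose length is almost the sum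
of the diameters of finitely many sets which cover the connected set. -/
theorem exists_of_isPreconnected {C : Set X} (hC : IsPreconnected C) (hU : ∀ n, IsOpen (U n))
    (hCU : C ⊆ ⋃ n, U n) {w : ℕ → ℝ} (hw : ∀ n, ∀ x ∈ U n, ∀ y ∈ U n, dist x y ≤ w n)
    (hw0 : ∀ n, 0 ≤ w n) (hwδ : ∀ n, w n ≤ δ) (ho : o ∈ C) {k : ℕ} (D : Fin k → X)
    (hD : ∀ a, D a ∈ C) :
    ∃ I m, Network U δ o (Set.range D) I (∑ i ∈ I, w i + k * δ) m := by
  obtain ⟨j, hj⟩ := Set.mem_iUnion.1 (hCU ho)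
  suffices h : ∀ s : Finset (Fin k), ∃ I m, j ∈ I ∧
      Network U δ o (D '' s) I (∑ i ∈ I, w i + s.card * δ) m by
    obtain ⟨I, m, -, h⟩ := h Finset.univ
    refine ⟨I, m, ?_⟩
    simpa using h
  classical
  intro s
  induction s using Finset.induction_on with
  | empty =>
    refine ⟨{j}, 0, by simp, by simp, by simp, by simp, ?_, ?_⟩
    · intro i hi
      rw [Finset.mem_singleton.1 hi]
      exact ⟨o, hj, Conn.refl _⟩
    · simpa using hw0 j
  | insert a s ha ih =>
    obtain ⟨I, m, hjI, hm⟩ := ih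
    obtain ⟨i, hi⟩ := Set.mem_iUnion.1 (hCU (hD a))
    obtain ⟨c, hc⟩ := (hC.reachable_intersectionGraph hU hCU (hD a) ho hi hj).exists_isPath
    obtain ⟨I', m', h1, -, h2⟩ := hm.exists_join hw hwδ c hc hjI hi
    refine ⟨I', m', h1 hjI, ?_⟩
    rw [Finset.coe_insert, Set.image_insert_eq, Finset.card_insert_of_notMem ha]
    convert h2 using 2
    push_cast; ring

end Network

open Classical in
/-- Points in a connected set of length at most `l` are joined by nets of length almost `l`. -/
theorem Net.exists_good_of_steinerLength_le {k d : ℕ} {D : Fin k → EuclideanSpace ℝ (Fin d)}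
    (a₀ : Fin k) {l : ℝ} (hl : 0 < l) (hSt : steinerLength (Set.range D) ≤ ENNReal.ofReal l)
    {ε : ℝ} (hε : 0 < ε) :
    ∃ G : Net k (EuclideanSpace ℝ (Fin d)) ℕ, G.Good D shortCond 0 (l + ε) ε := by
  have hlt : steinerLength (Set.range D) < ENNReal.ofReal (l + ε / 2) :=
    hSt.trans_lt ((ENNReal.ofReal_lt_ofReal_iff (by linarith)).2 (by linarith))
  simp only [steinerLength, iInf_lt_iff] at hlt
  obtain ⟨C, ⟨-, hC, hDC⟩, hlt⟩ := hlt
  have hk : (0 : ℝ) < k := by exact_mod_cast a₀.pos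
  set δ := min (π / 2) (ε / 2 / k) with hδ
  have hδ0 : 0 < δ := lt_min (by positivity) (by positivity)
  obtain ⟨U, w, hU, hCU, hw, hw0, hwδ, hsum⟩ := exists_open_cover_of_hausdorffMeasure_lt hδ0 hlt
  obtain ⟨I, m, hm⟩ := Network.exists_of_isPreconnected hC.isPreconnected hU hCU hw hw0 hwδ
    (hDC (Set.mem_range_self a₀)) D fun a => hDC (Set.mem_range_self a)
  have hkδ : k * δ ≤ ε / 2 := by
    calc k * δ ≤ k * (ε / 2 / k) := by gcongr; exact min_le_right _ _
      _ = ε / 2 := by field_simp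
  -- Points serve as their own labels. All values are zero and c = 0, so the energy condition is
  -- void and only lengths matter.
  let G : Net k (EuclideanSpace ℝ (Fin d)) (EuclideanSpace ℝ (Fin d)) :=
    { edges := m, pos := id, val := fun _ => 0, term := D, base := D a₀ }
  refine Good.exists_nat (G := G)
    { edge_ok := fun e he x y hxy => ⟨(hm.edge_ok e he x y hxy).1, fun _ => rfl,
        (hm.edge_ok e he x y hxy).2.trans (min_le_left _ _)⟩
      conn_edge := hm.conn_edge
      conn_term := fun a => hm.conn _ (Set.mem_range_self a)
      pos_term := fun a => rfl
      val_term := fun a => rfl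
      total_le := hm.length_le.trans (by linarith [hsum I])
      val_nonneg := fun v => le_rfl
      val_le := fun v => le_rfl
      val_base := rfl
      capped_le := ?_ }
  have : G.capped 0 (l + ε) = 0 := by
    have h0 : ∀ e ∈ G.edges, symCapped 0 e.2 (e.1.map G.val) = 0 := by
      rintro ⟨e, h⟩ -
      induction e using Sym2.ind with
      | _ x y => simp [G, cappedEnergy]
    simp [Net.capped, Multiset.map_congr rfl h0]
  rw [this]; exact hε.le

/-! ### The minimizer. -/

open Real Filter Topology

/-- There is an admissible pair. -/
theorem Net.exists_isAdmissible {k d : ℕ} [Nontrivial (EuclideanSpace ℝ (Fin d))]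
    {D : Fin k → EuclideanSpace ℝ (Fin d)} (a₀ : Fin k) {l : ℝ} (hl : 0 < l)
    (hSt : steinerLength (Set.range D) ≤ ENNReal.ofReal l) :
    ∃ (Γ : MetricGraph) (W : Set (Fin Γ.numV)), Γ.IsAdmissible (Set.range D) l W := by
  -- With zero values the compactness result produces a connecting net of length at most l. Pendant
  -- edges and straightening then give the exact length.
  obtain ⟨G₁, h1⟩ := exists_good_of_forall_pos (c := 0) (ℓ := l) a₀ fun ε hε =>
    exists_good_of_steinerLength_le a₀ hl hSt hε
  obtain ⟨G₂, h2⟩ := exists_isMinimal (h1.mono_cond fun _ _ _ => shortCond.properCond)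
  obtain ⟨G₃, V, h3, h4, h5, h6, h7, -⟩ := exists_tight_total_eq h2.1.toValid h2.simple
  obtain ⟨Γ, W, -, h8, -⟩ := exists_metricGraph (D := D) (ω := 1) (l := l) one_pos a₀
    (by simpa using h3) h4 h5 h6 (by simpa using h7)
  exact ⟨Γ, W, h8⟩

theorem mainTheorem8 (d k : ℕ) (hd : 1 ≤ d) (hk : 1 ≤ k)
    (D : Fin k → EuclideanSpace ℝ (Fin d)) (hD : Function.Injective D)
    (l : ℝ) (hl : 0 < l) (hSt : steinerLength (Set.range D) ≤ ENNReal.ofReal l) :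
    ∃ (Γ : MetricGraph) (W : Set (Fin Γ.numV)),
      Γ.IsAdmissible (Set.range D) l W ∧
      IsLeast (Γ.rayleighValues W) (Γ.lambda1 W) ∧
      (∀ (Γ' : MetricGraph) (W' : Set (Fin Γ'.numV)),
        Γ'.IsAdmissible (Set.range D) l W' → Γ.lambda1 W ≤ Γ'.lambda1 W') ∧
      Γ.graph.IsTree ∧ Γ.numV ≤ 2 * k ∧ Γ.graph.edgeSet.ncard ≤ 2 * k - 1 := by
  have : Nonempty (Fin d) := ⟨⟨0, hd⟩⟩
  have : Nontrivial (EuclideanSpace ℝ (Fin d)) := inferInstance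
  let a₀ : Fin k := ⟨0, hk⟩
  set R : Set ℝ := {e | ∃ (Γ : MetricGraph) (W : Set (Fin Γ.numV)),
    Γ.IsAdmissible (Set.range D) l W ∧ e ∈ Γ.rayleighValues W} with hR
  have hne : ∀ (Γ : MetricGraph) (W : Set (Fin Γ.numV)), Γ.IsAdmissible (Set.range D) l W →
      (Γ.rayleighValues W).Nonempty := fun Γ W h =>
    MetricGraph.rayleighValues_nonempty (by rw [h.2.1]; exact hl)
  have hRne : R.Nonempty := by
    obtain ⟨Γ, W, h⟩ := Net.exists_isAdmissible a₀ hl hSt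
    obtain ⟨e, he⟩ := hne Γ W h
    exact ⟨e, Γ, W, h, he⟩
  have hRle : ∀ e ∈ R, (4 * l ^ 2)⁻¹ ≤ e := by
    rintro e ⟨Γ, W, ⟨hc, ht, γ, -, hγ⟩, he⟩
    refine MetricGraph.inv_le_of_mem_rayleighValues hl hc ht ?_ he
    rw [← Set.image_nonempty (f := γ.vert), hγ]
    exact ⟨D a₀, Set.mem_range_self a₀⟩
  set Λ := sInf R with hΛ
  have hΛle : ∀ e ∈ R, Λ ≤ e := fun e he => csInf_le ⟨_, hRle⟩ he
  have hΛ0 : 0 < Λ := lt_of_lt_of_le (by positivity) (le_csInf hRne hRle)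
  set ω := √Λ with hω
  have hω0 : 0 < ω := sqrt_pos.2 hΛ0
  have hω2 : ω ^ 2 = Λ := sq_sqrt hΛ0.le
  -- A net of negative energy would give an admissible graph and a function on it with Rayleigh
  -- quotient below Λ.
  have hF : ∀ G : Net k (EuclideanSpace ℝ (Fin d)) ℕ,
      G.Valid (fun a => ω • D a) properCond (ω * l) → G.Simple → 0 ≤ G.energy (ω * l) := by
    intro G hG hS
    obtain ⟨G', V, h1, h2, h3, h4, h5, h6⟩ := Net.exists_tight_total_eq hG hS
    obtain ⟨Γ, W, u, b1, b2, b3, -⟩ := Net.exists_metricGraph hω0 a₀ h1 h2 h3 h4 h5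
    by_contra hneg
    have hE : ω * G'.energy (ω * l) < 0 := mul_neg_of_pos_of_neg hω0 (by linarith)
    have hg := Γ.gradSqIntegral_nonneg u
    have hs : 0 < Γ.sqIntegral u := by
      refine lt_of_le_of_ne (Γ.sqIntegral_nonneg u) fun h => ?_
      rw [← h] at b3
      linarith
    have := hΛle _ ⟨Γ, W, b1, MetricGraph.exists_mem_rayleighValues b2 hs⟩
    rw [le_div_iff₀ hs, ← hω2] at this
    linarith
  -- A competitor with quotient less than Λ + εω/l has a net of capped energy at most ε.
  obtain ⟨G, hG⟩ := Net.exists_good_of_forall_pos (D := fun a => ω • D a) (c := 1) (ℓ := ω * l) a₀ <| by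
    intro ε hε
    have hpos : 0 < ε * ω / l := by positivity
    obtain ⟨e, ⟨Γ, W, hΓ, he⟩, hlt⟩ := exists_lt_of_csInf_lt hRne (show Λ < Λ + ε * ω / l by linarith)
    obtain ⟨G, hG⟩ := Net.exists_good_of_mem_rayleighValues hω0 hl hΓ he
      (hω2.le.trans (hΛle e ⟨Γ, W, hΓ, he⟩))
    refine ⟨G, { hG.add_length hε.le with
      capped_le := (hG.add_length hε.le).capped_le.trans ?_ }⟩
    rw [hω2, div_le_iff₀ hω0]
    calc l * (e - Λ) ≤ l * (ε * ω / l) := by gcongr; linarith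
      _ = ε * ω := by field_simp
  have hDω : Function.Injective fun a => ω • D a :=
    (smul_right_injective _ hω0.ne').comp hD
  obtain ⟨G', V, h1, h2, h3, h4, h5, h6, h7, h8, h9⟩ := Net.exists_tight_tree hF hDω a₀
    (hG.mono_cond fun _ _ _ => shortCond.properCond)
  obtain ⟨Γ, W, u, b1, b2, b3, b4, b5, b6⟩ := Net.exists_metricGraph hω0 a₀ h1 h2 h3 h4 h5
  have hs : 0 < Γ.sqIntegral u := by
    refine lt_of_le_of_ne (Γ.sqIntegral_nonneg u) fun h => ?_
    rw [b4 h.symm] at h9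
    exact zero_ne_one h9
  -- The energy is at most zero by construction and at least zero by `hF`, so the quotient of `u` is
  -- exactly Λ.
  have hmem : Λ ∈ Γ.rayleighValues W := by
    rw [le_antisymm h6 (hF G' h1 h2), mul_zero, hω2, sub_eq_zero] at b3
    have := MetricGraph.exists_mem_rayleighValues b2 hs
    rwa [b3, mul_div_cancel_right₀ _ hs.ne'] at this
  have hleast : IsLeast (Γ.rayleighValues W) Λ :=
    ⟨hmem, fun e he => hΛle e ⟨Γ, W, b1, he⟩⟩
  have hl1 : Γ.lambda1 W = Λ := hleast.csInf_eq
  refine ⟨Γ, W, b1, by rw [hl1]; exact hleast, fun Γ' W' h' => ?_, ?_, by rw [b5]; exact h7, ?_⟩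
  · rw [hl1]
    exact le_csInf (hne Γ' W' h') fun e he => hΛle e ⟨Γ', W', h', he⟩
  · refine SimpleGraph.isTree_iff_connected_and_card.2 ⟨b1.1, ?_⟩
    rw [b6, Nat.card_eq_fintype_card, Fintype.card_fin, b5]
    exact h8
  · rw [← Nat.card_coe_set_eq, b6]
    omega
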